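/- **The game.** A die has faces $0,1,\dots,n$ with probabilities $p_0,\dots,p_n$, where $p_i\ge 0$, $\sum_i p_i=1$ and $p_0<1$. In the *generalized pig game* with target $N\ge 1$ two players take turns, and the first to bank $N$ points wins. A state is either "game over" or a tuple $(a,b,\tau,j)$: players one and two still need $a$ and $b$ points ($1\le a,b\le N$), player $j\in\{1,2\}$ is on turn and has turn score $\tau$, with $0\le\tau\le a+n-1$ if $j=1$ and $0\le\tau\le b+n-1$ if $j=2$. Let $\mathbf s$ be the number of states. Player one's moves (player two's are symmetric) are: at $\tau=0$ he has to roll; at $0<\tau<a$ he rolls or holds; at $\tau\ge a$ he has to hold, and wins. A roll leads to $(a,b,0,2)$ with probability $p_0$ and to $(a,b,\tau+i,1)$ with probability $p_i$, $i=1,\dots,n$; holding at $0<\tau<a$ leads to $(a-\tau,b,0,2)$. Player one maximizes, and player two minimizes, the probability that player one wins; both may use behavioral (history-dependent, randomized) strategies. Let $v(a,b,\tau)$ be the value of the game started at $(a,b,\tau,1)$, and $v(a,b)=v(a,b,0)$. **Theorem.** There is an algorithm (one program for a real random access machine with exact unit-cost arithmetic and comparison of real numbers, with input $n,N,p_0,\dots,p_n$)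 that always halts and outputs the table of the numbers $v(a,b,\tau)$ and a decision (roll or hold) for each $(a,b,\tau)$, where $1\le a,b\le N$, $0\le\tau<a$. The game started at any state has a value, which is given by the table: it is $v(a,b,\tau)$ (which is $1$ if $\tau\ge a$) at $(a,b,\tau,1)$, it is $1-v(b,a,\tau)$ at $(a,b,\tau,2)$, and it is $0$ at "game over". The decisions define, for each of the two players, a stationary deterministic strategy that is optimal, from every state, among all behavioral strategies. For each fixed $n$, the number of steps is $O(N^3\log N)$ and also $O(\mathbf s\log\mathbf s)$ as $N\to\infty$, with constants that do not depend on $p_0,\dots,p_n$. Moreover, for $1\le a,b\le N$ define $f_{a,b,i}(y)=1$ for $i\le 0$, $$f_{a,b,i}(y)=\max\Big\{1-v(b,i),\ p_0(1-y)+\sum_{k=1}^n p_k f_{a,b,i-k}(y)\Big\}\quad(1\le i<a),$$ and $f_{a,b}(y)=p_0(1-y)+\sum_{k=1}^n p_k f_{a,b,a-k}(y)$, which involve only the values $v(b,i)$ with $i<a$, that is, values of smaller sub-games. Then $(x,y)=(v(a,b),v(b,a))$ is the unique solution in $[0,1]^2$ of the system $x=f_{a,b}(y)$, $y=f_{b,a}(x)$,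 and $v(a,b,a-i)=f_{a,b,i}(v(b,a))$ for $1\le i<a$. -/

import Mathlib

open scoped ENNReal

namespace GenPig

/-! ## The generalized pig game -/

inductive Player
  | one
  | two

inductive Action
  | roll
  | hold

/-- `turn j a b τ`: players one and two still need `a` and `b` points, player `j` is on turn and
has turn score `τ`.  `go` is the absorbing state "game over". -/
inductive State
  | go
  | turn (j : Player) (a b τ : ℕ)

def Player.other : Player → Player
  | .one => .two
  | .two => .one

/-- Points that player `j` still needs. -/
def Player.need (j : Player) (a b : ℕ) : ℕ :=
  match j with
  | .one => a
  | .two => b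

/-- The states of the game with target `N` and a die with faces `0, …, n`. -/
def stateSet (n N : ℕ) : Set State :=
  {s | match s with
    | .go => True
    | .turn j a b τ => (1 ≤ a ∧ a ≤ N) ∧ (1 ≤ b ∧ b ≤ N) ∧ τ < j.need a b + n}

/-- The number of states of the game. -/
noncomputable def numStates (n N : ℕ) : ℕ := (stateSet n N).ncard

/-- A history: the past states in the order in which they were visited, and the current state.
(In states where there is a choice, the action taken can be read off from the next state, so
recording the actions as well would add no information.) -/
structure History where
  past : List State
  current : State

/-- A behavioral strategy: a randomized action for every history.  It is consulted only where the
player has a choice. -/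
abbrev Strategy : Type := History → PMF Action

/-- The state reached from `turn j a b τ` if the die shows `i`. -/
def afterRoll {n : ℕ} (j : Player) (a b τ : ℕ) (i : Fin (n + 1)) : State :=
  if i = 0 then .turn j.other a b 0 else .turn j a b (τ + i)

/-- The state reached from `turn j a b τ` by holding, if holding does not yet win. -/
def afterHold (j : Player) (a b τ : ℕ) : State :=
  match j with
  | .one => .turn .two (a - τ) b 0
  | .two => .turn .one a (b - τ) 0

/-- Law of the state reached by a roll; `p` is the law of the die. -/
noncomputable def rollLaw {n : ℕ} (p : PMF (Fin (n + 1))) (j : Player) (a b τ : ℕ) : PMF State :=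
  p.map (afterRoll j a b τ)

/-- Law of the next state.  With turn score `0` the player has to roll; with a turn score that
reaches what he needs he has to hold and the game is over; otherwise he follows his strategy. -/
noncomputable def nextState {n : ℕ} (p : PMF (Fin (n + 1))) (σ₁ σ₂ : Strategy) (h : History) :
    PMF State :=
  match h.current with
  | .go => PMF.pure .go
  | .turn j a b τ =>
    if j.need a b ≤ τ then PMF.pure .go
    else if τ = 0 then rollLaw p j a b τ
    else ((match j with
        | .one => σ₁
        | .two => σ₂) h).bind fun act =>
      match act with
      | .roll => rollLaw p j a b τ
      | .hold => PMF.pure (afterHold j a b τ)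

/-- Law of the history after `t` moves, starting from `s₀`. -/
noncomputable def historyLaw {n : ℕ} (p : PMF (Fin (n + 1))) (σ₁ σ₂ : Strategy) (s₀ : State) :
    ℕ → PMF History
  | 0 => PMF.pure ⟨[], s₀⟩
  | t + 1 => (historyLaw p σ₁ σ₂ s₀ t).bind fun h =>
      (nextState p σ₁ σ₂ h).map fun s => ⟨h.past ++ [h.current], s⟩

/-- The states in which player one holds and wins. -/
def State.Winning (s : State) : Prop :=
  match s with
  | .go => False
  | .turn .one a _ τ => a ≤ τ
  | .turn .two _ _ _ => False

def History.Won (h : History) : Prop := ∃ s ∈ h.past ++ [h.current], s.Winning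

/-- The probability that player one wins, from `s₀`: the limit of the (nondecreasing)
probabilities that he has won within `t` moves. -/
noncomputable def winProb {n : ℕ} (p : PMF (Fin (n + 1))) (σ₁ σ₂ : Strategy) (s₀ : State) : ℝ≥0∞ :=
  ⨆ t, (historyLaw p σ₁ σ₂ s₀ t).toOuterMeasure {h | h.Won}

noncomputable def lowerValue {n : ℕ} (p : PMF (Fin (n + 1))) (s : State) : ℝ≥0∞ :=
  ⨆ σ₁ : Strategy, ⨅ σ₂ : Strategy, winProb p σ₁ σ₂ s

noncomputable def upperValue {n : ℕ} (p : PMF (Fin (n + 1))) (s : State) : ℝ≥0∞ :=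
  ⨅ σ₂ : Strategy, ⨆ σ₁ : Strategy, winProb p σ₁ σ₂ s

/-- The game started at `s` has the value `v`. -/
def HasValue {n : ℕ} (p : PMF (Fin (n + 1))) (s : State) (v : ℝ) : Prop :=
  lowerValue p s = upperValue p s ∧ (lowerValue p s).toReal = v

/-- `σ` guarantees player one the value against every strategy of player two. -/
def OptimalForOne {n : ℕ} (p : PMF (Fin (n + 1))) (s : State) (σ : Strategy) : Prop :=
  ∀ σ₂ : Strategy, upperValue p s ≤ winProb p σ σ₂ s

/-- `σ` keeps player one down to the value, whatever strategy player one uses. -/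
def OptimalForTwo {n : ℕ} (p : PMF (Fin (n + 1))) (s : State) (σ : Strategy) : Prop :=
  ∀ σ₁ : Strategy, winProb p σ₁ σ s ≤ lowerValue p s

/-- The stationary deterministic strategy given by a table `d`, for either player: with own need
`a`, need `b` of the opponent and turn score `τ`, take the action `d a b τ`. -/
noncomputable def tableStrategy (d : ℕ → ℕ → ℕ → Action) : Strategy := fun h =>
  match h.current with
  | .go => PMF.pure .hold
  | .turn .one a b τ => PMF.pure (d a b τ)
  | .turn .two a b τ => PMF.pure (d b a τ)

/-- The values of all states, read off from a table `V a b τ`, `τ < a`, for player one on turn: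
`τ ≥ a` wins, and the states of player two are treated by symmetry. -/
noncomputable def tableValue (V : ℕ → ℕ → ℕ → ℝ) : State → ℝ
  | .go => 0
  | .turn .one a b τ => if τ < a then V a b τ else 1
  | .turn .two a b τ => 1 - (if τ < b then V b a τ else 1)

/-! ## The functions `f_{a,b,i}` and `f_{a,b}` of a sub-game -/

/-- `f_{a,b,i}(y)`: value, as a function of the value `y` of losing the turn to the opponent, when
`i` more points win; `w b i` is the (known) value with need `b` against need `i`.
(The subtraction truncates at `0`, where the function is `1`.) -/
noncomputable def turnFun {n : ℕ} (p : PMF (Fin (n + 1))) (w : ℕ → ℕ → ℝ) (b : ℕ) (y : ℝ) : ℕ → ℝ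
  | 0 => 1
  | i + 1 => max (1 - w b (i + 1))
      ((p 0).toReal * (1 - y) + ∑ k : Fin n, (p k.succ).toReal * turnFun p w b y (i - k))
termination_by i => i
decreasing_by omega

/-- `f_{a,b}(y)`: the same for the beginning of a turn, where the player has to roll.  It involves
`w b i` for `1 ≤ i < a` only. -/
noncomputable def subgameFun {n : ℕ} (p : PMF (Fin (n + 1))) (w : ℕ → ℕ → ℝ) (a b : ℕ) (y : ℝ) : ℝ :=
  (p 0).toReal * (1 - y) + ∑ k : Fin n, (p k.succ).toReal * turnFun p w b y (a - (k + 1))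

/-! ## Real random access machine

Programs over finitely many arrays of natural numbers and finitely many arrays of real numbers,
each with three indices.  The real operations are `0`, `1`, `+`, `-`, `*`, `/` and comparison,
exact and at unit cost; there is no rounding and no other real constant.  On natural numbers (used
for counting and addressing) there are literals, `+`, truncated `-`, halving and comparison. -/

structure Store where
  nat : ℕ → ℕ → ℕ → ℕ → ℕ
  real : ℕ → ℕ → ℕ → ℕ → ℝ

inductive NExp
  | lit (k : ℕ)
  | get (A : ℕ) (i j k : NExp)
  | add (e f : NExp)
  | sub (e f : NExp)
  | half (e : NExp)

inductive RExp
  | zero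
  | one
  | get (A : ℕ) (i j k : NExp)
  | add (e f : RExp)
  | sub (e f : RExp)
  | mul (e f : RExp)
  | div (e f : RExp)

inductive Test
  | natLE (e f : NExp)
  | realLE (e f : RExp)
  | not (b : Test)
  | and (b c : Test)

inductive Program
  | skip
  | setNat (A : ℕ) (i j k : NExp) (e : NExp)
  | setReal (A : ℕ) (i j k : NExp) (e : RExp)
  | seq (P Q : Program)
  | ite (b : Test) (P Q : Program)
  | while (b : Test) (P : Program)

def NExp.eval (s : Store) : NExp → ℕ
  | .lit k => k
  | .get A i j k => s.nat A (i.eval s) (j.eval s) (k.eval s)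
  | .add e f => e.eval s + f.eval s
  | .sub e f => e.eval s - f.eval s
  | .half e => e.eval s / 2

/-- The number of operations needed to evaluate an expression. -/
def NExp.cost : NExp → ℕ
  | .lit _ => 1
  | .get _ i j k => i.cost + j.cost + k.cost + 1
  | .add e f => e.cost + f.cost + 1
  | .sub e f => e.cost + f.cost + 1
  | .half e => e.cost + 1

noncomputable def RExp.eval (s : Store) : RExp → ℝ
  | .zero => 0
  | .one => 1
  | .get A i j k => s.real A (i.eval s) (j.eval s) (k.eval s)
  | .add e f => e.eval s + f.eval s
  | .sub e f => e.eval s - f.eval s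
  | .mul e f => e.eval s * f.eval s
  | .div e f => e.eval s / f.eval s

def RExp.cost : RExp → ℕ
  | .zero => 1
  | .one => 1
  | .get _ i j k => i.cost + j.cost + k.cost + 1
  | .add e f => e.cost + f.cost + 1
  | .sub e f => e.cost + f.cost + 1
  | .mul e f => e.cost + f.cost + 1
  | .div e f => e.cost + f.cost + 1

def Test.Holds (s : Store) : Test → Prop
  | .natLE e f => e.eval s ≤ f.eval s
  | .realLE e f => e.eval s ≤ f.eval s
  | .not b => ¬ b.Holds s
  | .and b c => b.Holds s ∧ c.Holds s

def Test.cost : Test → ℕ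
  | .natLE e f => e.cost + f.cost + 1
  | .realLE e f => e.cost + f.cost + 1
  | .not b => b.cost + 1
  | .and b c => b.cost + c.cost + 1

/-- Overwrite the cell with indices `i j k` of the array `A`. -/
def writeCell {α : Type} (m : ℕ → ℕ → ℕ → ℕ → α) (A i j k : ℕ) (x : α) : ℕ → ℕ → ℕ → ℕ → α :=
  fun A' i' j' k' => if A' = A ∧ i' = i ∧ j' = j ∧ k' = k then x else m A' i' j' k'

/-- `Runs P s t s'`: started with the memory `s`, the program `P` halts after `t` steps with the
memory `s'`. -/
inductive Runs : Program → Store → ℕ → Store → Prop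
  | skip (s : Store) : Runs .skip s 1 s
  | setNat (s : Store) (A : ℕ) (i j k e : NExp) :
      Runs (.setNat A i j k e) s (i.cost + j.cost + k.cost + e.cost + 1)
        { s with nat := writeCell s.nat A (i.eval s) (j.eval s) (k.eval s) (e.eval s) }
  | setReal (s : Store) (A : ℕ) (i j k : NExp) (e : RExp) :
      Runs (.setReal A i j k e) s (i.cost + j.cost + k.cost + e.cost + 1)
        { s with real := writeCell s.real A (i.eval s) (j.eval s) (k.eval s) (e.eval s) }
  | seq {P Q : Program} {s s' s'' : Store} {t t' : ℕ} :
      Runs P s t s' → Runs Q s' t' s'' → Runs (.seq P Q) s (t + t') s''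
  | ite_true {b : Test} {P Q : Program} {s s' : Store} {t : ℕ} :
      b.Holds s → Runs P s t s' → Runs (.ite b P Q) s (b.cost + 1 + t) s'
  | ite_false {b : Test} {P Q : Program} {s s' : Store} {t : ℕ} :
      ¬ b.Holds s → Runs Q s t s' → Runs (.ite b P Q) s (b.cost + 1 + t) s'
  | while_true {b : Test} {P : Program} {s s' s'' : Store} {t t' : ℕ} :
      b.Holds s → Runs P s t s' → Runs (.while b P) s' t' s'' →
        Runs (.while b P) s (b.cost + 1 + t + t') s''
  | while_false {b : Test} {P : Program} {s : Store} :
      ¬ b.Holds s → Runs (.while b P) s (b.cost + 1) s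

/-- The input: `n` and `N` in the cells `(0, 0, 0)` and `(1, 0, 0)` of the natural-number array `0`,
the probability of face `i` in the cell `(i, 0, 0)` of the real array `0`, and `0` elsewhere. -/
noncomputable def inputStore {n : ℕ} (p : PMF (Fin (n + 1))) (N : ℕ) : Store where
  nat := fun A i j k =>
    if A = 0 ∧ j = 0 ∧ k = 0 then (if i = 0 then n else if i = 1 then N else 0) else 0
  real := fun A i j k =>
    if h : A = 0 ∧ j = 0 ∧ k = 0 ∧ i < n + 1 then (p ⟨i, h.2.2.2⟩).toReal else 0

/-- The first output: the table of values, in the real array `1`. -/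
def Store.values (s : Store) : ℕ → ℕ → ℕ → ℝ := s.real 1

/-- The second output: the table of actions, in the natural-number array `1`
(`0` stands for hold, everything else for roll). -/
def Store.actions (s : Store) (a b τ : ℕ) : Action :=
  if s.nat 1 a b τ = 0 then .hold else .roll

end GenPig

open GenPig

/-!
The proof has three parts: the analysis of the system of equations, the verification theorem for the
game, and a program with a proof of correctness and of its running time.

*The system.*  With `i` points missing, rolling is worth `subgameFun p w i b y`, so `turnFun` is the
maximum of this and of the value of holding.  As functions of `y` both decrease at a rate less than
one (`slowlyAntitone_subgameFun`), because a roll of `0` contributes the rate one but some other face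
has positive probability.  Hence `f_{b,a} ∘ f_{a,b}` increases at a rate less than one, and the
system has a unique solution (`SlowlyAntitone.system_unique`).  The solutions define `gameValue` and
`turnValue` by recursion on `a + b`.

*The game.*  Consider the winning probability under optimal play from the present state on
(`historyValue`).  If player two follows a table of greedy actions, its expectation never increases,
whatever player one does, so it bounds the winning probability.  If player one follows such a table,
it never decreases, and since the game ends almost surely (`exists_not_over_lt`, by a bounded
potential that drops by one in expectation with every move), player one wins with at least this
probability.  Together: `hasValue_and_optimal`.

*The program.*  The functions `f_{a,b,i}` do not depend on `a`.  For every `b` the program maintains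
a grid of points between which the functions `f_{a,b,i}`, `i < a`, are affine (`IsGrid`).  A binary
search in this grid finds the interval that contains `v(b,a)`, because a point `z` lies to the left
of `v(b,a)` if and only if `z < f_{b,a}(f_{a,b}(z))`; every test takes `O(N)` steps.  In the same way
an interval for `v(a,b)` is found.  On these intervals the system is linear and can be solved
exactly (`lineProgram_spec`, `outputProgram_spec`).  For the next function `f_{a+1,b,a}`, which is
the maximum of a constant and of the decreasing function `f_{a,b}`, one point has to be inserted in
the grid, and it is found by another binary search (`refineProgram_spec`).  Thus each of the `N²`
sub-games takes `O(N log N)` steps.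
-/

namespace GenPig

/-! ### The functions of a sub-game -/

theorem turnFun_zero {n : ℕ} (p : PMF (Fin (n + 1))) (w : ℕ → ℕ → ℝ) (b : ℕ) (y : ℝ) :
    turnFun p w b y 0 = 1 := by
  rw [turnFun]

/-- The second alternative in `turnFun` is the value of rolling, which is `subgameFun` at the number
of points still missing. -/
theorem turnFun_eq_max {n : ℕ} (p : PMF (Fin (n + 1))) (w : ℕ → ℕ → ℝ) (b : ℕ) (y : ℝ) {i : ℕ}
    (hi : 1 ≤ i) : turnFun p w b y i = max (1 - w b i) (subgameFun p w i b y) := by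
  obtain ⟨i, rfl⟩ : ∃ j, i = j + 1 := ⟨i - 1, by omega⟩
  rw [turnFun, subgameFun]
  simp only [Nat.add_sub_add_right]

/-- `f_{a,b,i}` involves only the values with need `b` against needs from `1` to `i`. -/
theorem turnFun_congr {n : ℕ} (p : PMF (Fin (n + 1))) {w w' : ℕ → ℕ → ℝ} {b : ℕ} (y : ℝ) {i : ℕ}
    (h : ∀ j, 1 ≤ j → j ≤ i → w b j = w' b j) : turnFun p w b y i = turnFun p w' b y i := by
  induction i using Nat.strong_induction_on with
  | _ i ih =>
    rcases Nat.eq_zero_or_pos i with rfl | hi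
    · rw [turnFun_zero, turnFun_zero]
    · rw [turnFun_eq_max p w b y hi, turnFun_eq_max p w' b y hi, h i hi le_rfl]
      unfold subgameFun
      congr 2
      refine Finset.sum_congr rfl fun k _ => ?_
      rw [ih _ (by omega) fun j h1 h2 => h j h1 (by omega)]

theorem subgameFun_congr {n : ℕ} (p : PMF (Fin (n + 1))) {w w' : ℕ → ℕ → ℝ} {a b : ℕ} (y : ℝ)
    (h : ∀ j, 1 ≤ j → j < a → w b j = w' b j) : subgameFun p w a b y = subgameFun p w' a b y := by
  unfold subgameFun
  congr 1
  refine Finset.sum_congr rfl fun k _ => ?_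
  rw [turnFun_congr p y fun j h1 h2 => h j h1 (by omega)]

theorem sum_faces {n : ℕ} (p : PMF (Fin (n + 1))) :
    (p 0).toReal + ∑ k : Fin n, (p k.succ).toReal = 1 := by
  have h := p.tsum_coe
  rw [tsum_fintype] at h
  rw [← Fin.sum_univ_succ (fun k => (p k).toReal),
    ← ENNReal.toReal_sum fun k _ => p.apply_ne_top k, h, ENNReal.toReal_one]

theorem exists_face_pos {n : ℕ} {p : PMF (Fin (n + 1))} (hp : p 0 < 1) :
    ∃ k : Fin n, 0 < (p k.succ).toReal := by
  by_contra! h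
  have h0 : (p 0).toReal < 1 := by
    rw [← ENNReal.toReal_one]
    exact (ENNReal.toReal_lt_toReal (p.apply_ne_top 0) ENNReal.one_ne_top).2 hp
  have := sum_faces p
  have h1 : ∑ k : Fin n, (p k.succ).toReal ≤ 0 := Finset.sum_nonpos fun k _ => h k
  linarith

theorem subgameFun_mem_of_turnFun_mem {n : ℕ} (p : PMF (Fin (n + 1))) {w : ℕ → ℕ → ℝ} {a b : ℕ}
    {y : ℝ} (hy : y ∈ Set.Icc (0 : ℝ) 1)
    (h : ∀ k : Fin n, turnFun p w b y (a - (k + 1)) ∈ Set.Icc (0 : ℝ) 1) :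
    subgameFun p w a b y ∈ Set.Icc (0 : ℝ) 1 := by
  have h0 : 0 ≤ (p 0).toReal := ENNReal.toReal_nonneg
  constructor
  · exact add_nonneg (mul_nonneg h0 (by linarith [hy.2])) (Finset.sum_nonneg fun k _ =>
      mul_nonneg ENNReal.toReal_nonneg (h k).1)
  · rw [← sum_faces p]
    refine add_le_add (mul_le_of_le_one_right h0 (by linarith [hy.1])) (Finset.sum_le_sum fun k _ =>
      mul_le_of_le_one_right ENNReal.toReal_nonneg (h k).2)

theorem turnFun_mem_Icc {n : ℕ} (p : PMF (Fin (n + 1))) {w : ℕ → ℕ → ℝ} {b : ℕ} {y : ℝ}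
    (hy : y ∈ Set.Icc (0 : ℝ) 1) {i : ℕ} (h : ∀ j, 1 ≤ j → j ≤ i → w b j ∈ Set.Icc (0 : ℝ) 1) :
    turnFun p w b y i ∈ Set.Icc (0 : ℝ) 1 := by
  induction i using Nat.strong_induction_on with
  | _ i ih =>
    rcases Nat.eq_zero_or_pos i with rfl | hi
    · rw [turnFun_zero]; simp
    · rw [turnFun_eq_max p w b y hi]
      have h1 := h i hi le_rfl
      have h2 := subgameFun_mem_of_turnFun_mem p (a := i) (b := b) (w := w) hy fun k =>
        ih _ (by omega) fun j h1 h2 => h j h1 (by omega)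
      exact ⟨le_max_of_le_right h2.1, max_le (by linarith [h1.1]) h2.2⟩

theorem subgameFun_mem_Icc {n : ℕ} (p : PMF (Fin (n + 1))) {w : ℕ → ℕ → ℝ} {a b : ℕ} {y : ℝ}
    (hy : y ∈ Set.Icc (0 : ℝ) 1) (h : ∀ j, 1 ≤ j → j < a → w b j ∈ Set.Icc (0 : ℝ) 1) :
    subgameFun p w a b y ∈ Set.Icc (0 : ℝ) 1 :=
  subgameFun_mem_of_turnFun_mem p hy fun _ => turnFun_mem_Icc p hy fun j h1 h2 =>
    h j h1 (by omega)

/-- `f` is nonincreasing and decreases at a rate less than one. -/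
def SlowlyAntitone (f : ℝ → ℝ) : Prop :=
  ∀ ⦃y z : ℝ⦄, y < z → f z ≤ f y ∧ f y - f z < z - y

theorem SlowlyAntitone.antitone {f : ℝ → ℝ} (hf : SlowlyAntitone f) : Antitone f := fun y z h => by
  rcases h.eq_or_lt with rfl | h
  · exact le_rfl
  · exact (hf h).1

/-- The rate of decrease of a roll is an average of `1`, for face `0`, and of rates less than one for
the other faces, one of which has positive probability. -/
theorem slowlyAntitone_subgameFun_of_turnFun {n : ℕ} {p : PMF (Fin (n + 1))} (hp : p 0 < 1)
    {w : ℕ → ℕ → ℝ} {a b : ℕ}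
    (h : ∀ k : Fin n, SlowlyAntitone fun y => turnFun p w b y (a - (k + 1))) :
    SlowlyAntitone (subgameFun p w a b) := by
  intro y z hyz
  have h0 : 0 ≤ (p 0).toReal := ENNReal.toReal_nonneg
  have hle : ∑ k : Fin n, (p k.succ).toReal * turnFun p w b z (a - (k + 1)) ≤
      ∑ k : Fin n, (p k.succ).toReal * turnFun p w b y (a - (k + 1)) :=
    Finset.sum_le_sum fun k _ =>
      mul_le_mul_of_nonneg_left (h k hyz).1 ENNReal.toReal_nonneg
  have hlt : ∑ k : Fin n, (p k.succ).toReal * turnFun p w b y (a - (k + 1)) <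
      ∑ k : Fin n, ((p k.succ).toReal * turnFun p w b z (a - (k + 1)) +
        (p k.succ).toReal * (z - y)) := by
    obtain ⟨k, hk⟩ := exists_face_pos hp
    refine Finset.sum_lt_sum (fun k _ => ?_) ⟨k, Finset.mem_univ k, ?_⟩
    · rw [← mul_add]
      exact mul_le_mul_of_nonneg_left (by linarith [(h k hyz).2]) ENNReal.toReal_nonneg
    · rw [← mul_add]
      exact mul_lt_mul_of_pos_left (by linarith [(h k hyz).2]) hk
  rw [Finset.sum_add_distrib, ← Finset.sum_mul] at hlt
  have hs := sum_faces p
  have hs' : ∑ k : Fin n, (p k.succ).toReal = 1 - (p 0).toReal := by linarith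
  rw [hs'] at hlt
  unfold subgameFun
  constructor
  · nlinarith
  · nlinarith

theorem slowlyAntitone_turnFun {n : ℕ} {p : PMF (Fin (n + 1))} (hp : p 0 < 1)
    (w : ℕ → ℕ → ℝ) (b i : ℕ) : SlowlyAntitone fun y => turnFun p w b y i := by
  induction i using Nat.strong_induction_on with
  | _ i ih =>
    intro y z hyz
    rcases Nat.eq_zero_or_pos i with rfl | hi
    · simp only [turnFun_zero]
      constructor <;> linarith
    · simp only [turnFun_eq_max p w b _ hi]
      have h := slowlyAntitone_subgameFun_of_turnFun hp (w := w) (a := i) (b := b)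
        (fun k => ih _ (by omega)) hyz
      refine ⟨max_le_max le_rfl h.1, ?_⟩
      rcases max_cases (1 - w b i) (subgameFun p w i b y) with h1 | h1 <;>
      rcases max_cases (1 - w b i) (subgameFun p w i b z) with h2 | h2 <;>
      linarith [h1.1, h2.1, h1.2, h2.2]

theorem slowlyAntitone_subgameFun {n : ℕ} {p : PMF (Fin (n + 1))} (hp : p 0 < 1)
    (w : ℕ → ℕ → ℝ) (a b : ℕ) : SlowlyAntitone (subgameFun p w a b) :=
  slowlyAntitone_subgameFun_of_turnFun hp fun _ => slowlyAntitone_turnFun hp w b _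

theorem SlowlyAntitone.continuous {f : ℝ → ℝ} (hf : SlowlyAntitone f) : Continuous f := by
  have : LipschitzWith 1 f := by
    refine LipschitzWith.of_dist_le_mul fun y z => ?_
    rw [NNReal.coe_one, one_mul, Real.dist_eq, Real.dist_eq]
    rcases lt_trichotomy y z with h | rfl | h
    · rw [abs_of_nonneg (by linarith [(hf h).1]), abs_of_neg (by linarith)]
      linarith [(hf h).2]
    · simp
    · rw [abs_of_nonpos (by linarith [(hf h).1]), abs_of_pos (by linarith)]
      linarith [(hf h).2]
  exact this.continuous

/-- The composition of two slowly decreasing functions increases at a rate less than one. -/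
theorem SlowlyAntitone.comp_sub_lt {f g : ℝ → ℝ} (hf : SlowlyAntitone f) (hg : SlowlyAntitone g)
    {y z : ℝ} (hyz : y < z) : g (f z) - g (f y) < z - y := by
  have h1 := hf hyz
  rcases h1.1.eq_or_lt with h | h
  · rw [h]; linarith
  · linarith [(hg h).2]

theorem SlowlyAntitone.system_unique {f g : ℝ → ℝ} (hf : SlowlyAntitone f) (hg : SlowlyAntitone g)
    {x y x' y' : ℝ} (hx : x = f y) (hy : y = g x) (hx' : x' = f y') (hy' : y' = g x') :
    x = x' ∧ y = y' := by
  have hyy : y = y' := by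
    have h1 : y = g (f y) := by rw [← hx, ← hy]
    have h2 : y' = g (f y') := by rw [← hx', ← hy']
    rcases lt_trichotomy y y' with h | h | h
    · linarith [hf.comp_sub_lt hg h]
    · exact h
    · linarith [hf.comp_sub_lt hg h]
  exact ⟨by rw [hx, hx', hyy], hyy⟩

/-- Comparing a point with its image tells on which side of the fixed point it lies. -/
theorem SlowlyAntitone.le_comp_iff {f g : ℝ → ℝ} (hf : SlowlyAntitone f) (hg : SlowlyAntitone g)
    {y : ℝ} (hy : y = g (f y)) (z : ℝ) : z ≤ g (f z) ↔ z ≤ y := by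
  constructor
  · intro h
    by_contra! hlt
    linarith [hf.comp_sub_lt hg hlt]
  · intro h
    rcases h.eq_or_lt with rfl | h
    · exact hy.le
    · linarith [hf.comp_sub_lt hg h]

/-! ### The values of the sub-games -/

/-- The value `v(a,b)` at the beginning of a turn: a fixed point of `f_{a,b} ∘ f_{b,a}` in `[0,1]`,
where the values of the smaller sub-games are given by recursion. -/
noncomputable def gameValue {n : ℕ} (p : PMF (Fin (n + 1))) (a b : ℕ) : ℝ :=
  Classical.epsilon fun x : ℝ => x ∈ Set.Icc (0 : ℝ) 1 ∧
    x = subgameFun p (fun c d => if _h : c + d < a + b then gameValue p c d else 0) a b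
      (subgameFun p (fun c d => if _h : c + d < a + b then gameValue p c d else 0) b a x)
termination_by a + b

/-- A fixed point exists by the intermediate value theorem, since `f_{a,b} ∘ f_{b,a}` is continuous
and maps `[0,1]` to itself. -/
theorem gameValue_spec {n : ℕ} {p : PMF (Fin (n + 1))} (hp : p 0 < 1) (a b : ℕ) :
    gameValue p a b ∈ Set.Icc (0 : ℝ) 1 ∧
      gameValue p a b =
        subgameFun p (gameValue p) a b (subgameFun p (gameValue p) b a (gameValue p a b)) := by
  induction hs : a + b using Nat.strong_induction_on generalizing a b with
  | _ s ih =>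
    subst hs
    have hf := slowlyAntitone_subgameFun hp (gameValue p) a b
    have hg := slowlyAntitone_subgameFun hp (gameValue p) b a
    have hmaps : Set.MapsTo (fun x => subgameFun p (gameValue p) a b
        (subgameFun p (gameValue p) b a x)) (Set.Icc (0 : ℝ) 1) (Set.Icc (0 : ℝ) 1) := by
      intro x hx
      refine subgameFun_mem_Icc p (subgameFun_mem_Icc p hx fun j _ h2 => ?_) fun j _ h2 => ?_
      · exact (ih _ (by omega) a j rfl).1
      · exact (ih _ (by omega) b j rfl).1
    obtain ⟨x, hx, hfix⟩ := exists_mem_Icc_isFixedPt_of_mapsTo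
      (hf.continuous.comp hg.continuous).continuousOn zero_le_one hmaps
    have hP : ∀ x, subgameFun p (fun c d => if _h : c + d < a + b then gameValue p c d else 0) a b
      (subgameFun p (fun c d => if _h : c + d < a + b then gameValue p c d else 0) b a x) =
        subgameFun p (gameValue p) a b (subgameFun p (gameValue p) b a x) := by
      intro x
      rw [subgameFun_congr p (w' := gameValue p) (a := b) (b := a) x,
        subgameFun_congr p (w' := gameValue p) (a := a) (b := b)]
      · intro j _ h; rw [dif_pos (by omega)]
      · intro j _ h; rw [dif_pos (by omega)]
    have key : ∃ x : ℝ, x ∈ Set.Icc (0 : ℝ) 1 ∧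
        x = subgameFun p (gameValue p) a b (subgameFun p (gameValue p) b a x) := ⟨x, hx, hfix.symm⟩
    have h := Classical.epsilon_spec key
    rw [gameValue]
    simp only [hP]
    exact h

theorem gameValue_mem_Icc {n : ℕ} {p : PMF (Fin (n + 1))} (hp : p 0 < 1) (a b : ℕ) :
    gameValue p a b ∈ Set.Icc (0 : ℝ) 1 := (gameValue_spec hp a b).1

/-- The numbers `v(a,b)` and `v(b,a)` are chosen separately, but by uniqueness they solve the same
system. -/
theorem gameValue_eq {n : ℕ} {p : PMF (Fin (n + 1))} (hp : p 0 < 1) (a b : ℕ) :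
    gameValue p a b = subgameFun p (gameValue p) a b (gameValue p b a) := by
  have h1 := (gameValue_spec hp a b).2
  have h2 := (gameValue_spec hp b a).2
  have hf := slowlyAntitone_subgameFun hp (gameValue p) a b
  have hg := slowlyAntitone_subgameFun hp (gameValue p) b a
  have := (hf.system_unique hg h1 rfl rfl h2).2
  rw [← this]
  exact h1

/-! ### Expectations under discrete laws -/

/-- The expectation of a nonnegative function. -/
noncomputable def expect {α : Type} (μ : PMF α) (g : α → ℝ≥0∞) : ℝ≥0∞ := ∑' x, μ x * g x

theorem expect_pure {α : Type} (x : α) (g : α → ℝ≥0∞) : expect (PMF.pure x) g = g x := by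
  unfold expect
  rw [tsum_eq_single x]
  · simp
  · intro y hy; simp [hy]

theorem expect_bind {α β : Type} (μ : PMF α) (f : α → PMF β) (g : β → ℝ≥0∞) :
    expect (μ.bind f) g = expect μ fun x => expect (f x) g := by
  unfold expect
  simp only [PMF.bind_apply, ← ENNReal.tsum_mul_right, ← ENNReal.tsum_mul_left]
  rw [ENNReal.tsum_comm]
  simp only [mul_assoc]

theorem expect_map {α β : Type} (μ : PMF α) (f : α → β) (g : β → ℝ≥0∞) :
    expect (μ.map f) g = expect μ fun x => g (f x) := by
  rw [← PMF.bind_pure_comp, expect_bind]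
  simp only [Function.comp_apply, expect_pure]

theorem expect_mono {α : Type} (μ : PMF α) {g g' : α → ℝ≥0∞} (h : ∀ x ∈ μ.support, g x ≤ g' x) :
    expect μ g ≤ expect μ g' := by
  refine ENNReal.tsum_le_tsum fun x => ?_
  by_cases hx : μ x = 0
  · simp [hx]
  · exact mul_le_mul_right (h x hx) _

theorem expect_const {α : Type} (μ : PMF α) (c : ℝ≥0∞) : (expect μ fun _ => c) = c := by
  unfold expect
  rw [ENNReal.tsum_mul_right, μ.tsum_coe, one_mul]

theorem expect_le {α : Type} (μ : PMF α) {g : α → ℝ≥0∞} {c : ℝ≥0∞} (h : ∀ x, g x ≤ c) :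
    expect μ g ≤ c :=
  (expect_mono μ fun x _ => h x).trans_eq (expect_const μ c)

theorem le_expect {α : Type} (μ : PMF α) {g : α → ℝ≥0∞} {c : ℝ≥0∞} (h : ∀ x, c ≤ g x) :
    c ≤ expect μ g :=
  (expect_const μ c).symm.trans_le (expect_mono μ fun x _ => h x)

theorem expect_add {α : Type} (μ : PMF α) (g g' : α → ℝ≥0∞) :
    (expect μ fun x => g x + g' x) = expect μ g + expect μ g' := by
  unfold expect
  rw [← ENNReal.tsum_add]
  simp only [mul_add]

open Classical in
theorem toOuterMeasure_eq_expect {α : Type} (μ : PMF α) (S : Set α) :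
    μ.toOuterMeasure S = expect μ fun x => if x ∈ S then 1 else 0 := by
  rw [PMF.toOuterMeasure_apply]
  refine tsum_congr fun x => ?_
  by_cases hx : x ∈ S <;> simp [hx]

theorem expect_rollLaw {n : ℕ} (p : PMF (Fin (n + 1))) (j : Player) (a b τ : ℕ) {g : State → ℝ}
    (hg : ∀ s, 0 ≤ g s) :
    (expect (rollLaw p j a b τ) fun s => ENNReal.ofReal (g s)) =
      ENNReal.ofReal ((p 0).toReal * g (.turn j.other a b 0) +
        ∑ k : Fin n, (p k.succ).toReal * g (.turn j a b (τ + (k + 1)))) := by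
  have h1 : (p 0).toReal * g (.turn j.other a b 0) +
        ∑ k : Fin n, (p k.succ).toReal * g (.turn j a b (τ + (k + 1))) =
      ∑ i, (p i).toReal * g (afterRoll j a b τ i) := by
    rw [Fin.sum_univ_succ]
    congr 1
  rw [h1, ENNReal.ofReal_sum_of_nonneg fun i _ => mul_nonneg ENNReal.toReal_nonneg (hg _), rollLaw,
    expect_map]
  unfold expect
  rw [tsum_fintype]
  refine Finset.sum_congr rfl fun i _ => ?_
  rw [ENNReal.ofReal_mul ENNReal.toReal_nonneg, ENNReal.ofReal_toReal (p.apply_ne_top i)]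

/-! ### One move of the game -/

theorem turn_mem_stateSet {n N : ℕ} {j : Player} {a b τ : ℕ} :
    State.turn j a b τ ∈ stateSet n N ↔
      (1 ≤ a ∧ a ≤ N) ∧ (1 ≤ b ∧ b ≤ N) ∧ τ < j.need a b + n := Iff.rfl

theorem go_mem_stateSet {n N : ℕ} : State.go ∈ stateSet n N := trivial

/-- Law of the next state if the action is `act`. -/
noncomputable def actionLaw {n : ℕ} (p : PMF (Fin (n + 1))) (j : Player) (a b τ : ℕ) :
    Action → PMF State
  | .roll => rollLaw p j a b τ
  | .hold => PMF.pure (afterHold j a b τ)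

/-- What player `j` does after the history `h` if he has a choice. -/
noncomputable def actionChoice (σ₁ σ₂ : Strategy) (j : Player) (h : History) : PMF Action :=
  match j with
  | .one => σ₁ h
  | .two => σ₂ h

theorem nextState_go {n : ℕ} (p : PMF (Fin (n + 1))) (σ₁ σ₂ : Strategy) (past : List State) :
    nextState p σ₁ σ₂ ⟨past, .go⟩ = PMF.pure .go := rfl

theorem nextState_of_need_le {n : ℕ} (p : PMF (Fin (n + 1))) (σ₁ σ₂ : Strategy)
    (past : List State) {j : Player} {a b τ : ℕ} (h : j.need a b ≤ τ) :
    nextState p σ₁ σ₂ ⟨past, .turn j a b τ⟩ = PMF.pure .go := by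
  simp only [nextState, if_pos h]

theorem nextState_zero {n : ℕ} (p : PMF (Fin (n + 1))) (σ₁ σ₂ : Strategy)
    (past : List State) {j : Player} {a b : ℕ} (h : 0 < j.need a b) :
    nextState p σ₁ σ₂ ⟨past, .turn j a b 0⟩ = actionLaw p j a b 0 .roll := by
  simp only [nextState, if_neg (not_le.2 h), if_true, actionLaw]

theorem nextState_choice {n : ℕ} (p : PMF (Fin (n + 1))) (σ₁ σ₂ : Strategy)
    (past : List State) {j : Player} {a b τ : ℕ} (h0 : 0 < τ) (h : τ < j.need a b) :
    nextState p σ₁ σ₂ ⟨past, .turn j a b τ⟩ =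
      (actionChoice σ₁ σ₂ j ⟨past, .turn j a b τ⟩).bind (actionLaw p j a b τ) := by
  simp only [nextState, if_neg (not_le.2 h), if_neg h0.ne']
  congr 1
  cases j <;> rfl

theorem support_actionLaw {n N : ℕ} (p : PMF (Fin (n + 1))) {j : Player} {a b τ : ℕ}
    (ha : 1 ≤ a ∧ a ≤ N) (hb : 1 ≤ b ∧ b ≤ N) (hτ : τ < j.need a b) (act : Action) :
    ∀ s ∈ (actionLaw p j a b τ act).support, s ∈ stateSet n N := by
  intro s hs
  cases act with
  | roll =>
    simp only [actionLaw, rollLaw, PMF.mem_support_map_iff] at hs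
    obtain ⟨i, _, rfl⟩ := hs
    unfold afterRoll
    split_ifs with h
    · refine turn_mem_stateSet.2 ⟨ha, hb, ?_⟩
      cases j <;> simp only [Player.other, Player.need] <;> omega
    · exact turn_mem_stateSet.2 ⟨ha, hb, by omega⟩
  | hold =>
    simp only [actionLaw, PMF.support_pure, Set.mem_singleton_iff] at hs
    subst hs
    cases j <;> simp only [Player.need] at hτ <;>
      exact turn_mem_stateSet.2 (by simp only [Player.need]; omega)

theorem support_nextState {n N : ℕ} (p : PMF (Fin (n + 1))) (σ₁ σ₂ : Strategy) {h : History}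
    (hh : h.current ∈ stateSet n N) :
    ∀ s ∈ (nextState p σ₁ σ₂ h).support, s ∈ stateSet n N := by
  obtain ⟨past, current⟩ := h
  have hgo : ∀ s ∈ (PMF.pure State.go).support, s ∈ stateSet n N := by
    intro s hs
    rw [PMF.support_pure, Set.mem_singleton_iff] at hs
    rw [hs]; exact go_mem_stateSet
  cases current with
  | go => exact hgo
  | turn j a b τ =>
    obtain ⟨ha, hb, _⟩ := turn_mem_stateSet.1 hh
    rcases le_or_gt (j.need a b) τ with h | h
    · rw [nextState_of_need_le p σ₁ σ₂ past h]; exact hgo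
    · rcases Nat.eq_zero_or_pos τ with rfl | h0
      · rw [nextState_zero p σ₁ σ₂ past h]
        exact support_actionLaw p ha hb h .roll
      · rw [nextState_choice p σ₁ σ₂ past h0 h]
        intro s hs
        rw [PMF.mem_support_bind_iff] at hs
        obtain ⟨act, _, hs⟩ := hs
        exact support_actionLaw p ha hb h act s hs

theorem support_historyLaw {n N : ℕ} (p : PMF (Fin (n + 1))) (σ₁ σ₂ : Strategy) {s₀ : State}
    (hs : s₀ ∈ stateSet n N) (t : ℕ) :
    ∀ h ∈ (historyLaw p σ₁ σ₂ s₀ t).support, h.current ∈ stateSet n N := by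
  induction t with
  | zero =>
    intro h hh
    simp only [historyLaw, PMF.support_pure, Set.mem_singleton_iff] at hh
    rw [hh]; exact hs
  | succ t ih =>
    intro h hh
    simp only [historyLaw, PMF.mem_support_bind_iff, PMF.mem_support_map_iff] at hh
    obtain ⟨h', hh', s, hs', rfl⟩ := hh
    exact support_nextState p σ₁ σ₂ (ih h' hh') s hs'

theorem expect_historyLaw_succ {n : ℕ} (p : PMF (Fin (n + 1))) (σ₁ σ₂ : Strategy) (s₀ : State)
    (t : ℕ) (g : History → ℝ≥0∞) :
    expect (historyLaw p σ₁ σ₂ s₀ (t + 1)) g = expect (historyLaw p σ₁ σ₂ s₀ t) fun h =>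
      expect (nextState p σ₁ σ₂ h) fun s => g ⟨h.past ++ [h.current], s⟩ := by
  simp only [historyLaw, expect_bind, expect_map]

/-! ### The game ends almost surely -/

/-- Twice the number of points that are still missing if the turn score is banked (increased by `n`
to allow for overshooting), plus one if there is something to bank.  Every move that is not a roll
of `0` decreases it. -/
def State.remaining (n : ℕ) : State → ℕ
  | .go => 0
  | .turn _ a b τ => 2 * (a + b + n - τ) + if τ = 0 then 0 else 1

/-- A bounded function of the state that decreases in expectation by at least one in every move, as
long as the game is not over: `θ⁻ᴿ (1 - θ^r)`, where `r` is `State.remaining` and `R` is its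
maximum. -/
noncomputable def potential (n N : ℕ) (θ : ℝ) (s : State) : ℝ :=
  (θ⁻¹) ^ (2 * (2 * N + n) + 1) * (1 - θ ^ s.remaining n)

theorem potential_nonneg (n N : ℕ) {θ : ℝ} (h0 : 0 < θ) (h1 : θ ≤ 1 / 2) (s : State) :
    0 ≤ potential n N θ s :=
  mul_nonneg (by positivity) (sub_nonneg.2 (pow_le_one₀ h0.le (by linarith)))

theorem remaining_le {n N : ℕ} {s : State} (hs : s ∈ stateSet n N) :
    s.remaining n ≤ 2 * (2 * N + n) + 1 := by
  cases s with
  | go => simp [State.remaining]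
  | turn j a b τ =>
    obtain ⟨ha, hb, _⟩ := turn_mem_stateSet.1 hs
    simp only [State.remaining]
    split_ifs <;> omega

theorem one_le_pow_mul_pow {θ : ℝ} (h0 : 0 < θ) (h1 : θ ≤ 1 / 2) {r R : ℕ} (h : r ≤ R) :
    1 ≤ (θ⁻¹) ^ R * θ ^ r := by
  rw [inv_pow, inv_mul_eq_div, one_le_div (by positivity)]
  exact pow_le_pow_of_le_one h0.le (by linarith) h

theorem potential_add_one_le {n N : ℕ} {θ : ℝ} (h0 : 0 < θ) (h1 : θ ≤ 1 / 2) {s s' : State}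
    (hs : s ∈ stateSet n N) (h : s'.remaining n < s.remaining n) :
    potential n N θ s' ≤ potential n N θ s - 1 := by
  have hc := one_le_pow_mul_pow h0 h1 (remaining_le hs)
  unfold potential
  set c := (θ⁻¹) ^ (2 * (2 * N + n) + 1)
  have hc0 : 0 ≤ c := by positivity
  have h2 : θ ^ s.remaining n ≤ θ ^ s'.remaining n * (1 / 2) := by
    calc θ ^ s.remaining n ≤ θ ^ (s'.remaining n + 1) :=
          pow_le_pow_of_le_one h0.le (by linarith) h
      _ = θ ^ s'.remaining n * θ := pow_succ _ _
      _ ≤ _ := mul_le_mul_of_nonneg_left h1 (by positivity)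
  nlinarith [mul_le_mul_of_nonneg_left h2 hc0]

/-- For `θ = q / 2`, where `q` is the probability of not rolling `0`, the chance of losing the turn
costs less than what the other faces gain. -/
theorem potential_roll_le {n N : ℕ} {p : PMF (Fin (n + 1))} (hp : p 0 < 1)
    {j : Player} {a b τ : ℕ} (hs : State.turn j a b τ ∈ stateSet n N) :
    (p 0).toReal * potential n N ((1 - (p 0).toReal) / 2) (.turn j.other a b 0) +
        ∑ k : Fin n, (p k.succ).toReal *
          potential n N ((1 - (p 0).toReal) / 2) (.turn j a b (τ + (k + 1))) ≤
      potential n N ((1 - (p 0).toReal) / 2) (.turn j a b τ) - 1 := by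
  have hp1 : (p 0).toReal < 1 := by
    rw [← ENNReal.toReal_one]
    exact (ENNReal.toReal_lt_toReal (p.apply_ne_top 0) ENNReal.one_ne_top).2 hp
  have hp0 : 0 ≤ (p 0).toReal := ENNReal.toReal_nonneg
  have hsum := sum_faces p
  set q := 1 - (p 0).toReal with hq
  set θ := q / 2 with hθ
  have h0 : 0 < θ := by rw [hθ, hq]; linarith
  have h1 : θ ≤ 1 / 2 := by rw [hθ, hq]; linarith
  have hc := one_le_pow_mul_pow h0 h1 (remaining_le hs)
  obtain ⟨ha, hb, hτ⟩ := turn_mem_stateSet.1 hs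
  have hτ' : τ < a + b + n := by cases j <;> simp only [Player.need] at hτ <;> omega
  obtain ⟨r, hr⟩ : ∃ r, (State.turn j a b τ).remaining n = r + 1 := by
    refine ⟨(State.turn j a b τ).remaining n - 1, ?_⟩
    simp only [State.remaining]; omega
  set c := (θ⁻¹) ^ (2 * (2 * N + n) + 1) with hcdef
  have hc0 : 0 ≤ c := by positivity
  have hzero : potential n N θ (.turn j.other a b 0) ≤ c := by
    unfold potential
    rw [← hcdef]
    have : 0 ≤ c * θ ^ (State.turn j.other a b 0).remaining n := by positivity
    linarith
  have hpos : ∀ k : Fin n, potential n N θ (.turn j a b (τ + (k + 1))) ≤ c * (1 - θ ^ r) := by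
    intro k
    unfold potential
    refine mul_le_mul_of_nonneg_left (sub_le_sub_left ?_ _) hc0
    refine pow_le_pow_of_le_one h0.le (by linarith) ?_
    simp only [State.remaining] at hr ⊢
    split_ifs at hr ⊢ <;> omega
  have hS : ∑ k : Fin n, (p k.succ).toReal * potential n N θ (.turn j a b (τ + (k + 1))) ≤
      q * (c * (1 - θ ^ r)) := by
    rw [show q = ∑ k : Fin n, (p k.succ).toReal by rw [hq]; linarith, Finset.sum_mul]
    exact Finset.sum_le_sum fun k _ => mul_le_mul_of_nonneg_left (hpos k) ENNReal.toReal_nonneg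
  have hZ := mul_le_mul_of_nonneg_left hzero hp0
  rw [hr] at hc
  have hq2 : q = 2 * θ := by rw [hθ]; ring
  have hp2 : (p 0).toReal = 1 - 2 * θ := by rw [← hq2, hq]; ring
  have hgoal : potential n N θ (.turn j a b τ) = c * (1 - θ ^ (r + 1)) := by
    unfold potential; rw [hr]
  rw [hgoal]
  rw [hq2] at hS
  rw [hp2] at hZ ⊢
  rw [pow_succ] at hc ⊢
  nlinarith

theorem expect_potential_le {n N : ℕ} {p : PMF (Fin (n + 1))} (hp : p 0 < 1) (σ₁ σ₂ : Strategy)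
    {h : History} (hh : h.current ∈ stateSet n N) (hgo : h.current ≠ .go) :
    (expect (nextState p σ₁ σ₂ h) fun s =>
      ENNReal.ofReal (potential n N ((1 - (p 0).toReal) / 2) s)) ≤
      ENNReal.ofReal (potential n N ((1 - (p 0).toReal) / 2) h.current - 1) := by
  have hp1 : (p 0).toReal < 1 := by
    rw [← ENNReal.toReal_one]
    exact (ENNReal.toReal_lt_toReal (p.apply_ne_top 0) ENNReal.one_ne_top).2 hp
  have hp0 : 0 ≤ (p 0).toReal := ENNReal.toReal_nonneg
  have h0 : 0 < (1 - (p 0).toReal) / 2 := by linarith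
  have h1 : (1 - (p 0).toReal) / 2 ≤ 1 / 2 := by linarith
  have hroll : ∀ {j : Player} {a b τ : ℕ}, State.turn j a b τ ∈ stateSet n N →
      (expect (actionLaw p j a b τ .roll) fun s =>
        ENNReal.ofReal (potential n N ((1 - (p 0).toReal) / 2) s)) ≤
      ENNReal.ofReal (potential n N ((1 - (p 0).toReal) / 2) (.turn j a b τ) - 1) := by
    intro j a b τ hs
    rw [actionLaw, expect_rollLaw p j a b τ (potential_nonneg n N h0 h1)]
    exact ENNReal.ofReal_le_ofReal (potential_roll_le hp hs)
  obtain ⟨past, current⟩ := h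
  cases current with
  | go => exact absurd rfl hgo
  | turn j a b τ =>
    obtain ⟨ha, hb, hτ⟩ := turn_mem_stateSet.1 hh
    rcases le_or_gt (j.need a b) τ with h | h
    · rw [nextState_of_need_le p σ₁ σ₂ past h, expect_pure]
      refine ENNReal.ofReal_le_ofReal (potential_add_one_le h0 h1 hh ?_)
      cases j <;> simp only [Player.need, State.remaining] at hτ ⊢ <;> omega
    · rcases Nat.eq_zero_or_pos τ with rfl | hτ0
      · rw [nextState_zero p σ₁ σ₂ past h]
        exact hroll hh
      · rw [nextState_choice p σ₁ σ₂ past hτ0 h, expect_bind]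
        refine expect_le _ fun act => ?_
        cases act with
        | roll => exact hroll hh
        | hold =>
          rw [actionLaw, expect_pure]
          refine ENNReal.ofReal_le_ofReal (potential_add_one_le h0 h1 hh ?_)
          cases j <;> simp only [Player.need, State.remaining, afterHold] at h ⊢ <;>
            rw [if_neg hτ0.ne'] <;> simp <;> omega

open Classical in
/-- Whatever the strategies, the game is over after some time with probability as close to one as
one likes. -/
theorem exists_not_over_lt {n N : ℕ} {p : PMF (Fin (n + 1))} (hp : p 0 < 1) (σ₁ σ₂ : Strategy)
    {s₀ : State} (hs : s₀ ∈ stateSet n N) {ε : ℝ≥0∞} (hε : 0 < ε) :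
    ∃ t, (expect (historyLaw p σ₁ σ₂ s₀ t) fun h => if h.current = .go then 0 else 1) < ε := by
  set G : State → ℝ≥0∞ := fun s => ENNReal.ofReal (potential n N ((1 - (p 0).toReal) / 2) s)
    with hG
  set u : ℕ → ℝ≥0∞ := fun t =>
    expect (historyLaw p σ₁ σ₂ s₀ t) fun h => if h.current = .go then 0 else 1 with hu
  have hp1 : (p 0).toReal < 1 := by
    rw [← ENNReal.toReal_one]
    exact (ENNReal.toReal_lt_toReal (p.apply_ne_top 0) ENNReal.one_ne_top).2 hp
  have hp0 : 0 ≤ (p 0).toReal := ENNReal.toReal_nonneg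
  have h0 : 0 < (1 - (p 0).toReal) / 2 := by linarith
  have h1 : (1 - (p 0).toReal) / 2 ≤ 1 / 2 := by linarith
  -- The expected potential drops by at least the probability `u t` that the game is not over, so
  -- that these probabilities have a finite sum.
  have hstep : ∀ t, (expect (historyLaw p σ₁ σ₂ s₀ (t + 1)) fun h => G h.current) + u t ≤
      expect (historyLaw p σ₁ σ₂ s₀ t) fun h => G h.current := by
    intro t
    rw [expect_historyLaw_succ, hu, ← expect_add]
    refine expect_mono _ fun h hh => ?_
    have hmem := support_historyLaw p σ₁ σ₂ hs t h hh
    by_cases hgo : h.current = .go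
    · obtain ⟨past, current⟩ := h
      simp only at hgo
      subst hgo
      simp [nextState_go, expect_pure]
    · rw [if_neg hgo]
      refine (add_le_add_left (expect_potential_le hp σ₁ σ₂ hmem hgo) 1).trans ?_
      have hrem : (State.go).remaining n < h.current.remaining n := by
        cases hc : h.current with
        | go => exact absurd hc hgo
        | turn j a b τ =>
          rw [hc] at hmem
          obtain ⟨ha, hb, hτ⟩ := turn_mem_stateSet.1 hmem
          cases j <;> simp only [Player.need, State.remaining] at hτ ⊢ <;> omega
      have := potential_add_one_le h0 h1 hmem hrem
      have := potential_nonneg n N h0 h1 State.go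
      rw [← ENNReal.ofReal_one, ← ENNReal.ofReal_add (by linarith) zero_le_one]
      exact ENNReal.ofReal_le_ofReal (by linarith)
  have hsum : ∀ T, (expect (historyLaw p σ₁ σ₂ s₀ T) fun h => G h.current) +
      ∑ t ∈ Finset.range T, u t ≤ G s₀ := by
    intro T
    induction T with
    | zero => simp [historyLaw, expect_pure]
    | succ T ih =>
      rw [Finset.sum_range_succ, add_comm (∑ t ∈ Finset.range T, u t), ← add_assoc]
      exact (add_le_add_left (hstep T) _).trans ih
  by_contra! hcon
  have hbound : ∀ T : ℕ, (T : ℝ≥0∞) * ε ≤ G s₀ := by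
    intro T
    calc (T : ℝ≥0∞) * ε = ∑ t ∈ Finset.range T, ε := by simp
      _ ≤ ∑ t ∈ Finset.range T, u t := Finset.sum_le_sum fun t _ => hcon t
      _ ≤ _ := le_add_self
      _ ≤ G s₀ := hsum T
  have htop : G s₀ ≠ ⊤ := ENNReal.ofReal_ne_top
  obtain ⟨T, hT⟩ := ENNReal.exists_nat_mul_gt hε.ne' htop
  exact absurd (hbound T) (not_le.2 hT)

/-! ### Values of the states and optimal strategies -/

/-- The value `v(a,b,τ)`.  If `τ` reaches `a`, the truncated `a - τ` is `0` and the value is `1`. -/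
noncomputable def turnValue {n : ℕ} (p : PMF (Fin (n + 1))) (a b τ : ℕ) : ℝ :=
  if τ = 0 then gameValue p a b else turnFun p (gameValue p) b (gameValue p b a) (a - τ)

/-- The actions of `d` attain the maximum in the definition of `turnFun` wherever there is a choice,
for all needs up to `N`. -/
def GreedyTable {n : ℕ} (p : PMF (Fin (n + 1))) (N : ℕ) (d : ℕ → ℕ → ℕ → Action) : Prop :=
  ∀ a b τ, 1 ≤ a → a ≤ N → 1 ≤ b → b ≤ N → 0 < τ → τ < a →
    turnFun p (gameValue p) b (gameValue p b a) (a - τ) =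
      match d a b τ with
      | .hold => 1 - gameValue p b (a - τ)
      | .roll => subgameFun p (gameValue p) (a - τ) b (gameValue p b a)

theorem turnValue_mem_Icc {n : ℕ} {p : PMF (Fin (n + 1))} (hp : p 0 < 1) (a b τ : ℕ) :
    turnValue p a b τ ∈ Set.Icc (0 : ℝ) 1 := by
  unfold turnValue
  split_ifs
  · exact gameValue_mem_Icc hp a b
  · exact turnFun_mem_Icc p (gameValue_mem_Icc hp b a) fun j _ _ => gameValue_mem_Icc hp b j

theorem turnValue_of_le {n : ℕ} (p : PMF (Fin (n + 1))) {a b τ : ℕ} (h0 : 0 < τ) (h : a ≤ τ) :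
    turnValue p a b τ = 1 := by
  rw [turnValue, if_neg h0.ne', Nat.sub_eq_zero_of_le h, turnFun_zero]

theorem tableValue_one {n : ℕ} (p : PMF (Fin (n + 1))) {a b τ : ℕ} (h : 0 < a ∨ 0 < τ) :
    tableValue (turnValue p) (.turn .one a b τ) = turnValue p a b τ := by
  simp only [tableValue]
  split_ifs with h1
  · rfl
  · rw [turnValue_of_le p (by omega) (by omega)]

theorem tableValue_two {n : ℕ} (p : PMF (Fin (n + 1))) {a b τ : ℕ} (h : 0 < b ∨ 0 < τ) :
    tableValue (turnValue p) (.turn .two a b τ) = 1 - turnValue p b a τ := by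
  simp only [tableValue]
  split_ifs with h1
  · rfl
  · rw [turnValue_of_le p (by omega) (by omega)]

theorem tableValue_mem_Icc {n : ℕ} {p : PMF (Fin (n + 1))} (hp : p 0 < 1) (s : State) :
    tableValue (turnValue p) s ∈ Set.Icc (0 : ℝ) 1 := by
  cases s with
  | go => simp [tableValue]
  | turn j a b τ =>
    have h1 := turnValue_mem_Icc hp a b τ
    have h2 := turnValue_mem_Icc hp b a τ
    cases j <;> simp only [tableValue] <;> split_ifs <;> constructor <;>
      linarith [h1.1, h1.2, h2.1, h2.2]

/-- The value of a roll is given by `subgameFun`, and by symmetry for player two. -/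
theorem expect_roll_value {n : ℕ} {p : PMF (Fin (n + 1))} (hp : p 0 < 1) {j : Player} {a b τ : ℕ}
    (ha : 1 ≤ a) (hb : 1 ≤ b) :
    (expect (actionLaw p j a b τ .roll) fun s => ENNReal.ofReal (tableValue (turnValue p) s)) =
      ENNReal.ofReal (match j with
        | .one => subgameFun p (gameValue p) (a - τ) b (gameValue p b a)
        | .two => 1 - subgameFun p (gameValue p) (b - τ) a (gameValue p a b)) := by
  rw [actionLaw, expect_rollLaw p j a b τ fun s => (tableValue_mem_Icc hp s).1]
  congr 1
  cases j with
  | one =>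
    simp only [Player.other, subgameFun]
    rw [tableValue_two p (Or.inl hb), turnValue, if_pos rfl]
    congr 1
    refine Finset.sum_congr rfl fun k _ => ?_
    rw [tableValue_one p (Or.inl ha), turnValue, if_neg (by omega), Nat.sub_sub]
  | two =>
    simp only [Player.other, subgameFun]
    rw [tableValue_one p (Or.inl ha), turnValue, if_pos rfl]
    have hs := sum_faces p
    have : ∀ k : Fin n, (p k.succ).toReal *
        tableValue (turnValue p) (.turn .two a b (τ + (k + 1))) = (p k.succ).toReal -
          (p k.succ).toReal * turnFun p (gameValue p) a (gameValue p a b) (b - τ - (k + 1)) := by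
      intro k
      rw [tableValue_two p (Or.inl hb), turnValue, if_neg (by omega), Nat.sub_sub]
      ring
    rw [Finset.sum_congr rfl fun k _ => this k, Finset.sum_sub_distrib]
    linear_combination hs

theorem expect_hold_value {n : ℕ} (p : PMF (Fin (n + 1))) {j : Player} {a b τ : ℕ}
    (ha : 1 ≤ a) (hb : 1 ≤ b) (hτ : τ < j.need a b) :
    (expect (actionLaw p j a b τ .hold) fun s => ENNReal.ofReal (tableValue (turnValue p) s)) =
      ENNReal.ofReal (match (generalizing := false) j with
        | .one => 1 - gameValue p b (a - τ)
        | .two => gameValue p a (b - τ)) := by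
  rw [actionLaw, expect_pure]
  congr 1
  cases j <;> simp only [Player.need] at hτ <;> simp only [afterHold]
  · rw [tableValue_two p (Or.inl hb), turnValue, if_pos rfl]
  · rw [tableValue_one p (Or.inl ha), turnValue, if_pos rfl]

theorem turnValue_eq_max {n : ℕ} (p : PMF (Fin (n + 1))) {a b τ : ℕ} (h0 : 0 < τ) (hτ : τ < a) :
    turnValue p a b τ = max (1 - gameValue p b (a - τ))
      (subgameFun p (gameValue p) (a - τ) b (gameValue p b a)) := by
  rw [turnValue, if_neg h0.ne', turnFun_eq_max _ _ _ _ (by omega)]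

theorem expect_action_one_le {n : ℕ} {p : PMF (Fin (n + 1))} (hp : p 0 < 1) {a b τ : ℕ}
    (ha : 1 ≤ a) (hb : 1 ≤ b) (h0 : 0 < τ) (hτ : τ < a) (act : Action) :
    (expect (actionLaw p .one a b τ act) fun s => ENNReal.ofReal (tableValue (turnValue p) s)) ≤
      ENNReal.ofReal (tableValue (turnValue p) (.turn .one a b τ)) := by
  rw [tableValue_one p (Or.inl ha), turnValue_eq_max p h0 hτ]
  cases act with
  | roll =>
    rw [expect_roll_value hp ha hb]
    exact ENNReal.ofReal_le_ofReal (le_max_right _ _)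
  | hold =>
    rw [expect_hold_value p ha hb hτ]
    exact ENNReal.ofReal_le_ofReal (le_max_left _ _)

theorem le_expect_action_two {n : ℕ} {p : PMF (Fin (n + 1))} (hp : p 0 < 1) {a b τ : ℕ}
    (ha : 1 ≤ a) (hb : 1 ≤ b) (h0 : 0 < τ) (hτ : τ < b) (act : Action) :
    ENNReal.ofReal (tableValue (turnValue p) (.turn .two a b τ)) ≤
      expect (actionLaw p .two a b τ act) fun s => ENNReal.ofReal (tableValue (turnValue p) s) := by
  rw [tableValue_two p (Or.inl hb), turnValue_eq_max p h0 hτ]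
  cases act with
  | roll =>
    rw [expect_roll_value hp ha hb]
    exact ENNReal.ofReal_le_ofReal (sub_le_sub_left (le_max_right _ _) _)
  | hold =>
    rw [expect_hold_value p ha hb hτ]
    have h := le_max_left (1 - gameValue p a (b - τ))
      (subgameFun p (gameValue p) (b - τ) a (gameValue p a b))
    refine ENNReal.ofReal_le_ofReal ?_
    simp only
    linarith

/-- A greedy action preserves the value of the state. -/
theorem expect_greedy {n N : ℕ} {p : PMF (Fin (n + 1))} (hp : p 0 < 1)
    {d : ℕ → ℕ → ℕ → Action} (hd : GreedyTable p N d) {j : Player} {a b τ : ℕ}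
    (ha : 1 ≤ a ∧ a ≤ N) (hb : 1 ≤ b ∧ b ≤ N) (h0 : 0 < τ) (hτ : τ < j.need a b) :
    (expect (actionLaw p j a b τ (match j with | .one => d a b τ | .two => d b a τ)) fun s =>
      ENNReal.ofReal (tableValue (turnValue p) s)) =
      ENNReal.ofReal (tableValue (turnValue p) (.turn j a b τ)) := by
  cases j with
  | one =>
    have h := hd a b τ ha.1 ha.2 hb.1 hb.2 h0 hτ
    rw [tableValue_one p (Or.inl ha.1), turnValue, if_neg h0.ne', h]
    cases hact : d a b τ with
    | roll => simp only; rw [expect_roll_value hp ha.1 hb.1]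
    | hold => simp only; rw [expect_hold_value p ha.1 hb.1 hτ]
  | two =>
    have h := hd b a τ hb.1 hb.2 ha.1 ha.2 h0 hτ
    rw [tableValue_two p (Or.inl hb.1), turnValue, if_neg h0.ne', h]
    cases hact : d b a τ with
    | roll => simp only; rw [expect_roll_value hp ha.1 hb.1]
    | hold =>
      simp only
      rw [expect_hold_value p ha.1 hb.1 hτ]
      simp

theorem expect_first_roll {n : ℕ} {p : PMF (Fin (n + 1))} (hp : p 0 < 1) {j : Player} {a b : ℕ}
    (ha : 1 ≤ a) (hb : 1 ≤ b) :
    (expect (actionLaw p j a b 0 .roll) fun s => ENNReal.ofReal (tableValue (turnValue p) s)) =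
      ENNReal.ofReal (tableValue (turnValue p) (.turn j a b 0)) := by
  rw [expect_roll_value hp ha hb]
  cases j with
  | one =>
    rw [tableValue_one p (Or.inl ha), turnValue, if_pos rfl, Nat.sub_zero, ← gameValue_eq hp a b]
  | two =>
    rw [tableValue_two p (Or.inl hb), turnValue, if_pos rfl, gameValue_eq hp b a]
    simp only [Nat.sub_zero]

theorem tableValue_of_winning {n : ℕ} (p : PMF (Fin (n + 1))) {s : State} (hs : s.Winning) :
    tableValue (turnValue p) s = 1 := by
  match s, hs with
  | .turn .one a b τ, hs =>
    simp only [State.Winning] at hs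
    simp only [tableValue]
    rw [if_neg (not_lt.2 hs)]

theorem tableValue_of_two_need_le {n : ℕ} (p : PMF (Fin (n + 1))) {a b τ : ℕ} (h : b ≤ τ) :
    tableValue (turnValue p) (.turn .two a b τ) = 0 := by
  simp only [tableValue]
  rw [if_neg (not_lt.2 h), sub_self]

theorem tableStrategy_eq (d : ℕ → ℕ → ℕ → Action) (past : List State) (j : Player) (a b τ : ℕ) :
    tableStrategy d ⟨past, .turn j a b τ⟩ =
      PMF.pure (match j with | .one => d a b τ | .two => d b a τ) := by
  cases j <;> rfl

/-- If player two follows a greedy table, then the value does not increase in expectation. -/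
theorem expect_nextState_le {n N : ℕ} {p : PMF (Fin (n + 1))} (hp : p 0 < 1)
    {d : ℕ → ℕ → ℕ → Action} (hd : GreedyTable p N d) (σ₁ : Strategy) {h : History}
    (hh : h.current ∈ stateSet n N) :
    (expect (nextState p σ₁ (tableStrategy d) h) fun s =>
      ENNReal.ofReal (tableValue (turnValue p) s)) ≤
      ENNReal.ofReal (tableValue (turnValue p) h.current) := by
  obtain ⟨past, current⟩ := h
  cases current with
  | go => rw [nextState_go, expect_pure]
  | turn j a b τ =>
    obtain ⟨ha, hb, _⟩ := turn_mem_stateSet.1 hh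
    rcases le_or_gt (j.need a b) τ with h | h
    · rw [nextState_of_need_le _ _ _ past h, expect_pure]
      simp [tableValue]
    · rcases Nat.eq_zero_or_pos τ with rfl | h0
      · rw [nextState_zero _ _ _ past h, expect_first_roll hp ha.1 hb.1]
      · rw [nextState_choice _ _ _ past h0 h]
        cases j with
        | one =>
          rw [expect_bind]
          exact expect_le _ fun act => expect_action_one_le hp ha.1 hb.1 h0 h act
        | two =>
          simp only [actionChoice]
          rw [tableStrategy_eq, PMF.pure_bind]
          exact (expect_greedy hp hd (j := .two) ha hb h0 h).le

/-- If player one follows a greedy table, then the value does not decrease in expectation, unless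
he has just won. -/
theorem le_expect_nextState {n N : ℕ} {p : PMF (Fin (n + 1))} (hp : p 0 < 1)
    {d : ℕ → ℕ → ℕ → Action} (hd : GreedyTable p N d) (σ₂ : Strategy) {h : History}
    (hh : h.current ∈ stateSet n N) (hw : ¬ h.current.Winning) :
    ENNReal.ofReal (tableValue (turnValue p) h.current) ≤
      expect (nextState p (tableStrategy d) σ₂ h) fun s =>
        ENNReal.ofReal (tableValue (turnValue p) s) := by
  obtain ⟨past, current⟩ := h
  cases current with
  | go => rw [nextState_go, expect_pure]
  | turn j a b τ =>
    obtain ⟨ha, hb, _⟩ := turn_mem_stateSet.1 hh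
    rcases le_or_gt (j.need a b) τ with h | h
    · cases j with
      | one => exact absurd h hw
      | two =>
        simp only
        rw [tableValue_of_two_need_le (a := a) (b := b) p h, ENNReal.ofReal_zero]
        exact zero_le
    · rcases Nat.eq_zero_or_pos τ with rfl | h0
      · rw [nextState_zero _ _ _ past h, expect_first_roll hp ha.1 hb.1]
      · rw [nextState_choice _ _ _ past h0 h]
        cases j with
        | one =>
          simp only [actionChoice]
          rw [tableStrategy_eq, PMF.pure_bind]
          exact (expect_greedy hp hd (j := .one) ha hb h0 h).ge
        | two =>
          rw [expect_bind]
          exact le_expect _ fun act => le_expect_action_two hp ha.1 hb.1 h0 h act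

theorem History.won_append (h : History) (s : State) :
    (History.mk (h.past ++ [h.current]) s).Won ↔ h.Won ∨ s.Winning := by
  unfold History.Won
  simp only [List.mem_append, List.mem_singleton]
  constructor
  · rintro ⟨x, hx | rfl, hw⟩
    · exact Or.inl ⟨x, hx, hw⟩
    · exact Or.inr hw
  · rintro (⟨x, hx, hw⟩ | hw)
    · exact ⟨x, Or.inl hx, hw⟩
    · exact ⟨s, Or.inr rfl, hw⟩

theorem History.won_of_current {h : History} (hw : h.current.Winning) : h.Won :=
  ⟨h.current, by simp, hw⟩

open Classical in
/-- The winning probability of player one after the history `h`, if the play is optimal from then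
on. -/
noncomputable def historyValue {n : ℕ} (p : PMF (Fin (n + 1))) (h : History) : ℝ≥0∞ :=
  if h.Won then 1 else ENNReal.ofReal (tableValue (turnValue p) h.current)

theorem historyValue_start {n : ℕ} (p : PMF (Fin (n + 1))) (s : State) :
    historyValue p ⟨[], s⟩ = ENNReal.ofReal (tableValue (turnValue p) s) := by
  unfold historyValue
  split_ifs with h
  · obtain ⟨x, hx, hw⟩ := h
    simp only [List.nil_append, List.mem_singleton] at hx
    rw [← hx, tableValue_of_winning p hw, ENNReal.ofReal_one]
  · rfl

theorem historyValue_append_of_won {n : ℕ} (p : PMF (Fin (n + 1))) {h : History} (hw : h.Won)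
    (s : State) : historyValue p ⟨h.past ++ [h.current], s⟩ = 1 := by
  rw [historyValue, if_pos ((h.won_append s).2 (Or.inl hw))]

theorem historyValue_append_of_not_won {n : ℕ} (p : PMF (Fin (n + 1))) {h : History}
    (hw : ¬ h.Won) (s : State) : historyValue p ⟨h.past ++ [h.current], s⟩ =
      ENNReal.ofReal (tableValue (turnValue p) s) := by
  by_cases hs : s.Winning
  · rw [historyValue, if_pos ((h.won_append s).2 (Or.inr hs)), tableValue_of_winning p hs,
      ENNReal.ofReal_one]
  · rw [historyValue, if_neg]
    rw [h.won_append s]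
    exact not_or.2 ⟨hw, hs⟩

theorem expect_historyValue_le {n N : ℕ} {p : PMF (Fin (n + 1))} (hp : p 0 < 1)
    {d : ℕ → ℕ → ℕ → Action} (hd : GreedyTable p N d) (σ₁ : Strategy) {s₀ : State}
    (hs : s₀ ∈ stateSet n N) (t : ℕ) :
    expect (historyLaw p σ₁ (tableStrategy d) s₀ t) (historyValue p) ≤
      ENNReal.ofReal (tableValue (turnValue p) s₀) := by
  induction t with
  | zero => rw [historyLaw, expect_pure, historyValue_start]
  | succ t ih =>
    rw [expect_historyLaw_succ]
    refine (expect_mono _ fun h hh => ?_).trans ih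
    by_cases hw : h.Won
    · simp only [historyValue_append_of_won p hw]
      rw [expect_const, historyValue, if_pos hw]
    · simp only [historyValue_append_of_not_won p hw]
      rw [historyValue, if_neg hw]
      exact expect_nextState_le hp hd σ₁ (support_historyLaw p _ _ hs t h hh)

theorem le_expect_historyValue {n N : ℕ} {p : PMF (Fin (n + 1))} (hp : p 0 < 1)
    {d : ℕ → ℕ → ℕ → Action} (hd : GreedyTable p N d) (σ₂ : Strategy) {s₀ : State}
    (hs : s₀ ∈ stateSet n N) (t : ℕ) :
    ENNReal.ofReal (tableValue (turnValue p) s₀) ≤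
      expect (historyLaw p (tableStrategy d) σ₂ s₀ t) (historyValue p) := by
  induction t with
  | zero => rw [historyLaw, expect_pure, historyValue_start]
  | succ t ih =>
    rw [expect_historyLaw_succ]
    refine ih.trans (expect_mono _ fun h hh => ?_)
    by_cases hw : h.Won
    · simp only [historyValue_append_of_won p hw]
      rw [expect_const, historyValue, if_pos hw]
    · simp only [historyValue_append_of_not_won p hw]
      rw [historyValue, if_neg hw]
      exact le_expect_nextState hp hd σ₂ (support_historyLaw p _ _ hs t h hh)
        fun hc => hw (History.won_of_current hc)

theorem winProb_le_of_greedy {n N : ℕ} {p : PMF (Fin (n + 1))} (hp : p 0 < 1)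
    {d : ℕ → ℕ → ℕ → Action} (hd : GreedyTable p N d) (σ₁ : Strategy) {s₀ : State}
    (hs : s₀ ∈ stateSet n N) :
    winProb p σ₁ (tableStrategy d) s₀ ≤ ENNReal.ofReal (tableValue (turnValue p) s₀) := by
  classical
  refine iSup_le fun t => ?_
  rw [toOuterMeasure_eq_expect]
  refine (expect_mono _ fun h _ => ?_).trans (expect_historyValue_le hp hd σ₁ hs t)
  rw [historyValue]
  by_cases hw : h.Won <;> simp [hw]

theorem le_winProb_of_greedy {n N : ℕ} {p : PMF (Fin (n + 1))} (hp : p 0 < 1)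
    {d : ℕ → ℕ → ℕ → Action} (hd : GreedyTable p N d) (σ₂ : Strategy) {s₀ : State}
    (hs : s₀ ∈ stateSet n N) :
    ENNReal.ofReal (tableValue (turnValue p) s₀) ≤ winProb p (tableStrategy d) σ₂ s₀ := by
  classical
  -- Up to the probability `ε` that the game is not over at time `t`, the expected value at time `t`
  -- is the probability that player one has won.
  refine ENNReal.le_of_forall_pos_le_add fun ε hε _ => ?_
  obtain ⟨t, ht⟩ := exists_not_over_lt hp (tableStrategy d) σ₂ hs (ENNReal.coe_pos.2 hε)
  refine (le_expect_historyValue hp hd σ₂ hs t).trans (le_trans ?_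
    (add_le_add (le_iSup (fun t => (historyLaw p (tableStrategy d) σ₂ s₀ t).toOuterMeasure
      {h | h.Won}) t) ht.le))
  rw [toOuterMeasure_eq_expect, ← expect_add]
  refine expect_mono _ fun h _ => ?_
  rw [historyValue]
  by_cases hw : h.Won
  · simp [hw]
  · by_cases hgo : h.current = .go
    · simp [hw, hgo, tableValue]
    · simp only [hw, if_false, hgo, Set.mem_ofPred_eq, zero_add]
      rw [← ENNReal.ofReal_one]
      exact ENNReal.ofReal_le_ofReal (tableValue_mem_Icc hp _).2

/-- Greedy play is optimal for both players, and the table of the numbers `turnValue` gives the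
values. -/
theorem hasValue_and_optimal {n N : ℕ} {p : PMF (Fin (n + 1))} (hp : p 0 < 1)
    {d : ℕ → ℕ → ℕ → Action} (hd : GreedyTable p N d) {s : State} (hs : s ∈ stateSet n N) :
    HasValue p s (tableValue (turnValue p) s) ∧ OptimalForOne p s (tableStrategy d) ∧
      OptimalForTwo p s (tableStrategy d) := by
  have h1 : upperValue p s ≤ ENNReal.ofReal (tableValue (turnValue p) s) :=
    iInf_le_of_le (tableStrategy d) (iSup_le fun σ₁ => winProb_le_of_greedy hp hd σ₁ hs)
  have h2 : ENNReal.ofReal (tableValue (turnValue p) s) ≤ lowerValue p s :=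
    le_iSup_of_le (tableStrategy d) (le_iInf fun σ₂ => le_winProb_of_greedy hp hd σ₂ hs)
  have h3 : lowerValue p s ≤ upperValue p s := iSup_iInf_le_iInf_iSup _
  refine ⟨⟨le_antisymm h3 (h1.trans h2), ?_⟩, fun σ₂ => ?_, fun σ₁ => ?_⟩
  · rw [le_antisymm (h3.trans h1) h2, ENNReal.toReal_ofReal (tableValue_mem_Icc hp s).1]
  · exact h1.trans (le_winProb_of_greedy hp hd σ₂ hs)
  · exact (winProb_le_of_greedy hp hd σ₁ hs).trans h2

/-! ### Total correctness and running time of programs -/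

/-- Started with the memory `s`, the program halts after at most `T` steps with a memory that
satisfies `Q`. -/
def Does (P : Program) (s : Store) (T : ℕ) (Q : Store → Prop) : Prop :=
  ∃ t s', Runs P s t s' ∧ t ≤ T ∧ Q s'

/-- Write a cell of an array of natural numbers. -/
def Store.putNat (s : Store) (A i j k x : ℕ) : Store := { s with nat := writeCell s.nat A i j k x }

/-- Write a cell of an array of real numbers. -/
def Store.putReal (s : Store) (A i j k : ℕ) (x : ℝ) : Store :=
  { s with real := writeCell s.real A i j k x }

@[simp]
theorem Store.putNat_real (s : Store) (A i j k x : ℕ) : (s.putNat A i j k x).real = s.real := rfl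

@[simp]
theorem Store.putReal_nat (s : Store) (A i j k : ℕ) (x : ℝ) :
    (s.putReal A i j k x).nat = s.nat := rfl

@[simp]
theorem Store.putNat_nat (s : Store) (A i j k x A' i' j' k' : ℕ) :
    (s.putNat A i j k x).nat A' i' j' k' =
      if A' = A ∧ i' = i ∧ j' = j ∧ k' = k then x else s.nat A' i' j' k' := rfl

@[simp]
theorem Store.putReal_real (s : Store) (A i j k : ℕ) (x : ℝ) (A' i' j' k' : ℕ) :
    (s.putReal A i j k x).real A' i' j' k' =
      if A' = A ∧ i' = i ∧ j' = j ∧ k' = k then x else s.real A' i' j' k' := rfl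

/-- The arrays of natural numbers to which a program may write. -/
def Program.natWrites : Program → List ℕ
  | .skip => []
  | .setNat A _ _ _ _ => [A]
  | .setReal _ _ _ _ _ => []
  | .seq P Q => P.natWrites ++ Q.natWrites
  | .ite _ P Q => P.natWrites ++ Q.natWrites
  | .while _ P => P.natWrites

/-- The arrays of real numbers to which a program may write. -/
def Program.realWrites : Program → List ℕ
  | .skip => []
  | .setNat _ _ _ _ _ => []
  | .setReal A _ _ _ _ => [A]
  | .seq P Q => P.realWrites ++ Q.realWrites
  | .ite _ P Q => P.realWrites ++ Q.realWrites
  | .while _ P => P.realWrites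

/-- The memory `s'` agrees with `s` except possibly in the arrays listed. -/
structure Frame (ns rs : List ℕ) (s s' : Store) : Prop where
  nat : ∀ A, A ∉ ns → ∀ i j k, s'.nat A i j k = s.nat A i j k
  real : ∀ A, A ∉ rs → ∀ i j k, s'.real A i j k = s.real A i j k

theorem Frame.refl (ns rs : List ℕ) (s : Store) : Frame ns rs s s :=
  ⟨fun _ _ _ _ _ => rfl, fun _ _ _ _ _ => rfl⟩

theorem Frame.trans {ns rs : List ℕ} {s s' s'' : Store} (h : Frame ns rs s s')
    (h' : Frame ns rs s' s'') : Frame ns rs s s'' :=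
  ⟨fun A hA i j k => (h'.nat A hA i j k).trans (h.nat A hA i j k),
    fun A hA i j k => (h'.real A hA i j k).trans (h.real A hA i j k)⟩

theorem Frame.mono {ns rs ns' rs' : List ℕ} {s s' : Store} (h : Frame ns rs s s')
    (hn : ns ⊆ ns') (hr : rs ⊆ rs') : Frame ns' rs' s s' :=
  ⟨fun A hA => h.nat A fun hc => hA (hn hc), fun A hA => h.real A fun hc => hA (hr hc)⟩

theorem Frame.putNat {ns rs : List ℕ} {s s' : Store} (h : Frame ns rs s s') {A : ℕ} (hA : A ∈ ns)
    (i j k x : ℕ) : Frame ns rs s (s'.putNat A i j k x) := by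
  refine ⟨fun B hB i' j' k' => ?_, fun B hB i' j' k' => h.real B hB i' j' k'⟩
  rw [Store.putNat_nat, if_neg, h.nat B hB]
  rintro ⟨rfl, _⟩
  exact hB hA

theorem Runs.frame {P : Program} {s s' : Store} {t : ℕ} (h : Runs P s t s') :
    Frame P.natWrites P.realWrites s s' := by
  induction h with
  | skip s => exact Frame.refl _ _ s
  | setNat s A i j k e =>
    refine ⟨fun B hB i' j' k' => ?_, fun _ _ _ _ _ => rfl⟩
    have : B ≠ A := fun h => hB (by simp [Program.natWrites, h])
    simp [writeCell, this]
  | setReal s A i j k e =>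
    refine ⟨fun _ _ _ _ _ => rfl, fun B hB i' j' k' => ?_⟩
    have : B ≠ A := fun h => hB (by simp [Program.realWrites, h])
    simp [writeCell, this]
  | seq _ _ ih1 ih2 =>
    exact (ih1.mono (List.subset_append_left _ _) (List.subset_append_left _ _)).trans
      (ih2.mono (List.subset_append_right _ _) (List.subset_append_right _ _))
  | ite_true _ _ ih =>
    exact ih.mono (List.subset_append_left _ _) (List.subset_append_left _ _)
  | ite_false _ _ ih =>
    exact ih.mono (List.subset_append_right _ _) (List.subset_append_right _ _)
  | while_true _ _ _ ih1 ih2 => exact ih1.trans ih2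
  | while_false _ => exact Frame.refl _ _ _

theorem Does.frame {P : Program} {s : Store} {T : ℕ} {Q : Store → Prop} (h : Does P s T Q) :
    Does P s T fun s' => Q s' ∧ Frame P.natWrites P.realWrites s s' := by
  obtain ⟨t, s', hr, ht, hq⟩ := h
  exact ⟨t, s', hr, ht, hq, hr.frame⟩

theorem Does.mono {P : Program} {s : Store} {T T' : ℕ} {Q Q' : Store → Prop} (h : Does P s T Q)
    (hT : T ≤ T') (hQ : ∀ s', Q s' → Q' s') : Does P s T' Q' := by
  obtain ⟨t, s', hr, ht, hq⟩ := h
  exact ⟨t, s', hr, ht.trans hT, hQ s' hq⟩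

theorem Does.mono_cost {P : Program} {s : Store} {T T' : ℕ} {Q : Store → Prop} (h : Does P s T Q)
    (hT : T ≤ T') : Does P s T' Q := h.mono hT fun _ h => h

theorem Does.seq {P P' : Program} {s : Store} {T T' : ℕ} {Q R : Store → Prop}
    (h : Does P s T Q) (h' : ∀ s', Q s' → Does P' s' T' R) : Does (.seq P P') s (T + T') R := by
  obtain ⟨t, s', hr, ht, hq⟩ := h
  obtain ⟨t', s'', hr', ht', hq'⟩ := h' s' hq
  exact ⟨t + t', s'', hr.seq hr', add_le_add ht ht', hq'⟩

theorem Does.setNat {s : Store} {A : ℕ} {i j k e : NExp} {Q : Store → Prop}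
    (h : Q (s.putNat A (i.eval s) (j.eval s) (k.eval s) (e.eval s))) :
    Does (.setNat A i j k e) s (i.cost + j.cost + k.cost + e.cost + 1) Q :=
  ⟨_, _, Runs.setNat s A i j k e, le_rfl, h⟩

theorem Does.setReal {s : Store} {A : ℕ} {i j k : NExp} {e : RExp} {Q : Store → Prop}
    (h : Q (s.putReal A (i.eval s) (j.eval s) (k.eval s) (e.eval s))) :
    Does (.setReal A i j k e) s (i.cost + j.cost + k.cost + e.cost + 1) Q :=
  ⟨_, _, Runs.setReal s A i j k e, le_rfl, h⟩

theorem Does.setNat_seq {s : Store} {A : ℕ} {i j k e : NExp} {P : Program} {T : ℕ}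
    {Q : Store → Prop}
    (h : Does P (s.putNat A (i.eval s) (j.eval s) (k.eval s) (e.eval s)) T Q) :
    Does (.seq (.setNat A i j k e) P) s (i.cost + j.cost + k.cost + e.cost + 1 + T) Q :=
  Does.seq (Q := (· = s.putNat A (i.eval s) (j.eval s) (k.eval s) (e.eval s)))
    (Does.setNat rfl) fun s' hs' => by rw [hs']; exact h

theorem Does.setReal_seq {s : Store} {A : ℕ} {i j k : NExp} {e : RExp} {P : Program} {T : ℕ}
    {Q : Store → Prop}
    (h : Does P (s.putReal A (i.eval s) (j.eval s) (k.eval s) (e.eval s)) T Q) :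
    Does (.seq (.setReal A i j k e) P) s (i.cost + j.cost + k.cost + e.cost + 1 + T) Q :=
  Does.seq (Q := (· = s.putReal A (i.eval s) (j.eval s) (k.eval s) (e.eval s)))
    (Does.setReal rfl) fun s' hs' => by rw [hs']; exact h

theorem Does.ite {b : Test} {P P' : Program} {s : Store} {T : ℕ} {Q : Store → Prop}
    (h : b.Holds s → Does P s T Q) (h' : ¬ b.Holds s → Does P' s T Q) :
    Does (.ite b P P') s (b.cost + 1 + T) Q := by
  by_cases hb : b.Holds s
  · obtain ⟨t, s', hr, ht, hq⟩ := h hb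
    exact ⟨_, s', Runs.ite_true hb hr, by omega, hq⟩
  · obtain ⟨t, s', hr, ht, hq⟩ := h' hb
    exact ⟨_, s', Runs.ite_false hb hr, by omega, hq⟩

theorem Does.while_true {b : Test} {P : Program} {s : Store} {T T' : ℕ} {Q R : Store → Prop}
    (hb : b.Holds s) (h : Does P s T Q) (h' : ∀ s', Q s' → Does (.while b P) s' T' R) :
    Does (.while b P) s (b.cost + 1 + T + T') R := by
  obtain ⟨t, s', hr, ht, hq⟩ := h
  obtain ⟨t', s'', hr', ht', hq'⟩ := h' s' hq
  exact ⟨_, s'', Runs.while_true hb hr hr', by omega, hq'⟩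

theorem Does.while_false {b : Test} {P : Program} {s : Store} {Q : Store → Prop}
    (hb : ¬ b.Holds s) (h : Q s) : Does (.while b P) s (b.cost + 1) Q :=
  ⟨_, s, Runs.while_false hb, le_rfl, h⟩

/-! ### Variables, counting loops and binary search -/

/-- The natural-number variable `A`: the cell `(0, 0, 0)` of the array `A`. -/
abbrev natVar (A : ℕ) : NExp := .get A (.lit 0) (.lit 0) (.lit 0)

/-- The real variable `A`: the cell `(0, 0, 0)` of the array `A`. -/
abbrev realVar (A : ℕ) : RExp := .get A (.lit 0) (.lit 0) (.lit 0)

abbrev assignNat (A : ℕ) (e : NExp) : Program := .setNat A (.lit 0) (.lit 0) (.lit 0) e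

abbrev assignReal (A : ℕ) (e : RExp) : Program := .setReal A (.lit 0) (.lit 0) (.lit 0) e

/-- `for v := lo to hi do P`. -/
def forLoop (v : ℕ) (lo hi : NExp) (P : Program) : Program :=
  .seq (assignNat v lo)
    (.while (.natLE (natVar v) hi) (.seq P (assignNat v (.add (natVar v) (.lit 1)))))

/-- Invariant rule for counting loops, in which the invariant may depend on the counter, and the
arrays that are not written to are known to be unchanged. -/
theorem Does.forLoop {v : ℕ} {loE hiE : NExp} {P : Program} {s₀ : Store} {lo hi c : ℕ}
    (I : ℕ → Store → Prop) (hv : v ∉ P.natWrites) (hlo : loE.eval s₀ = lo) (hle : lo ≤ hi + 1)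
    (hhi : ∀ s, Frame (v :: P.natWrites) P.realWrites s₀ s → hiE.eval s = hi)
    (h0 : I lo (s₀.putNat v 0 0 0 lo))
    (hstep : ∀ k s, lo ≤ k → k ≤ hi → Frame (v :: P.natWrites) P.realWrites s₀ s →
      s.nat v 0 0 0 = k → I k s → Does P s c fun s' => I (k + 1) (s'.putNat v 0 0 0 (k + 1))) :
    Does (forLoop v loE hiE P) s₀
      (loE.cost + hiE.cost + 10 + (hi + 1 - lo) * (c + hiE.cost + 16))
      fun s' => s'.nat v 0 0 0 = hi + 1 ∧ I (hi + 1) s' := by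
  -- Induction on the number `m` of iterations that are still to be done.
  have key : ∀ m k s, m = hi + 1 - k → lo ≤ k → k ≤ hi + 1 →
      Frame (v :: P.natWrites) P.realWrites s₀ s → s.nat v 0 0 0 = k → I k s →
      Does (.while (.natLE (natVar v) hiE) (.seq P (assignNat v (.add (natVar v) (.lit 1))))) s
        (hiE.cost + 6 + m * (c + hiE.cost + 16))
        fun s' => s'.nat v 0 0 0 = hi + 1 ∧ I (hi + 1) s' := by
    intro m
    induction m with
    | zero =>
      intro k s hm h1 h2 hF hk hI
      obtain rfl : k = hi + 1 := by omega
      refine (Does.while_false ?_ ⟨hk, hI⟩).mono_cost ?_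
      · simp [Test.Holds, NExp.eval, hk, hhi s hF]
      · simp only [Test.cost, NExp.cost]; omega
    | succ m ih =>
      intro k s hm h1 h2 hF hk hI
      have hbody : Does (.seq P (assignNat v (.add (natVar v) (.lit 1)))) s (c + 10) fun s' =>
          Frame (v :: P.natWrites) P.realWrites s₀ s' ∧ s'.nat v 0 0 0 = k + 1 ∧ I (k + 1) s' := by
        refine Does.seq (hstep k s h1 (by omega) hF hk hI).frame fun s' hs' => ?_
        refine (Does.setNat ?_).mono_cost (by simp [NExp.cost])
        have hvk : s'.nat v 0 0 0 = k := (hs'.2.nat v hv 0 0 0).trans hk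
        simp only [NExp.eval, hvk]
        refine ⟨?_, by simp, hs'.1⟩
        exact (hF.trans (hs'.2.mono (List.subset_cons_self _ _) (List.Subset.refl _))).putNat
          List.mem_cons_self _ _ _ _
      refine (Does.while_true ?_ hbody fun s' hs' =>
        ih (k + 1) s' (by omega) (by omega) (by omega) hs'.1 hs'.2.1 hs'.2.2).mono_cost ?_
      · simp only [Test.Holds, NExp.eval, hk, hhi s hF]; omega
      · simp only [Test.cost, NExp.cost]
        ring_nf
        omega
  refine (Does.setNat_seq (key (hi + 1 - lo) lo _ rfl le_rfl hle ?_ ?_ ?_)).mono_cost ?_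
  · exact (Frame.refl _ _ _).putNat List.mem_cons_self _ _ _ _
  · simp [NExp.eval, hlo]
  · simpa only [NExp.eval, hlo] using h0
  · simp only [NExp.cost]
    omega

/-- Binary search, between `0` and `hi`, for a place where the outcome of the test `b` changes from
true to false; `P` prepares the test at the position given by the variable `24`. The result is in
the variable `22`. -/
def binarySearch (hi : NExp) (P : Program) (b : Test) : Program :=
  .seq (assignNat 22 (.lit 0)) (.seq (assignNat 23 hi)
    (.while (.natLE (.add (natVar 22) (.lit 2)) (natVar 23))
      (.seq (assignNat 24 (.half (.add (natVar 22) (natVar 23))))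
        (.seq P (.ite b (assignNat 22 (natVar 24)) (assignNat 23 (natVar 24)))))))

/-- Rule for `binarySearch` if the test at position `k` decides `φ k`.  The positions `0` and `hi`
are never tested. -/
theorem Does.binarySearch {hiE : NExp} {P : Program} {b : Test} {s₀ : Store} {hi c L : ℕ}
    (φ : ℕ → Prop) (hv : ∀ v ∈ [22, 23, 24], v ∉ P.natWrites)
    (hhi : hiE.eval (s₀.putNat 22 0 0 0 0) = hi) (hpos : 0 < hi) (hL : hi ≤ 2 ^ L)
    (hstep : ∀ k s, 0 < k → k < hi → Frame (22 :: 23 :: 24 :: P.natWrites) P.realWrites s₀ s →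
      s.nat 24 0 0 0 = k → Does P s c fun s' => b.Holds s' ↔ φ k) :
    Does (binarySearch hiE P b) s₀ (hiE.cost + 30 + L * (c + b.cost + 40))
      fun s' => ∃ j, s'.nat 22 0 0 0 = j ∧ j < hi ∧ (j = 0 ∨ φ j) ∧ (j + 1 = hi ∨ ¬ φ (j + 1)) := by
  -- Every iteration halves the length of the interval from `j` to `k`, up to rounding.
  have key : ∀ m j k s, j < k → k ≤ hi → k - j ≤ 2 ^ m →
      Frame (22 :: 23 :: 24 :: P.natWrites) P.realWrites s₀ s → s.nat 22 0 0 0 = j →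
      s.nat 23 0 0 0 = k → (j = 0 ∨ φ j) → (k = hi ∨ ¬ φ k) →
      Does (.while (.natLE (.add (natVar 22) (.lit 2)) (natVar 23))
      (.seq (assignNat 24 (.half (.add (natVar 22) (natVar 23))))
        (.seq P (.ite b (assignNat 22 (natVar 24)) (assignNat 23 (natVar 24)))))) s
        (12 + m * (c + b.cost + 40))
        fun s' => ∃ j, s'.nat 22 0 0 0 = j ∧ j < hi ∧ (j = 0 ∨ φ j) ∧
          (j + 1 = hi ∨ ¬ φ (j + 1)) := by
    intro m
    induction m with
    | zero =>
      intro j k s hjk hk hm hF h22 h23 hj hk'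
      obtain rfl : k = j + 1 := by simp at hm; omega
      refine (Does.while_false ?_ ⟨j, h22, by omega, hj, hk'⟩).mono_cost ?_
      · simp only [Test.Holds, NExp.eval, h22, h23]; omega
      · simp only [Test.cost, NExp.cost]; omega
    | succ m ih =>
      intro j k s hjk hk hm hF h22 h23 hj hk'
      by_cases hlt : j + 2 ≤ k
      · have h1 : j < (j + k) / 2 := by omega
        have h2 : (j + k) / 2 < k := by omega
        have h3 : k - (j + k) / 2 ≤ 2 ^ m := by rw [pow_succ] at hm; omega
        have h4 : (j + k) / 2 - j ≤ 2 ^ m := by rw [pow_succ] at hm; omega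
        have hbody : Does (.seq (assignNat 24 (.half (.add (natVar 22) (natVar 23))))
            (.seq P (.ite b (assignNat 22 (natVar 24)) (assignNat 23 (natVar 24))))) s
            (c + b.cost + 23) fun s' => ∃ j k, j < k ∧ k ≤ hi ∧ k - j ≤ 2 ^ m ∧
              Frame (22 :: 23 :: 24 :: P.natWrites) P.realWrites s₀ s' ∧ s'.nat 22 0 0 0 = j ∧
              s'.nat 23 0 0 0 = k ∧ (j = 0 ∨ φ j) ∧ (k = hi ∨ ¬ φ k) := by
          refine (Does.setNat_seq (Does.seq (hstep ((j + k) / 2) _ (by omega) (by omega) ?_ ?_).frame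
            fun s' hs' => Does.ite (T := 8) (fun hb => ?_) fun hb => ?_)).mono_cost ?_
          · exact hF.putNat (by simp) _ _ _ _
          · simp [NExp.eval, h22, h23]
          · obtain ⟨hφ, hF'⟩ := hs'
            have e22 := hF'.nat 22 (hv 22 (by simp)) 0 0 0
            have e23 := hF'.nat 23 (hv 23 (by simp)) 0 0 0
            have e24 := hF'.nat 24 (hv 24 (by simp)) 0 0 0
            simp [NExp.eval, h22, h23] at e22 e23 e24
            refine (Does.setNat ?_).mono_cost (by simp [NExp.cost])
            refine ⟨(j + k) / 2, k, h2, hk, h3, ?_, ?_, ?_, Or.inr (hφ.1 hb), hk'⟩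
            · refine (((hF.putNat ?_ _ _ _ _).trans (hF'.mono ?_ (List.Subset.refl _))).putNat ?_ _ _ _ _)
              · simp
              · intro x hx; simp [hx]
              · simp
            · simp [NExp.eval, e24]
            · simp [NExp.eval, e23]
          · obtain ⟨hφ, hF'⟩ := hs'
            have e22 := hF'.nat 22 (hv 22 (by simp)) 0 0 0
            have e23 := hF'.nat 23 (hv 23 (by simp)) 0 0 0
            have e24 := hF'.nat 24 (hv 24 (by simp)) 0 0 0
            simp [NExp.eval, h22, h23] at e22 e23 e24
            refine (Does.setNat ?_).mono_cost (by simp [NExp.cost])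
            refine ⟨j, (j + k) / 2, h1, by omega, h4, ?_, ?_, ?_, hj, Or.inr fun h => hb (hφ.2 h)⟩
            · refine (((hF.putNat ?_ _ _ _ _).trans (hF'.mono ?_ (List.Subset.refl _))).putNat ?_ _ _ _ _)
              · simp
              · intro x hx; simp [hx]
              · simp
            · simp [NExp.eval, e22]
            · simp [NExp.eval, e24]
          · simp only [NExp.cost]; omega
        refine (Does.while_true ?_ hbody fun s' ⟨j', k', g1, g2, g3, g4, g5, g6, g7, g8⟩ =>
          ih j' k' s' g1 g2 g3 g4 g5 g6 g7 g8).mono_cost ?_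
        · simp only [Test.Holds, NExp.eval, h22, h23]; exact hlt
        · simp only [Test.cost, NExp.cost]
          ring_nf
          omega
      · obtain rfl : k = j + 1 := by omega
        refine (Does.while_false ?_ ⟨j, h22, by omega, hj, hk'⟩).mono_cost ?_
        · simp only [Test.Holds, NExp.eval, h22, h23]; omega
        · simp only [Test.cost, NExp.cost]; omega
  refine (Does.setNat_seq (Does.setNat_seq (key L 0 hi _ hpos le_rfl (by omega) ?_ ?_ ?_
    (Or.inl rfl) (Or.inl rfl)))).mono_cost ?_
  · exact ((Frame.refl _ _ _).putNat (by simp) _ _ _ _).putNat (by simp) _ _ _ _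
  · simp [NExp.eval]
  · simpa [NExp.eval] using hhi
  · simp only [NExp.cost]; omega

/-! ### Evaluation of the functions of a sub-game -/

/-! Use of the memory.  The input is in the arrays `0` and the output in the arrays `1`.  The real
array `2` contains the grids, and the real array `3` the values `f_{a,b,i}(y)` for the last argument
`y`.  The array `10` of natural numbers contains the needs in the current sub-game, and the arrays
`12`, `13` and `14` contain the counters of the outer loops.  All arrays from `20` on are scratch:
the real variables `20` and `21` are the argument and the result of `subgameProgram`, the real
arrays `30` and `31` contain the slope and the intercept of a line each, and the variables `22`,
`23` and `24` of natural numbers belong to `binarySearch`. -/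

/-- The needs of the two players in the sub-game under consideration are kept in the cells
`(0, 0, 0)` and `(1, 0, 0)` of the array `10`; `arg u` is one of the two. -/
abbrev arg (u : ℕ) : NExp := .get 10 (.lit u) (.lit 0) (.lit 0)

/-- The input of the program, apart from the target. -/
def HasDie {n : ℕ} (p : PMF (Fin (n + 1))) (s : Store) : Prop :=
  s.nat 0 0 0 0 = n ∧ ∀ i : Fin (n + 1), s.real 0 i 0 0 = (p i).toReal

theorem HasDie.of_frame {n : ℕ} {p : PMF (Fin (n + 1))} {s s' : Store} {ns rs : List ℕ}
    (h : HasDie p s) (hF : Frame ns rs s s') (hn : 0 ∉ ns) (hr : 0 ∉ rs) : HasDie p s' :=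
  ⟨(hF.nat 0 hn _ _ _).trans h.1, fun i => (hF.real 0 hr _ _ _).trans (h.2 i)⟩

/-- Compute the value of a roll, if `i` (the variable `20`) points are missing and the values with
fewer points missing are in the array `3`.  The value of losing the turn to the opponent is the real
variable `20`; the result is the real variable `21`. -/
def rollProgram : Program :=
  .seq (assignReal 21 (.mul (.get 0 (.lit 0) (.lit 0) (.lit 0)) (.sub .one (realVar 20))))
    (forLoop 21 (.lit 1) (.get 0 (.lit 0) (.lit 0) (.lit 0))
      (assignReal 21 (.add (realVar 21) (.mul (.get 0 (natVar 21) (.lit 0) (.lit 0))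
        (.get 3 (.sub (natVar 20) (natVar 21)) (.lit 0) (.lit 0))))))

theorem rollProgram_spec {n : ℕ} {p : PMF (Fin (n + 1))} {s : Store} (hp : HasDie p s)
    {w : ℕ → ℕ → ℝ} {i b : ℕ} (hi : 1 ≤ i) (hI : s.nat 20 0 0 0 = i)
    (hT : ∀ j, j < i → s.real 3 j 0 0 = turnFun p w b (s.real 20 0 0 0) j) :
    Does rollProgram s (50 * (n + 1)) fun s' =>
      s'.real 21 0 0 0 = subgameFun p w i b (s.real 20 0 0 0) := by
  obtain ⟨hn, hpr⟩ := hp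
  refine (Does.setReal_seq ((Does.forLoop (lo := 1) (hi := n) (c := 30) (fun k s' =>
    s'.real 21 0 0 0 = s.real 0 0 0 0 * (1 - s.real 20 0 0 0) +
      ∑ j ∈ Finset.range (k - 1), s.real 0 (j + 1) 0 0 *
        turnFun p w b (s.real 20 0 0 0) (i - (j + 1))) ?_ ?_ ?_ ?_ ?_ ?_).mono le_rfl ?_)).mono_cost ?_
  · simp [Program.natWrites]
  · simp [NExp.eval]
  · omega
  · intro s' hF
    simp [Program.natWrites, Program.realWrites] at hF
    have := hF.nat 0 (by simp) 0 0 0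
    simp [NExp.eval, this, hn]
  · simp [NExp.eval, RExp.eval]
  · intro k s' h1 h2 hF hk hI'
    simp only [Program.natWrites, Program.realWrites] at hF
    refine (Does.setReal ?_).mono_cost (by simp [NExp.cost, RExp.cost])
    have e1 := hF.nat 20 (by simp) 0 0 0
    have e2 := hF.real 3 (by simp) (i - k) 0 0
    have e3 := hF.real 0 (by simp) k 0 0
    simp at e1 e2 e3
    obtain ⟨k, rfl⟩ : ∃ m, k = m + 1 := ⟨k - 1, by omega⟩
    simp only [Nat.add_sub_cancel] at hI'
    simp [NExp.eval, RExp.eval, hk, hI', e1, e2, e3, hI]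
    rw [Finset.sum_range_succ, hT _ (by omega)]
    ring
  · rintro s' ⟨-, h⟩
    rw [h, subgameFun, Nat.add_sub_cancel, Finset.sum_range]
    congr 1
    · rw [← hpr 0]; rfl
    · refine Finset.sum_congr rfl fun k _ => ?_
      rw [← hpr k.succ]; rfl
  · simp only [NExp.cost, RExp.cost]; omega

/-- Compute `f_{a,b}(y)`, where `a` and `b` are the arguments `u` and `w` and `y` is the real
variable `20`, and store `f_{a,b,i}(y)`, `i < a`, in the real array `3`.  The result is the real
variable `21`. -/
def subgameProgram (u w : ℕ) : Program :=
  .seq (.setReal 3 (.lit 0) (.lit 0) (.lit 0) .one)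
    (.seq (forLoop 20 (.lit 1) (.sub (arg u) (.lit 1))
      (.seq rollProgram
        (.ite (.realLE (realVar 21) (.sub .one (.get 1 (arg w) (natVar 20) (.lit 0))))
          (.setReal 3 (natVar 20) (.lit 0) (.lit 0)
            (.sub .one (.get 1 (arg w) (natVar 20) (.lit 0))))
          (.setReal 3 (natVar 20) (.lit 0) (.lit 0) (realVar 21)))))
      rollProgram)

theorem subgameProgram_spec {n : ℕ} {p : PMF (Fin (n + 1))} {s : Store} (hp : HasDie p s)
    {v : ℕ → ℕ → ℝ} {u w a b : ℕ} (hu : s.nat 10 u 0 0 = a) (hw : s.nat 10 w 0 0 = b) (ha : 1 ≤ a)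
    (hv : ∀ i, 1 ≤ i → i < a → s.real 1 b i 0 = v b i) :
    Does (subgameProgram u w) s (120 * (n + 1) * a) fun s' =>
      (s'.real 21 0 0 0 = subgameFun p v a b (s.real 20 0 0 0) ∧
        ∀ i, i < a → s'.real 3 i 0 0 = turnFun p v b (s.real 20 0 0 0) i) ∧
      Frame [20, 21] [3, 21] s s' := by
  have hF : Does (subgameProgram u w) s (120 * (n + 1) * a) fun s' =>
      s'.real 21 0 0 0 = subgameFun p v a b (s.real 20 0 0 0) ∧
        ∀ i, i < a → s'.real 3 i 0 0 = turnFun p v b (s.real 20 0 0 0) i := by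
    refine (Does.setReal_seq (Does.seq (Does.forLoop (lo := 1) (hi := a - 1)
      (c := 50 * (n + 1) + 40) (fun i s' => ∀ j, j < i →
        s'.real 3 j 0 0 = turnFun p v b (s.real 20 0 0 0) j) ?_ ?_ ?_ ?_ ?_ ?_).frame
        fun s' hs' => ((rollProgram_spec (p := p) (i := a) (w := v) (b := b) ?_ ha ?_ ?_).frame).mono
          le_rfl ?_)).mono_cost ?_
    · simp [Program.natWrites, rollProgram, forLoop]
    · simp [NExp.eval]
    · omega
    · intro s' hF
      have := hF.nat 10 (by simp [Program.natWrites, rollProgram, forLoop]) u 0 0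
      simp at this
      simp [NExp.eval, this, hu]
    · intro j hj
      obtain rfl : j = 0 := by omega
      simp [NExp.eval, RExp.eval, turnFun_zero]
    · intro i s' h1 h2 hF hi hI
      have d : HasDie p s' := by
        refine HasDie.of_frame (s := s.putReal 3 0 0 0 1) ?_ hF
          (by simp [Program.natWrites, rollProgram, forLoop])
          (by simp [Program.realWrites, rollProgram, forLoop])
        exact ⟨by simp [hp.1], fun i => by simp [hp.2]⟩
      have ey := hF.real 20 (by simp [Program.realWrites, rollProgram, forLoop]) 0 0 0
      have ev := hF.real 1 (by simp [Program.realWrites, rollProgram, forLoop]) b i 0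
      have ew := hF.nat 10 (by simp [Program.natWrites, rollProgram, forLoop]) w 0 0
      simp [hw] at ey ev ew
      refine (Does.seq (rollProgram_spec d h1 hi (w := v) (b := b) (fun j hj => ?_)).frame
        fun s'' hs'' => Does.ite (T := 22) (fun hb => ?_) fun hb => ?_).mono_cost ?_
      · rw [hI j hj, ey]
      · obtain ⟨hr, hF'⟩ := hs''
        have e20 := hF'.nat 20 (by simp [Program.natWrites, rollProgram, forLoop]) 0 0 0
        have e10 := hF'.nat 10 (by simp [Program.natWrites, rollProgram, forLoop]) w 0 0
        have e3 := hF'.real 3 (by simp [Program.realWrites, rollProgram, forLoop])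
        have e1 := hF'.real 1 (by simp [Program.realWrites, rollProgram, forLoop]) b i 0
        rw [hv i h1 (by omega)] at ev
        simp [Test.Holds, NExp.eval, RExp.eval, e20, hi, e10, ew, e1, ev, hr, ey] at hb
        refine (Does.setReal ?_).mono_cost (by simp [NExp.cost, RExp.cost])
        intro j hj
        simp [NExp.eval, RExp.eval, e20, hi, e10, ew, e1, ev, e3]
        split_ifs with hji
        · rw [hji, turnFun_eq_max p v b _ h1, max_eq_left hb]
        · exact hI j (by omega)
      · obtain ⟨hr, hF'⟩ := hs''
        have e20 := hF'.nat 20 (by simp [Program.natWrites, rollProgram, forLoop]) 0 0 0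
        have e10 := hF'.nat 10 (by simp [Program.natWrites, rollProgram, forLoop]) w 0 0
        have e3 := hF'.real 3 (by simp [Program.realWrites, rollProgram, forLoop])
        have e1 := hF'.real 1 (by simp [Program.realWrites, rollProgram, forLoop]) b i 0
        rw [hv i h1 (by omega)] at ev
        simp [Test.Holds, NExp.eval, RExp.eval, e20, hi, e10, ew, e1, ev, hr, ey] at hb
        refine (Does.setReal ?_).mono_cost (by simp [NExp.cost, RExp.cost])
        intro j hj
        simp [NExp.eval, RExp.eval, e20, hi, hr, ey, e3]
        split_ifs with hji
        · rw [hji, turnFun_eq_max p v b _ h1, max_eq_right hb.le]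
        · exact hI j (by omega)
      · simp only [Test.cost, NExp.cost, RExp.cost]; omega
    · refine HasDie.of_frame (s := s.putReal 3 0 0 0 1) ?_ hs'.2
        (by simp [Program.natWrites, rollProgram, forLoop])
        (by simp [Program.realWrites, rollProgram, forLoop])
      exact ⟨by simp [hp.1], fun i => by simp [hp.2]⟩
    · rw [hs'.1.1]; omega
    · intro j hj
      have ey := hs'.2.real 20 (by simp [Program.realWrites, rollProgram, forLoop]) 0 0 0
      simp at ey
      rw [hs'.1.2 j (by omega), ey]
    · rintro s'' ⟨hr, hF'⟩
      have ey := hs'.2.real 20 (by simp [Program.realWrites, rollProgram, forLoop]) 0 0 0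
      simp at ey
      refine ⟨by rw [hr, ey], fun j hj => ?_⟩
      rw [hF'.real 3 (by simp [Program.realWrites, rollProgram, forLoop])]
      exact hs'.1.2 j (by omega)
    · simp only [NExp.cost, RExp.cost]
      obtain ⟨a, rfl⟩ : ∃ m, a = m + 1 := ⟨a - 1, by omega⟩
      simp only [Nat.add_sub_cancel]
      nlinarith [Nat.zero_le (a * n)]
  refine hF.frame.mono le_rfl fun s' hs' => ⟨hs'.1, hs'.2.mono ?_ ?_⟩
  · intro x
    simp [subgameProgram, Program.natWrites, rollProgram, forLoop]
    omega
  · intro x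
    simp [subgameProgram, Program.realWrites, rollProgram, forLoop]
    omega

/-! ### Grids on which the functions of a sub-game are piecewise affine -/

/-- `f` is affine on `[l, u]`. -/
def AffineBetween (f : ℝ → ℝ) (l u : ℝ) : Prop :=
  ∃ c m : ℝ, ∀ y ∈ Set.Icc l u, f y = c + m * y

theorem AffineBetween.mono {f : ℝ → ℝ} {l u l' u' : ℝ} (h : AffineBetween f l u) (hl : l ≤ l')
    (hu : u' ≤ u) : AffineBetween f l' u' := by
  obtain ⟨c, m, h⟩ := h
  exact ⟨c, m, fun y hy => h y ⟨hl.trans hy.1, hy.2.trans hu⟩⟩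

theorem AffineBetween.congr {f g : ℝ → ℝ} {l u : ℝ} (h : AffineBetween f l u)
    (hfg : ∀ y ∈ Set.Icc l u, g y = f y) : AffineBetween g l u := by
  obtain ⟨c, m, h⟩ := h
  exact ⟨c, m, fun y hy => (hfg y hy).trans (h y hy)⟩

theorem affineBetween_const (c l u : ℝ) : AffineBetween (fun _ => c) l u :=
  ⟨c, 0, fun y _ => by ring⟩

theorem affineBetween_of_le (f : ℝ → ℝ) {l u : ℝ} (h : u ≤ l) : AffineBetween f l u :=
  ⟨f l, 0, fun y hy => by
    have : y = l := le_antisymm (hy.2.trans h) hy.1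
    rw [this]; ring⟩

theorem AffineBetween.eq_interpolation {f : ℝ → ℝ} {l u : ℝ} (h : AffineBetween f l u)
    (hlu : l < u) {y : ℝ} (hy : y ∈ Set.Icc l u) :
    f y = f l + (f u - f l) / (u - l) * (y - l) := by
  obtain ⟨c, m, h⟩ := h
  have hne : u - l ≠ 0 := by linarith
  rw [h y hy, h l ⟨le_rfl, hlu.le⟩, h u ⟨hlu.le, le_rfl⟩]
  field_simp
  ring

theorem affineBetween_subgameFun {n : ℕ} (p : PMF (Fin (n + 1))) {w : ℕ → ℕ → ℝ} {a b : ℕ}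
    {l u : ℝ} (h : ∀ k : Fin n, AffineBetween (fun y => turnFun p w b y (a - (k + 1))) l u) :
    AffineBetween (subgameFun p w a b) l u := by
  choose c m h using h
  refine ⟨(p 0).toReal + ∑ k, (p k.succ).toReal * c k,
    -(p 0).toReal + ∑ k, (p k.succ).toReal * m k, fun y hy => ?_⟩
  have h' : ∀ k : Fin n, (p k.succ).toReal * turnFun p w b y (a - (k + 1)) =
      (p k.succ).toReal * c k + (p k.succ).toReal * m k * y := by
    intro k
    rw [show turnFun p w b y (a - (k + 1)) = c k + m k * y from h k y hy]
    ring
  rw [subgameFun, Finset.sum_congr rfl fun k _ => h' k, Finset.sum_add_distrib, ← Finset.sum_mul]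
  ring

/-- The points `L 0 ≤ … ≤ L K` divide `[0,2]` into intervals on which the functions `f_{a,b,i}`,
`i < K`, are affine.  (These functions do not depend on `a`.)  The right end `2` exceeds all values
of the game, so that a value is always followed by a larger grid point. -/
structure IsGrid {n : ℕ} (p : PMF (Fin (n + 1))) (b K : ℕ) (L : ℕ → ℝ) : Prop where
  zero : L 0 = 0
  last : L K = 2
  step : ∀ j, j < K → L j ≤ L (j + 1)
  affine : ∀ i, i < K → ∀ j, j < K →
    AffineBetween (fun y => turnFun p (gameValue p) b y i) (L j) (L (j + 1))

theorem IsGrid.congr {n : ℕ} {p : PMF (Fin (n + 1))} {b K : ℕ} {L L' : ℕ → ℝ} (h : IsGrid p b K L)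
    (hL : ∀ k, k ≤ K → L' k = L k) : IsGrid p b K L' where
  zero := by rw [hL 0 (Nat.zero_le _), h.zero]
  last := by rw [hL K le_rfl, h.last]
  step j hj := by rw [hL j hj.le, hL (j + 1) hj]; exact h.step j hj
  affine i hi j hj := by rw [hL j hj.le, hL (j + 1) hj]; exact h.affine i hi j hj

theorem IsGrid.mono {n : ℕ} {p : PMF (Fin (n + 1))} {b K : ℕ} {L : ℕ → ℝ} (h : IsGrid p b K L)
    {i j : ℕ} (hij : i ≤ j) (hj : j ≤ K) : L i ≤ L j := by
  induction j, hij using Nat.le_induction with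
  | base => exact le_rfl
  | succ j _ ih => exact (ih (by omega)).trans (h.step j (by omega))

theorem isGrid_one {n : ℕ} (p : PMF (Fin (n + 1))) (b : ℕ) {L : ℕ → ℝ} (h0 : L 0 = 0)
    (h1 : L 1 = 2) : IsGrid p b 1 L where
  zero := h0
  last := h1
  step j hj := by
    obtain rfl : j = 0 := by omega
    rw [h0, h1]; norm_num
  affine i hi j _ := by
    obtain rfl : i = 0 := by omega
    simp only [turnFun_zero]
    exact affineBetween_const _ _ _

theorem IsGrid.affineBetween_subgameFun {n : ℕ} {p : PMF (Fin (n + 1))} {b K : ℕ} {L : ℕ → ℝ}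
    (h : IsGrid p b K L) {j : ℕ} (hj : j < K) :
    AffineBetween (subgameFun p (gameValue p) K b) (L j) (L (j + 1)) :=
  GenPig.affineBetween_subgameFun p fun k => h.affine _ (by omega) j hj

/-- Insert `c` after the position `j`. -/
noncomputable def insertAfter (L : ℕ → ℝ) (j : ℕ) (c : ℝ) (k : ℕ) : ℝ :=
  if k ≤ j then L k else if k ≤ j + 1 then c else L (k - 1)

/-- Inserting the point `c` at which rolling becomes worse than holding with `K` points missing
makes the grid fine enough for the next function.  Nothing is required to the left of `c = 0` or to
the right of `c = 2`, where a grid interval is a single point; so `c` may be put there if rolling is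
worse than holding everywhere, or nowhere. -/
theorem IsGrid.insert {n : ℕ} {p : PMF (Fin (n + 1))} {b K : ℕ} {L : ℕ → ℝ}
    (h : IsGrid p b K L) {j : ℕ} (hj : j < K) {c : ℝ} (h1 : L j ≤ c) (h2 : c ≤ L (j + 1))
    (hroll : 0 < c → ∀ y, y ≤ c → 1 - gameValue p b K ≤ subgameFun p (gameValue p) K b y)
    (hhold : c < 2 → ∀ y, c ≤ y → subgameFun p (gameValue p) K b y ≤ 1 - gameValue p b K) :
    IsGrid p b (K + 1) (insertAfter L j c) := by
  -- Every interval of the new grid is contained in one of the old grid, and lies on one side of `c`.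
  have key : ∀ k, k < K + 1 → ∃ i, i < K ∧ L i ≤ insertAfter L j c k ∧
      insertAfter L j c (k + 1) ≤ L (i + 1) ∧ insertAfter L j c k ≤ insertAfter L j c (k + 1) ∧
      (insertAfter L j c (k + 1) ≤ c ∨ c ≤ insertAfter L j c k) := by
    intro k hk
    rcases lt_trichotomy k j with hkj | rfl | hkj
    · have e1 : insertAfter L j c k = L k := by
        rw [insertAfter, if_pos (by omega)]
      have e2 : insertAfter L j c (k + 1) = L (k + 1) := by
        rw [insertAfter, if_pos (by omega)]
      rw [e1, e2]
      exact ⟨k, by omega, le_rfl, le_rfl, h.step k (by omega),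
        Or.inl ((h.mono (by omega) hj.le).trans h1)⟩
    · have e1 : insertAfter L k c k = L k := by
        rw [insertAfter, if_pos (by omega)]
      have e2 : insertAfter L k c (k + 1) = c := by
        rw [insertAfter, if_neg (by omega), if_pos (by omega)]
      rw [e1, e2]
      exact ⟨k, hj, le_rfl, h2, h1, Or.inl le_rfl⟩
    · have e2 : insertAfter L j c (k + 1) = L k := by
        rw [insertAfter, if_neg (by omega), if_neg (by omega), Nat.add_sub_cancel]
      rcases Nat.lt_or_ge (j + 1) k with hk2 | hk2
      · have e1 : insertAfter L j c k = L (k - 1) := by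
          rw [insertAfter, if_neg (by omega), if_neg (by omega)]
        rw [e1, e2]
        refine ⟨k - 1, by omega, le_rfl, ?_, h.mono (by omega) (by omega),
          Or.inr (h2.trans (h.mono (by omega) (by omega)))⟩
        rw [Nat.sub_add_cancel (by omega)]
      · obtain rfl : k = j + 1 := by omega
        have e1 : insertAfter L j c (j + 1) = c := by
          rw [insertAfter, if_neg (by omega), if_pos (by omega)]
        rw [e1, e2]
        exact ⟨j, hj, h1, le_rfl, h2, Or.inr le_rfl⟩
  refine ⟨?_, ?_, fun k hk => ?_, fun i hi k hk => ?_⟩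
  · rw [insertAfter, if_pos (Nat.zero_le _), h.zero]
  · rw [insertAfter, if_neg (by omega), if_neg (by omega), Nat.add_sub_cancel, h.last]
  · obtain ⟨_, _, _, _, hle, _⟩ := key k hk
    exact hle
  · obtain ⟨m, hm, g1, g2, g3, g4⟩ := key k hk
    rcases Nat.lt_or_ge i K with hiK | hiK
    · exact (h.affine i hiK m hm).mono g1 g2
    · obtain rfl : i = K := by omega
      have hK : 1 ≤ i := by omega
      have hf := (h.affineBetween_subgameFun hm).mono g1 g2
      have hpos : 0 ≤ insertAfter L j c k := by
        rw [← h.zero]; exact (h.mono (Nat.zero_le _) hm.le).trans g1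
      have htwo : insertAfter L j c (k + 1) ≤ 2 := by
        rw [← h.last]; exact g2.trans (h.mono (by omega) le_rfl)
      rcases g4 with g4 | g4
      · rcases le_or_gt c 0 with hc | hc
        · exact affineBetween_of_le _ ((g4.trans hc).trans hpos)
        · refine hf.congr fun y hy => ?_
          rw [turnFun_eq_max p _ _ _ hK, max_eq_right (hroll hc y (hy.2.trans g4))]
      · rcases le_or_gt 2 c with hc | hc
        · exact affineBetween_of_le _ ((htwo.trans hc).trans g4)
        · refine (affineBetween_const (1 - gameValue p b i) _ _).congr fun y hy => ?_
          rw [turnFun_eq_max p _ _ _ hK, max_eq_left (hhold hc y (g4.trans hy.1))]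

/-- The point to be inserted, computed from the values of `f` at the ends `l` and `u` of the grid
interval in which `f` passes the level `H`. -/
noncomputable def crossing (f : ℝ → ℝ) (H l u : ℝ) : ℝ :=
  if f l ≤ H then l else if H ≤ f u then u else l + (f l - H) * (u - l) / (f l - f u)

theorem crossing_mem_Icc {f : ℝ → ℝ} {H l u : ℝ} (hlu : l ≤ u) :
    crossing f H l u ∈ Set.Icc l u := by
  unfold crossing
  split_ifs with h1 h2
  · exact ⟨le_rfl, hlu⟩
  · exact ⟨hlu, le_rfl⟩
  · push Not at h1 h2
    have hd : 0 < f l - f u := by linarith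
    constructor
    · have : 0 ≤ (f l - H) * (u - l) / (f l - f u) :=
        div_nonneg (mul_nonneg (by linarith) (by linarith)) hd.le
      linarith
    · have : (f l - H) * (u - l) / (f l - f u) ≤ u - l := by
        rw [div_le_iff₀ hd]
        nlinarith
      linarith

/-- In the third case of `crossing`, linear interpolation is exact. -/
theorem apply_crossing {f : ℝ → ℝ} {H l u : ℝ} (hf : AffineBetween f l u) (hlu : l ≤ u)
    (h1 : H < f l) (h2 : f u < H) : f (crossing f H l u) = H := by
  have hlt : l < u := by
    rcases hlu.eq_or_lt with rfl | h
    · exact absurd (h1.trans h2) (lt_irrefl _)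
    · exact h
  rw [hf.eq_interpolation hlt (crossing_mem_Icc hlu), crossing, if_neg (not_le.2 h1),
    if_neg (not_le.2 h2)]
  have : u - l ≠ 0 := by linarith
  have : f l - f u ≠ 0 := by linarith
  field_simp
  ring

/-- The two alternatives of a binary search for the last grid point at which rolling is not worse
than holding justify the insertion of the crossing point. -/
theorem IsGrid.insert_crossing {n : ℕ} {p : PMF (Fin (n + 1))} (hp : p 0 < 1) {b K : ℕ}
    {L : ℕ → ℝ} (h : IsGrid p b K L) {j : ℕ} (hj : j < K)
    (h1 : j = 0 ∨ 1 - gameValue p b K ≤ subgameFun p (gameValue p) K b (L j))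
    (h2 : j + 1 = K ∨ ¬ 1 - gameValue p b K ≤ subgameFun p (gameValue p) K b (L (j + 1))) :
    IsGrid p b (K + 1) (insertAfter L j (crossing (subgameFun p (gameValue p) K b)
      (1 - gameValue p b K) (L j) (L (j + 1)))) := by
  have hanti := (slowlyAntitone_subgameFun hp (gameValue p) K b).antitone
  have haff := h.affineBetween_subgameFun hj
  have hle := h.step j hj
  set f := subgameFun p (gameValue p) K b
  set H := 1 - gameValue p b K
  have hmem := crossing_mem_Icc (f := f) (H := H) hle
  refine h.insert hj hmem.1 hmem.2 (fun hc y hy => ?_) fun hc y hy => ?_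
  · by_cases g1 : f (L j) ≤ H
    · have e : crossing f H (L j) (L (j + 1)) = L j := by rw [crossing, if_pos g1]
      rw [e] at hc hy
      rcases h1 with rfl | h1
      · rw [h.zero] at hc; exact absurd hc (lt_irrefl _)
      · exact h1.trans (hanti hy)
    · by_cases g2 : H ≤ f (L (j + 1))
      · exact g2.trans (hanti (hy.trans hmem.2))
      · push Not at g1 g2
        exact (apply_crossing haff hle g1 g2).ge.trans (hanti hy)
  · by_cases g1 : f (L j) ≤ H
    · exact (hanti (hmem.1.trans hy)).trans g1
    · by_cases g2 : H ≤ f (L (j + 1))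
      · have e : crossing f H (L j) (L (j + 1)) = L (j + 1) := by
          rw [crossing, if_neg g1, if_pos g2]
        rcases h2 with h2 | h2
        · rw [e, h2, h.last] at hc; exact absurd hc (lt_irrefl _)
        · exact absurd g2 h2
      · push Not at g1 g2
        exact (hanti hy).trans (apply_crossing haff hle g1 g2).le

/-- The slope of `f` between `l` and `u`. -/
noncomputable def chordSlope (f : ℝ → ℝ) (l u : ℝ) : ℝ := (f u - f l) / (u - l)

theorem SlowlyAntitone.chordSlope_mem {f : ℝ → ℝ} (hf : SlowlyAntitone f) {l u : ℝ} (h : l < u) :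
    -1 < chordSlope f l u ∧ chordSlope f l u ≤ 0 := by
  have h1 := hf h
  have h2 : 0 < u - l := by linarith
  unfold chordSlope
  rw [lt_div_iff₀ h2]
  exact ⟨by linarith, div_nonpos_of_nonpos_of_nonneg (by linarith) h2.le⟩

/-- The first coordinate of the intersection of two lines with slopes in `(-1, 0]`. -/
theorem eq_of_lines {x y s t c d : ℝ} (hs : -1 < s ∧ s ≤ 0) (ht : -1 < t ∧ t ≤ 0)
    (hx : x = c + s * y) (hy : y = d + t * x) : x = (c + s * d) / (1 - s * t) := by
  have hst : 1 - s * t ≠ 0 := by nlinarith [hs.1, hs.2, ht.1, ht.2]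
  rw [eq_div_iff hst]
  rw [hy] at hx
  linarith

/-! ### Solution of one sub-game -/

/-- The state of the computation in which the sub-game with needs `a` and `b`, given by the
arguments `u` and `w`, is solved: the values `v(b,i)`, `i < a`, are in the real array `1`, and a
grid for the functions `f_{a,b,i}`, `i < a`, is in the cells `(b, a, 0), …, (b, a, a)` of the real
array `2`. -/
structure Ready {n : ℕ} (p : PMF (Fin (n + 1))) (u w a b : ℕ) (s : Store) : Prop where
  die : HasDie p s
  fst : s.nat 10 u 0 0 = a
  snd : s.nat 10 w 0 0 = b
  pos : 1 ≤ a
  value : ∀ i, 1 ≤ i → i < a → s.real 1 b i 0 = gameValue p b i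
  grid : IsGrid p b a (s.real 2 b a)

theorem Ready.of_frame {n : ℕ} {p : PMF (Fin (n + 1))} {u w a b : ℕ} {s s' : Store}
    {ns rs : List ℕ} (h : Ready p u w a b s) (hF : Frame ns rs s s') (h0 : 0 ∉ ns) (h10 : 10 ∉ ns)
    (hr0 : 0 ∉ rs) (hr1 : 1 ∉ rs) (hr2 : 2 ∉ rs) : Ready p u w a b s' where
  die := h.die.of_frame hF h0 hr0
  fst := (hF.nat 10 h10 _ _ _).trans h.fst
  snd := (hF.nat 10 h10 _ _ _).trans h.snd
  pos := h.pos
  value i h1 h2 := (hF.real 1 hr1 _ _ _).trans (h.value i h1 h2)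
  grid := h.grid.congr fun _ _ => hF.real 2 hr2 _ _ _

theorem Ready.putReal {n : ℕ} {p : PMF (Fin (n + 1))} {u w a b : ℕ} {s : Store}
    (h : Ready p u w a b s) {A : ℕ} (hA : 2 < A) (i j k : ℕ) (x : ℝ) :
    Ready p u w a b (s.putReal A i j k x) := by
  refine h.of_frame (ns := []) (rs := [A]) ⟨fun _ _ _ _ _ => rfl, fun B hB i' j' k' => ?_⟩
    (by simp) (by simp) (by simp; omega) (by simp; omega) (by simp; omega)
  rw [Store.putReal_real, if_neg]
  rintro ⟨rfl, _⟩
  simp at hB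

/-- `subgameProgram` evaluates `f_{a,b}` at the real variable `20`. -/
theorem Ready.subgameProgram {n : ℕ} {p : PMF (Fin (n + 1))} {u w a b : ℕ} {s : Store}
    (h : Ready p u w a b s) {N : ℕ} (ha : a ≤ N) :
    Does (subgameProgram u w) s (120 * (n + 1) * N) fun s' =>
      (s'.real 21 0 0 0 = subgameFun p (gameValue p) a b (s.real 20 0 0 0) ∧
        ∀ i, i < a → s'.real 3 i 0 0 = turnFun p (gameValue p) b (s.real 20 0 0 0) i) ∧
      Frame [20, 21] [3, 21] s s' :=
  (subgameProgram_spec h.die h.fst h.snd h.pos h.value).mono_cost (Nat.mul_le_mul_left _ ha)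

/-- The point number `e` of the grid for the functions `f_{a,b,i}`, `i < a`. -/
abbrev gridPoint (u w : ℕ) (e : NExp) : RExp := .get 2 (arg w) (arg u) e

/-- Evaluate `f_{a,b}` at the ends of the grid interval number `j`, the variable `22`; the results
are the real variables `21` (left end) and `22` (right end). -/
def endsProgram (u w : ℕ) : Program :=
  .seq (assignReal 20 (gridPoint u w (.add (natVar 22) (.lit 1))))
    (.seq (subgameProgram u w)
      (.seq (assignReal 22 (realVar 21))
        (.seq (assignReal 20 (gridPoint u w (natVar 22)))
          (subgameProgram u w))))

theorem endsProgram_spec {n : ℕ} {p : PMF (Fin (n + 1))} {u w a b : ℕ} {s : Store}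
    (h : Ready p u w a b s) {N j : ℕ} (ha : a ≤ N) (hj : s.nat 22 0 0 0 = j) :
    Does (endsProgram u w) s (2 * (120 * (n + 1) * N) + 60) fun s' =>
      (s'.real 21 0 0 0 = subgameFun p (gameValue p) a b (s.real 2 b a j) ∧
        s'.real 22 0 0 0 = subgameFun p (gameValue p) a b (s.real 2 b a (j + 1))) ∧
      Frame [20, 21] [3, 20, 21, 22] s s' := by
  have hD : Does (endsProgram u w) s (2 * (120 * (n + 1) * N) + 60) fun s' =>
      (s'.real 21 0 0 0 = subgameFun p (gameValue p) a b (s.real 2 b a j) ∧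
        s'.real 22 0 0 0 = subgameFun p (gameValue p) a b (s.real 2 b a (j + 1))) := by
    refine (Does.setReal_seq (Does.seq (T' := 120 * (n + 1) * N + 30)
      ((h.putReal (by norm_num) _ _ _ _).subgameProgram ha) fun s1 hs1 => ?rest)).mono_cost ?cost
    case cost =>
      simp only [NExp.cost, RExp.cost]
      omega
    case rest =>
      obtain ⟨⟨h1, _⟩, hF1⟩ := hs1
      refine (Does.setReal_seq (Does.setReal_seq (Does.mono
        (Ready.subgameProgram (p := p) (a := a) (b := b) (N := N) ?ready ha)
        le_rfl fun s2 hs2 => ?post))).mono_cost ?cost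
      case cost =>
        simp only [NExp.cost, RExp.cost]
        omega
      case ready =>
        refine Ready.putReal (Ready.putReal ?_ (by norm_num) _ _ _ _) (by norm_num) _ _ _ _
        exact (h.putReal (by norm_num) _ _ _ _).of_frame hF1 (by simp) (by simp) (by simp) (by simp)
          (by simp)
      case post =>
        obtain ⟨⟨h2, _⟩, hF2⟩ := hs2
        have e1 := hF2.real 22 (by simp) 0 0 0
        have e2 := hF1.real 2 (by simp) b a j
        have e3 := hF1.nat 22 (by simp) 0 0 0
        have e4 := hF1.nat 10 (by simp) u 0 0
        have e5 := hF1.nat 10 (by simp) w 0 0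
        simp [NExp.eval, RExp.eval, h.fst, h.snd, hj] at h1 h2 e1 e2 e3 e4 e5
        rw [e1, h1, h2, e3, e4, e5, e2]
        exact ⟨rfl, rfl⟩
  refine hD.frame.mono le_rfl fun s' hs' => ⟨hs'.1, hs'.2.mono ?_ ?_⟩
  · intro x
    simp [endsProgram, subgameProgram, Program.natWrites, rollProgram, forLoop]
    omega
  · intro x
    simp [endsProgram, subgameProgram, Program.realWrites, rollProgram, forLoop]
    omega

/-- Find the grid interval that contains `y = v(b,a)` by binary search (a point `z` lies to the left
of `y` or equals `y` if and only if `z ≤ f_{b,a}(f_{a,b}(z))`), and store the slope and the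
intercept of `f_{a,b}` on this interval in the cells `(0, 0, 0)` and `(1, 0, 0)` of the real
array `r`. -/
def lineProgram (u w r : ℕ) : Program :=
  .seq (binarySearch (arg u)
      (.seq (assignReal 20 (gridPoint u w (natVar 24)))
        (.seq (subgameProgram u w)
          (.seq (assignReal 20 (realVar 21)) (subgameProgram w u))))
      (.realLE (gridPoint u w (natVar 24)) (realVar 21)))
    (.seq (endsProgram u w)
      (.seq (.setReal r (.lit 0) (.lit 0) (.lit 0)
          (.div (.sub (realVar 22) (realVar 21))
            (.sub (gridPoint u w (.add (natVar 22) (.lit 1))) (gridPoint u w (natVar 22)))))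
        (.setReal r (.lit 1) (.lit 0) (.lit 0)
          (.sub (realVar 21)
            (.mul (.get r (.lit 0) (.lit 0) (.lit 0)) (gridPoint u w (natVar 22)))))))

theorem lineProgram_spec {n : ℕ} {p : PMF (Fin (n + 1))} (hp : p 0 < 1) {u w a b r : ℕ} {s : Store}
    (h : Ready p u w a b s) (h' : Ready p w u b a s) {N k : ℕ} (ha : a ≤ N) (hb : b ≤ N)
    (hN : N ≤ 2 ^ k) (hr : 22 < r) :
    Does (lineProgram u w r) s (3 * (120 * (n + 1) * N) * k + 4 * (120 * (n + 1) * N)) fun s' =>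
      ((-1 < s'.real r 0 0 0 ∧ s'.real r 0 0 0 ≤ 0) ∧
        gameValue p a b = s'.real r 1 0 0 + s'.real r 0 0 0 * gameValue p b a) ∧
      Frame [20, 21, 22, 23, 24] [3, 20, 21, 22, r] s s' := by
  have hC : 120 ≤ 120 * (n + 1) * N := by
    have := h.pos
    nlinarith [Nat.zero_le (n * N)]
  set C := 120 * (n + 1) * N with hCdef
  have hf := slowlyAntitone_subgameFun hp (gameValue p) a b
  have hg := slowlyAntitone_subgameFun hp (gameValue p) b a
  have hy : gameValue p b a =
      subgameFun p (gameValue p) b a (subgameFun p (gameValue p) a b (gameValue p b a)) :=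
    (gameValue_spec hp b a).2
  have hD : Does (lineProgram u w r) s (3 * C * k + 4 * C) fun s' =>
      ((-1 < s'.real r 0 0 0 ∧ s'.real r 0 0 0 ≤ 0) ∧
        gameValue p a b = s'.real r 1 0 0 + s'.real r 0 0 0 * gameValue p b a) := by
    refine (Does.seq (T' := 2 * C + 150) (Does.binarySearch (hi := a) (L := k) (c := 2 * C + 30)
      (fun i => s.real 2 b a i ≤ gameValue p b a) ?_ ?_ h.pos (ha.trans hN) ?_).frame
      fun s1 hs1 => ?rest).mono_cost ?cost
    case cost =>
      simp only [NExp.cost, RExp.cost, Test.cost]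
      have : k * (2 * C + 30 + (1 + 1 + 1 + 1 + (1 + 1 + 1 + 1) + (1 + 1 + 1 + 1) + 1 +
        (1 + 1 + 1 + 1) + 1) + 40) ≤ k * (3 * C) := Nat.mul_le_mul_left k (by omega)
      nlinarith
    · intro v hv
      simp [subgameProgram, Program.natWrites, rollProgram, forLoop] at hv ⊢
      omega
    · simp [NExp.eval, h.fst]
    · intro i s1 hi0 hia hF hi
      have hF' : Frame [20, 21, 22, 23, 24] [3, 20, 21] s s1 := by
        refine hF.mono ?_ ?_
        · intro x
          simp [subgameProgram, Program.natWrites, rollProgram, forLoop]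
          omega
        · intro x
          simp [subgameProgram, Program.realWrites, rollProgram, forLoop]
          omega
      have r1 := h.of_frame hF' (by simp) (by simp) (by simp) (by simp) (by simp)
      have r2 := h'.of_frame hF' (by simp) (by simp) (by simp) (by simp) (by simp)
      refine (Does.setReal_seq (Does.seq (T' := C + 8)
        ((r1.putReal (by norm_num) _ _ _ _).subgameProgram ha) fun s2 hs2 => ?next)).mono_cost ?cost1
      case cost1 =>
        rw [← hCdef]
        simp only [NExp.cost, RExp.cost]
        omega
      case next =>
        obtain ⟨⟨h2, _⟩, hF2⟩ := hs2
        refine (Does.setReal_seq (Does.mono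
          (Ready.subgameProgram (p := p) (a := b) (b := a) (N := N) (Ready.putReal
            ((r2.putReal (by norm_num) _ _ _ _).of_frame hF2 (by simp) (by simp)
              (by simp) (by simp) (by simp)) (by norm_num) _ _ _ _) hb) le_rfl
          fun s3 hs3 => ?post)).mono_cost ?cost2
        case cost2 =>
          rw [← hCdef]
          simp only [NExp.cost, RExp.cost]
          omega
        case post =>
          obtain ⟨⟨h3, _⟩, hF3⟩ := hs3
          have e1 := hF2.real 2 (by simp) b a i
          have e2 := hF2.nat 10 (by simp) u 0 0
          have e3 := hF2.nat 10 (by simp) w 0 0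
          have e4 := hF2.nat 24 (by simp) 0 0 0
          have e5 := hF3.real 2 (by simp) b a i
          have e6 := hF3.nat 10 (by simp) u 0 0
          have e7 := hF3.nat 10 (by simp) w 0 0
          have e8 := hF3.nat 24 (by simp) 0 0 0
          have e9 := hF'.real 2 (by simp) b a i
          simp [NExp.eval, RExp.eval, r1.fst, r1.snd, hi] at h2 h3 e1 e2 e3 e4 e5 e6 e7 e8
          rw [← hf.le_comp_iff hg hy]
          simp [Test.Holds, NExp.eval, RExp.eval, e6, e7, e8, e5, e1, e2, e3, e4, h3, h2, e9]
    case rest =>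
      obtain ⟨⟨j, hj, hja, hj1, hj2⟩, hF1⟩ := hs1
      have hF1' : Frame [20, 21, 22, 23, 24] [3, 20, 21] s s1 := by
        refine hF1.mono ?_ ?_
        · intro x
          simp [binarySearch, subgameProgram, Program.natWrites, rollProgram, forLoop]
          omega
        · intro x
          simp [binarySearch, subgameProgram, Program.realWrites, rollProgram, forLoop]
          omega
      have r1 := h.of_frame hF1' (by simp) (by simp) (by simp) (by simp) (by simp)
      refine (Does.seq (T' := 80) (endsProgram_spec r1 ha hj) fun s2 ⟨⟨h2, h3⟩, hF2⟩ =>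
        (Does.setReal_seq (Does.setReal ?_)).mono_cost (by simp [NExp.cost, RExp.cost])).mono_cost
          (by omega)
      have e0 := hF1'.real 2 (by simp) b a
      have e1 := hF2.real 2 (by simp) b a
      have e2 := hF2.nat 10 (by simp) u 0 0
      have e3 := hF2.nat 10 (by simp) w 0 0
      have e4 := hF2.nat 22 (by simp) 0 0 0
      have hr2 : ¬ 2 = r := by omega
      have hr21 : ¬ 21 = r := by omega
      rw [r1.fst] at e2
      rw [r1.snd] at e3
      rw [hj] at e4
      -- The search does not test the ends `0` and `2` of the grid, which lie on the right sides of
      -- `v(b,a)` anyway.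
      have hl : s.real 2 b a j ≤ gameValue p b a := by
        rcases hj1 with rfl | hj1
        · rw [h.grid.zero]; exact (gameValue_mem_Icc hp b a).1
        · exact hj1
      have hu : gameValue p b a < s.real 2 b a (j + 1) := by
        rcases hj2 with hj2 | hj2
        · rw [hj2, h.grid.last]; linarith [(gameValue_mem_Icc hp b a).2]
        · exact not_le.1 hj2
      have haff := h.grid.affineBetween_subgameFun hja
      have hslope := hf.chordSlope_mem (hl.trans_lt hu)
      have hint := haff.eq_interpolation (hl.trans_lt hu) ⟨hl, hu.le⟩
      rw [← gameValue_eq hp a b] at hint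
      simp [NExp.eval, RExp.eval, e0, e1, e2, e3, e4, h2, h3, hr2, hr21]
      refine ⟨hslope, ?_⟩
      rw [hint]
      ring
  refine hD.frame.mono le_rfl fun s' hs' => ⟨hs'.1, hs'.2.mono ?_ ?_⟩
  · intro x
    simp [lineProgram, binarySearch, endsProgram, subgameProgram, Program.natWrites, rollProgram,
      forLoop]
    omega
  · intro x
    simp [lineProgram, binarySearch, endsProgram, subgameProgram, Program.realWrites, rollProgram,
      forLoop]
    omega

/-- The values and actions with needs `a` and `b` are in the output arrays, and the actions are
greedy. -/
structure Solved {n : ℕ} (p : PMF (Fin (n + 1))) (a b : ℕ) (s : Store) : Prop where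
  value : ∀ τ, τ < a → s.values a b τ = turnValue p a b τ
  action : ∀ τ, 0 < τ → τ < a → turnFun p (gameValue p) b (gameValue p b a) (a - τ) =
    match s.actions a b τ with
    | .hold => 1 - gameValue p b (a - τ)
    | .roll => subgameFun p (gameValue p) (a - τ) b (gameValue p b a)

theorem Solved.congr {n : ℕ} {p : PMF (Fin (n + 1))} {a b : ℕ} {s s' : Store}
    (h : Solved p a b s) (hv : ∀ τ, s'.real 1 a b τ = s.real 1 a b τ)
    (ha : ∀ τ, s'.nat 1 a b τ = s.nat 1 a b τ) : Solved p a b s' where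
  value τ hτ := (hv τ).trans (h.value τ hτ)
  action τ h0 hτ := by
    have e : s'.actions a b τ = s.actions a b τ := by rw [Store.actions, Store.actions, ha]
    rw [e]
    exact h.action τ h0 hτ

/-- Intersect the lines in the real arrays `30` and `31`, which gives `v(a,b)` and `v(b,a)` in the
real variables `34` and `35`, and fill in the output for the needs `a` and `b`. -/
def outputProgram (u w : ℕ) : Program :=
  .seq (assignReal 34 (.div
      (.add (.get 30 (.lit 1) (.lit 0) (.lit 0)) (.mul (realVar 30)
        (.get 31 (.lit 1) (.lit 0) (.lit 0))))
      (.sub .one (.mul (realVar 30) (realVar 31)))))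
    (.seq (assignReal 35 (.add (.get 31 (.lit 1) (.lit 0) (.lit 0))
        (.mul (realVar 31) (realVar 34))))
      (.seq (assignReal 20 (realVar 35))
        (.seq (subgameProgram u w)
          (.seq (.setReal 1 (arg u) (arg w) (.lit 0) (realVar 34))
            (.seq (.setNat 1 (arg u) (arg w) (.lit 0) (.lit 1))
              (forLoop 25 (.lit 1) (.sub (arg u) (.lit 1))
                (.seq (.setReal 1 (arg u) (arg w) (.sub (arg u) (natVar 25))
                    (.get 3 (natVar 25) (.lit 0) (.lit 0)))
                  (.ite (.realLE (.get 3 (natVar 25) (.lit 0) (.lit 0))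
                      (.sub .one (.get 1 (arg w) (natVar 25) (.lit 0))))
                    (.setNat 1 (arg u) (arg w) (.sub (arg u) (natVar 25)) (.lit 0))
                    (.setNat 1 (arg u) (arg w) (.sub (arg u) (natVar 25)) (.lit 1))))))))))

theorem outputProgram_spec {n : ℕ} {p : PMF (Fin (n + 1))} {u w a b : ℕ}
    {s : Store} (h : Ready p u w a b s) {N : ℕ} (ha : a ≤ N)
    (hs : -1 < s.real 30 0 0 0 ∧ s.real 30 0 0 0 ≤ 0)
    (ht : -1 < s.real 31 0 0 0 ∧ s.real 31 0 0 0 ≤ 0)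
    (hx : gameValue p a b = s.real 30 1 0 0 + s.real 30 0 0 0 * gameValue p b a)
    (hy : gameValue p b a = s.real 31 1 0 0 + s.real 31 0 0 0 * gameValue p a b) :
    Does (outputProgram u w) s (3 * (120 * (n + 1) * N)) fun s' =>
      (Solved p a b s' ∧ s'.real 35 0 0 0 = gameValue p b a ∧
        ∀ c d, ¬ (c = a ∧ d = b) → ∀ τ, s'.real 1 c d τ = s.real 1 c d τ ∧
          s'.nat 1 c d τ = s.nat 1 c d τ) ∧
      Frame [1, 20, 21, 25] [1, 3, 20, 21, 34, 35] s s' := by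
  have hC : 120 * a ≤ 120 * (n + 1) * N := by
    rw [mul_assoc]
    exact Nat.mul_le_mul_left _ (ha.trans (Nat.le_mul_of_pos_left _ (by omega)))
  have ha1 := h.pos
  set C := 120 * (n + 1) * N with hCdef
  have hX := eq_of_lines hs ht hx hy
  have hD : Does (outputProgram u w) s (3 * C) fun s' =>
      (Solved p a b s' ∧ s'.real 35 0 0 0 = gameValue p b a ∧
        ∀ c d, ¬ (c = a ∧ d = b) → ∀ τ, s'.real 1 c d τ = s.real 1 c d τ ∧
          s'.nat 1 c d τ = s.nat 1 c d τ) := by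
    refine (Does.setReal_seq (Does.setReal_seq (Does.setReal_seq (Does.seq (T' := C + 60)
      ((((h.putReal (by norm_num) _ _ _ _).putReal (by norm_num) _ _ _ _).putReal (by norm_num)
        _ _ _ _).subgameProgram ha) fun s1 hs1 => ?next)))).mono_cost ?cost
    case cost =>
      simp only [NExp.cost, RExp.cost]
      omega
    case next =>
    obtain ⟨⟨-, hT⟩, hF1⟩ := hs1
    simp [NExp.eval, RExp.eval, ← hX, ← hy] at hT
    have f3 := hF1.nat 10 (by simp) u 0 0
    have f4 := hF1.nat 10 (by simp) w 0 0
    have f5 := hF1.real 34 (by simp) 0 0 0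
    have f6 := hF1.real 35 (by simp) 0 0 0
    have f7 := hF1.real 1 (by simp)
    have f8 := hF1.nat 1 (by simp)
    simp [h.fst, h.snd] at f3 f4 f7 f8
    simp [NExp.eval, RExp.eval, ← hX, ← hy] at f5 f6
    refine (Does.setReal_seq (Does.setNat_seq (Does.mono (Does.forLoop (lo := 1) (hi := a - 1)
      (c := 80) (fun i s' => (∀ j, 1 ≤ j → j < i → s'.real 1 a b (a - j) =
          turnFun p (gameValue p) b (gameValue p b a) j ∧
          (s'.nat 1 a b (a - j) = 0 ↔ turnFun p (gameValue p) b (gameValue p b a) j ≤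
            1 - gameValue p b j)) ∧ s'.real 1 a b 0 = gameValue p a b ∧
          s'.real 35 0 0 0 = gameValue p b a ∧
          ∀ c d, ¬ (c = a ∧ d = b) → ∀ τ, s'.real 1 c d τ = s.real 1 c d τ ∧
            s'.nat 1 c d τ = s.nat 1 c d τ) ?_ ?_ ?_ ?_ ?_ ?_)
      le_rfl fun s2 hs2 => ?post))).mono_cost ?cost2
    case cost2 =>
      simp only [NExp.cost, RExp.cost]
      omega
    case post =>
      obtain ⟨hi, hloop, h0, h35, hother⟩ := hs2
      refine ⟨⟨fun τ hτ => ?_, fun τ h0 hτ => ?_⟩, h35, hother⟩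
      · rcases Nat.eq_zero_or_pos τ with rfl | hpos
        · rw [turnValue, if_pos rfl]
          exact h0
        · rw [turnValue, if_neg hpos.ne', ← (hloop (a - τ) (by omega) (by omega)).1,
            Nat.sub_sub_self hτ.le]
          rfl
      · have hact := (hloop (a - τ) (by omega) (by omega)).2
        rw [Nat.sub_sub_self hτ.le] at hact
        have hmax := turnFun_eq_max p (gameValue p) b (gameValue p b a)
          (show 1 ≤ a - τ by omega)
        by_cases hz : s2.nat 1 a b τ = 0
        · rw [Store.actions, if_pos hz]
          exact le_antisymm (hact.1 hz) (by rw [hmax]; exact le_max_left _ _)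
        · rw [Store.actions, if_neg hz]
          have hlt : ¬ turnFun p (gameValue p) b (gameValue p b a) (a - τ) ≤
              1 - gameValue p b (a - τ) := fun hc => hz (hact.2 hc)
          simp only
          rw [hmax, max_eq_right]
          by_contra! hc
          exact hlt (by rw [hmax, max_eq_left hc.le])
    · simp [Program.natWrites]
    · simp [NExp.eval]
    · omega
    · intro s' hF
      have := hF.nat 10 (by simp [Program.natWrites]) u 0 0
      simp [f3] at this
      simp [NExp.eval, this]
    · refine ⟨fun j _ _ => by omega, ?_, ?_, fun c d hcd τ => ?_⟩
      · simp [NExp.eval, RExp.eval, f3, f4, f5]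
      · simp [f6]
      · have : ¬ (c = a ∧ d = b ∧ τ = 0) := fun hc => hcd ⟨hc.1, hc.2.1⟩
        simp [NExp.eval, f3, f4, f7, f8, this]
    · intro i s' h1 h2 hF hi hI
      obtain ⟨hloop, h0, h35, hother⟩ := hI
      have e1 := hF.nat 10 (by simp [Program.natWrites]) u 0 0
      have e2 := hF.nat 10 (by simp [Program.natWrites]) w 0 0
      have e3 := hF.real 3 (by simp [Program.realWrites]) i 0 0
      simp [f3, f4] at e1 e2 e3
      rw [hT i (by omega)] at e3
      -- As `i < a`, the value `v(b,i)` is not among the cells that are being filled.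
      have hbi : ¬ (b = a ∧ i = b) := by omega
      have e4 := (hother b i hbi 0).1
      rw [h.value i h1 (by omega)] at e4
      have hne : ∀ j, j < i + 1 → (a - j = a - i ↔ j = i) := by omega
      have hne0 : ¬ 0 = a - i := by omega
      have hba : ¬ (b = a ∧ i = b ∧ 0 = a - i) := by omega
      refine (Does.setReal_seq (Does.ite (T := 30) (fun hb => ?_) fun hb => ?_)).mono_cost ?_
      · simp [Test.Holds, NExp.eval, RExp.eval, e1, e2, e3, hi, e4, hba] at hb
        refine (Does.setNat ?_).mono_cost (by simp [NExp.cost])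
        refine ⟨fun j hj1 hj2 => ?_, ?_, ?_, fun c d hcd τ => ?_⟩
        · by_cases hji : j = i
          · subst hji
            simp [NExp.eval, RExp.eval, e1, e2, e3, hi, hb]
          · have := hloop j hj1 (by omega)
            simpa [NExp.eval, RExp.eval, e1, e2, e3, hi, hne j hj2, hji] using this
        · simp [NExp.eval, RExp.eval, e1, e2, hi, hne0, h0]
        · simp [h35]
        · have : ¬ (c = a ∧ d = b ∧ τ = a - i) := fun hc => hcd ⟨hc.1, hc.2.1⟩
          simpa [NExp.eval, RExp.eval, e1, e2, hi, this] using hother c d hcd τ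
      · simp [Test.Holds, NExp.eval, RExp.eval, e1, e2, e3, hi, e4, hba] at hb
        refine (Does.setNat ?_).mono_cost (by simp [NExp.cost])
        refine ⟨fun j hj1 hj2 => ?_, ?_, ?_, fun c d hcd τ => ?_⟩
        · by_cases hji : j = i
          · subst hji
            simp [NExp.eval, RExp.eval, e1, e2, e3, hi, hb]
          · have := hloop j hj1 (by omega)
            simpa [NExp.eval, RExp.eval, e1, e2, e3, hi, hne j hj2, hji] using this
        · simp [NExp.eval, RExp.eval, e1, e2, hi, hne0, h0]
        · simp [h35]
        · have : ¬ (c = a ∧ d = b ∧ τ = a - i) := fun hc => hcd ⟨hc.1, hc.2.1⟩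
          simpa [NExp.eval, RExp.eval, e1, e2, hi, this] using hother c d hcd τ
      · simp only [NExp.cost, RExp.cost, Test.cost]
        omega
  refine hD.frame.mono le_rfl fun s' hs' => ⟨hs'.1, hs'.2.mono ?_ ?_⟩
  · intro x
    simp [outputProgram, subgameProgram, Program.natWrites, rollProgram, forLoop]
    omega
  · intro x
    simp [outputProgram, subgameProgram, Program.realWrites, rollProgram, forLoop]
    omega

/-- Find the number of the grid interval in which `f_{a,b}` passes `1 - v(b,a)` and insert the
crossing point; the new grid is stored in the cells `(b, a + 1, 0), …, (b, a + 1, a + 1)`. -/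
def refineProgram (u w : ℕ) : Program :=
  .seq (assignReal 36 (.sub .one (realVar 35)))
    (.seq (binarySearch (arg u)
        (.seq (assignReal 20 (gridPoint u w (natVar 24))) (subgameProgram u w))
        (.realLE (realVar 36) (realVar 21)))
      (.seq (endsProgram u w)
        (.seq (.ite (.realLE (realVar 21) (realVar 36))
            (assignReal 37 (gridPoint u w (natVar 22)))
            (.ite (.realLE (realVar 36) (realVar 22))
              (assignReal 37 (gridPoint u w (.add (natVar 22) (.lit 1))))
              (assignReal 37 (.add (gridPoint u w (natVar 22))
                (.div (.mul (.sub (realVar 21) (realVar 36))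
                    (.sub (gridPoint u w (.add (natVar 22) (.lit 1))) (gridPoint u w (natVar 22))))
                  (.sub (realVar 21) (realVar 22)))))))
          (forLoop 26 (.lit 0) (.add (arg u) (.lit 1))
            (.ite (.natLE (natVar 26) (natVar 22))
              (.setReal 2 (arg w) (.add (arg u) (.lit 1)) (natVar 26)
                (gridPoint u w (natVar 26)))
              (.ite (.natLE (natVar 26) (.add (natVar 22) (.lit 1)))
                (.setReal 2 (arg w) (.add (arg u) (.lit 1)) (natVar 26) (realVar 37))
                (.setReal 2 (arg w) (.add (arg u) (.lit 1)) (natVar 26)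
                  (gridPoint u w (.sub (natVar 26) (.lit 1))))))))))

theorem refineProgram_spec {n : ℕ} {p : PMF (Fin (n + 1))} (hp : p 0 < 1) {u w a b : ℕ}
    {s : Store} (h : Ready p u w a b s) {N k : ℕ} (ha : a ≤ N) (hN : N ≤ 2 ^ k)
    (hy : s.real 35 0 0 0 = gameValue p b a) :
    Does (refineProgram u w) s (2 * (120 * (n + 1) * N) * k + 8 * (120 * (n + 1) * N)) fun s' =>
      (IsGrid p b (a + 1) (s'.real 2 b (a + 1)) ∧
        ∀ d K, ¬ (d = b ∧ K = a + 1) → ∀ i, s'.real 2 d K i = s.real 2 d K i) ∧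
      Frame [20, 21, 22, 23, 24, 26] [2, 3, 20, 21, 22, 36, 37] s s' := by
  have ha1 := h.pos
  have hC : 120 * a ≤ 120 * (n + 1) * N := by
    rw [mul_assoc]
    exact Nat.mul_le_mul_left _ (ha.trans (Nat.le_mul_of_pos_left _ (by omega)))
  set C := 120 * (n + 1) * N with hCdef
  have hD : Does (refineProgram u w) s (2 * C * k + 8 * C) fun s' =>
      IsGrid p b (a + 1) (s'.real 2 b (a + 1)) ∧
        ∀ d K, ¬ (d = b ∧ K = a + 1) → ∀ i, s'.real 2 d K i = s.real 2 d K i := by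
    refine (Does.setReal_seq (Does.seq (T' := 5 * C + 300) (Does.binarySearch (hi := a) (L := k)
      (c := C + 20) (fun i => 1 - gameValue p b a ≤
        subgameFun p (gameValue p) a b (s.real 2 b a i)) ?_ ?_ h.pos (ha.trans hN) ?_).frame
      fun s1 hs1 => ?rest)).mono_cost ?cost
    case cost =>
      simp only [NExp.cost, RExp.cost, Test.cost]
      have : k * (C + 20 + (1 + 1 + 1 + 1 + (1 + 1 + 1 + 1) + 1) + 40) ≤ k * (2 * C) :=
        Nat.mul_le_mul_left k (by omega)
      nlinarith
    · intro v hv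
      simp [subgameProgram, Program.natWrites, rollProgram, forLoop] at hv ⊢
      omega
    · simp [NExp.eval, h.fst]
    · intro i s1 hi0 hia hF hi
      have hF' : Frame [20, 21, 22, 23, 24] [3, 20, 21] (s.putReal 36 0 0 0 (1 - gameValue p b a))
          s1 := by
        simp [NExp.eval, RExp.eval, hy] at hF
        refine hF.mono ?_ ?_
        · intro x
          simp [subgameProgram, Program.natWrites, rollProgram, forLoop]
          omega
        · intro x
          simp [subgameProgram, Program.realWrites, rollProgram, forLoop]
          omega
      have r1 := (h.putReal (A := 36) (by norm_num) 0 0 0 (1 - gameValue p b a)).of_frame hF'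
        (by simp) (by simp) (by simp) (by simp) (by simp)
      refine (Does.setReal_seq (Does.mono
        ((r1.putReal (by norm_num) _ _ _ _).subgameProgram ha) le_rfl
          fun s2 hs2 => ?next)).mono_cost ?cost1
      case cost1 =>
        rw [← hCdef]
        simp only [NExp.cost, RExp.cost]
        omega
      case next =>
        obtain ⟨⟨h2, _⟩, hF2⟩ := hs2
        have e1 := hF2.real 36 (by simp) 0 0 0
        have e2 := hF'.real 36 (by simp) 0 0 0
        have e3 := hF'.real 2 (by simp) b a i
        simp [NExp.eval, RExp.eval, r1.fst, r1.snd, hi] at h2 e1 e2 e3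
        simp [Test.Holds, NExp.eval, RExp.eval, e1, e2, h2, e3]
    case rest =>
    obtain ⟨⟨j, hj, hja, hj1, hj2⟩, hF1⟩ := hs1
    have hF1' : Frame [20, 21, 22, 23, 24] [3, 20, 21]
        (s.putReal 36 0 0 0 (1 - gameValue p b a)) s1 := by
      simp [NExp.eval, RExp.eval, hy] at hF1
      refine hF1.mono ?_ ?_
      · intro x
        simp [binarySearch, subgameProgram, Program.natWrites, rollProgram, forLoop]
        omega
      · intro x
        simp [binarySearch, subgameProgram, Program.realWrites, rollProgram, forLoop]
        omega
    have r1 := (h.putReal (A := 36) (by norm_num) 0 0 0 (1 - gameValue p b a)).of_frame hF1'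
      (by simp) (by simp) (by simp) (by simp) (by simp)
    have hgrid := h.grid.insert_crossing hp hja hj1 hj2
    set c := crossing (subgameFun p (gameValue p) a b) (1 - gameValue p b a)
      (s.real 2 b a j) (s.real 2 b a (j + 1)) with hc
    have g2 : s1.real 2 = s.real 2 := by
      funext x y z
      simpa using hF1'.real 2 (by simp) x y z
    have g36 : s1.real 36 0 0 0 = 1 - gameValue p b a := by
      simpa using hF1'.real 36 (by simp) 0 0 0
    refine (Does.seq (T' := 3 * C + 200) (endsProgram_spec r1 ha hj) fun s2 hs2 =>
      ?ends).mono_cost (by omega)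
    case ends =>
    obtain ⟨⟨h2, h3⟩, hF2⟩ := hs2
    have k2 : s2.real 2 = s.real 2 := by
      rw [← g2]
      funext x y z
      exact hF2.real 2 (by simp) x y z
    have k36 := (hF2.real 36 (by simp) 0 0 0).trans g36
    have ku := (hF2.nat 10 (by simp) u 0 0).trans r1.fst
    have kw := (hF2.nat 10 (by simp) w 0 0).trans r1.snd
    have k22 := (hF2.nat 22 (by simp) 0 0 0).trans hj
    rw [g2] at h2 h3
    refine (Does.seq (T := 120) (T' := 3 * C + 80) (Q := fun s3 => s3.real 37 0 0 0 = c ∧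
      Frame [] [37] s2 s3) ?cross fun s3 hs3 => ?copy).mono_cost (by omega)
    case cross =>
      have hD : Does (.ite (.realLE (realVar 21) (realVar 36))
            (assignReal 37 (gridPoint u w (natVar 22)))
            (.ite (.realLE (realVar 36) (realVar 22))
              (assignReal 37 (gridPoint u w (.add (natVar 22) (.lit 1))))
              (assignReal 37 (.add (gridPoint u w (natVar 22))
                (.div (.mul (.sub (realVar 21) (realVar 36))
                    (.sub (gridPoint u w (.add (natVar 22) (.lit 1))) (gridPoint u w (natVar 22))))
                  (.sub (realVar 21) (realVar 22))))))) s2 120 (fun s3 => s3.real 37 0 0 0 = c) := by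
        refine (Does.ite (T := 110) (fun hb => ?_) fun hb => (Does.ite (T := 100) (fun hb' => ?_)
          fun hb' => ?_).mono_cost ?_).mono_cost ?_
        · simp [Test.Holds, NExp.eval, RExp.eval, h2, k36] at hb
          refine (Does.setReal ?_).mono_cost (by simp [NExp.cost, RExp.cost])
          simp [NExp.eval, RExp.eval, ku, kw, k22, k2, hc, crossing, hb]
        · simp [Test.Holds, NExp.eval, RExp.eval, h2, h3, k36] at hb hb'
          refine (Does.setReal ?_).mono_cost (by simp [NExp.cost, RExp.cost])
          simp [NExp.eval, RExp.eval, ku, kw, k22, k2, hc, crossing, hb, hb']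
        · simp [Test.Holds, NExp.eval, RExp.eval, h2, h3, k36] at hb hb'
          refine (Does.setReal ?_).mono_cost (by simp [NExp.cost, RExp.cost])
          rw [hc, crossing, if_neg (not_le.2 hb), if_neg (not_le.2 (by linarith))]
          simp [NExp.eval, RExp.eval, ku, kw, k22, k2, h2, h3, k36]
        · simp [NExp.cost, RExp.cost, Test.cost]
        · simp [NExp.cost, RExp.cost, Test.cost]
      exact hD.frame.mono le_rfl fun s' hs' => ⟨hs'.1, hs'.2.mono (by simp [Program.natWrites])
        (by simp [Program.realWrites])⟩
    case copy =>
    obtain ⟨h37, hF3⟩ := hs3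
    have m2 : s3.real 2 = s.real 2 := by
      rw [← k2]
      funext x y z
      exact hF3.real 2 (by simp) x y z
    have mu := (hF3.nat 10 (by simp) u 0 0).trans ku
    have mw := (hF3.nat 10 (by simp) w 0 0).trans kw
    have m22 := (hF3.nat 22 (by simp) 0 0 0).trans k22
    refine (Does.mono (Does.forLoop (lo := 0) (hi := a + 1) (c := 80) (fun i s' =>
      (∀ l, l < i → s'.real 2 b (a + 1) l = insertAfter (s.real 2 b a) j c l) ∧
        ∀ d K, ¬ (d = b ∧ K = a + 1) → ∀ i, s'.real 2 d K i = s.real 2 d K i)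
      ?_ ?_ ?_ ?_ ?_ ?_) le_rfl fun s4 hs4 => ?fin).mono_cost ?cost4
    case cost4 =>
      simp only [NExp.cost]
      omega
    case fin =>
      exact ⟨hgrid.congr fun l hl => hs4.2.1 l (by omega), hs4.2.2⟩
    · simp [Program.natWrites]
    · simp [NExp.eval]
    · omega
    · intro s' hF
      have := hF.nat 10 (by simp [Program.natWrites]) u 0 0
      simp [mu] at this
      simp [NExp.eval, this]
    · exact ⟨fun l hl => by omega, fun d K _ i => by simp [m2]⟩
    · intro i s' _ hi2 hF hi hI
      obtain ⟨hloop, hother⟩ := hI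
      have e1 := hF.nat 10 (by simp [Program.natWrites]) u 0 0
      have e2 := hF.nat 10 (by simp [Program.natWrites]) w 0 0
      have e3 := hF.nat 22 (by simp [Program.natWrites]) 0 0 0
      have e4 := hF.real 37 (by simp [Program.realWrites]) 0 0 0
      rw [mu] at e1
      rw [mw] at e2
      rw [m22] at e3
      rw [h37] at e4
      have e5 := hother b a (by omega)
      have hput : ∀ x, x = insertAfter (s.real 2 b a) j c i →
          (∀ l, l < i + 1 → ((s'.putReal 2 b (a + 1) i x).putNat 26 0 0 0 (i + 1)).real 2 b
            (a + 1) l = insertAfter (s.real 2 b a) j c l) ∧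
          ∀ d K, ¬ (d = b ∧ K = a + 1) → ∀ l, ((s'.putReal 2 b (a + 1) i x).putNat 26 0 0 0
            (i + 1)).real 2 d K l = s.real 2 d K l := by
        intro x hx
        refine ⟨fun l hl => ?_, fun d K hdK l => ?_⟩
        · by_cases hli : l = i
          · simp [hli, hx]
          · simpa [hli] using hloop l (by omega)
        · have : ¬ (d = b ∧ K = a + 1 ∧ l = i) := fun hc => hdK ⟨hc.1, hc.2.1⟩
          simpa [this] using hother d K hdK l
      refine (Does.ite (T := 60) (fun hb => ?_) fun hb => (Does.ite (T := 40) (fun hb' => ?_)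
        fun hb' => ?_).mono_cost ?_).mono_cost ?_
      · simp only [Test.Holds, NExp.eval, hi, e3] at hb
        refine (Does.setReal ?_).mono_cost (by simp [NExp.cost, RExp.cost])
        simp only [NExp.eval, RExp.eval, e1, e2, hi]
        refine hput _ ?_
        rw [e5, insertAfter, if_pos hb]
      · simp only [Test.Holds, NExp.eval, hi, e3] at hb hb'
        refine (Does.setReal ?_).mono_cost (by simp [NExp.cost, RExp.cost])
        simp only [NExp.eval, RExp.eval, e1, e2, hi]
        refine hput _ ?_
        rw [e4, insertAfter, if_neg hb, if_pos hb']
      · simp only [Test.Holds, NExp.eval, hi, e3] at hb hb'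
        refine (Does.setReal ?_).mono_cost (by simp [NExp.cost, RExp.cost])
        simp only [NExp.eval, RExp.eval, e1, e2, hi]
        refine hput _ ?_
        rw [e5, insertAfter, if_neg hb, if_neg hb']
      · simp [NExp.cost, Test.cost]
      · simp [NExp.cost, Test.cost]
  refine hD.frame.mono le_rfl fun s' hs' => ⟨hs'.1, hs'.2.mono ?_ ?_⟩
  · intro x
    simp [refineProgram, binarySearch, endsProgram, subgameProgram, Program.natWrites, rollProgram,
      forLoop]
    omega
  · intro x
    simp [refineProgram, binarySearch, endsProgram, subgameProgram, Program.realWrites,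
      rollProgram, forLoop]
    omega

/-- Solve the sub-game with the needs given by the arguments `u` and `w`. -/
def solveProgram (u w : ℕ) : Program :=
  .seq (lineProgram u w 30) (.seq (lineProgram w u 31) (.seq (outputProgram u w)
    (refineProgram u w)))

theorem solveProgram_spec {n : ℕ} {p : PMF (Fin (n + 1))} (hp : p 0 < 1) {u w a b : ℕ}
    {s : Store} (h : Ready p u w a b s) (h' : Ready p w u b a s) {N k : ℕ} (ha : a ≤ N)
    (hb : b ≤ N) (hN : N ≤ 2 ^ k) :
    Does (solveProgram u w) s (20 * (120 * (n + 1) * N) * (k + 1)) fun s' =>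
      (Solved p a b s' ∧ IsGrid p b (a + 1) (s'.real 2 b (a + 1)) ∧
        (∀ c d, ¬ (c = a ∧ d = b) → ∀ τ, s'.real 1 c d τ = s.real 1 c d τ ∧
          s'.nat 1 c d τ = s.nat 1 c d τ) ∧
        ∀ d K, ¬ (d = b ∧ K = a + 1) → ∀ i, s'.real 2 d K i = s.real 2 d K i) ∧
      Frame [1, 20, 21, 22, 23, 24, 25, 26]
        [1, 2, 3, 20, 21, 22, 30, 31, 34, 35, 36, 37] s s' := by
  set C := 120 * (n + 1) * N with hCdef
  refine Does.mono_cost (T := (3 * C * k + 4 * C) + ((3 * C * k + 4 * C) + (3 * C +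
    (2 * C * k + 8 * C)))) ?_ (by nlinarith [Nat.zero_le (C * k)])
  refine Does.seq (lineProgram_spec hp h h' ha hb hN (r := 30) (by norm_num)) fun s1 hs1 => ?_
  obtain ⟨⟨hs, hx⟩, hF1⟩ := hs1
  have r1 := h.of_frame hF1 (by simp) (by simp) (by simp) (by simp) (by simp)
  have r1' := h'.of_frame hF1 (by simp) (by simp) (by simp) (by simp) (by simp)
  refine Does.seq (lineProgram_spec hp r1' r1 hb ha hN (r := 31) (by norm_num)) fun s2 hs2 => ?_
  obtain ⟨⟨ht, hy⟩, hF2⟩ := hs2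
  have r2 := r1.of_frame hF2 (by simp) (by simp) (by simp) (by simp) (by simp)
  have e := hF2.real 30 (by simp)
  refine Does.seq (outputProgram_spec r2 ha (by rw [e]; exact hs) ht (by rw [e, e]; exact hx) hy)
    fun s3 hs3 => ?_
  obtain ⟨⟨hsol, h35, hother⟩, hF3⟩ := hs3
  have r3 : Ready p u w a b s3 := by
    refine ⟨r2.die.of_frame hF3 (by simp) (by simp), (hF3.nat 10 (by simp) _ _ _).trans r2.fst,
      (hF3.nat 10 (by simp) _ _ _).trans r2.snd, r2.pos, fun i h1 h2 => ?_,
      r2.grid.congr fun _ _ => hF3.real 2 (by simp) _ _ _⟩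
    rw [(hother b i (by omega) 0).1]
    exact r2.value i h1 h2
  refine (refineProgram_spec hp r3 ha hN h35).mono le_rfl fun s4 hs4 => ?_
  obtain ⟨⟨hgrid, hother2⟩, hF4⟩ := hs4
  refine ⟨⟨hsol.congr (fun τ => hF4.real 1 (by simp) _ _ _) fun τ => hF4.nat 1 (by simp) _ _ _,
    hgrid, fun c d hcd τ => ⟨?_, ?_⟩, fun d K hdK i => ?_⟩, ?_⟩
  · rw [hF4.real 1 (by simp), (hother c d hcd τ).1, hF2.real 1 (by simp), hF1.real 1 (by simp)]
  · rw [hF4.nat 1 (by simp), (hother c d hcd τ).2, hF2.nat 1 (by simp), hF1.nat 1 (by simp)]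
  · rw [hother2 d K hdK i, hF3.real 2 (by simp), hF2.real 2 (by simp), hF1.real 2 (by simp)]
  · refine (((hF1.mono ?_ ?_).trans (hF2.mono ?_ ?_)).trans (hF3.mono ?_ ?_)).trans
      (hF4.mono ?_ ?_) <;> simp

/-! ### The whole computation -/

/-- The state of the computation in which the sub-games with needs in `D` are solved. -/
structure Progress {n : ℕ} (p : PMF (Fin (n + 1))) (N : ℕ) (D : ℕ → ℕ → Prop) (s : Store) :
    Prop where
  die : HasDie p s
  target : s.nat 0 1 0 0 = N
  solved : ∀ a b, 1 ≤ a → a ≤ N → 1 ≤ b → b ≤ N → D a b →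
    Solved p a b s ∧ IsGrid p b (a + 1) (s.real 2 b (a + 1))
  grid : ∀ b, 1 ≤ b → b ≤ N → IsGrid p b 1 (s.real 2 b 1)

theorem Progress.mono {n : ℕ} {p : PMF (Fin (n + 1))} {N : ℕ} {D D' : ℕ → ℕ → Prop} {s : Store}
    (h : Progress p N D s)
    (hD : ∀ a b, 1 ≤ a → a ≤ N → 1 ≤ b → b ≤ N → D' a b → D a b) : Progress p N D' s where
  die := h.die
  target := h.target
  solved a b h1 h2 h3 h4 h5 := h.solved a b h1 h2 h3 h4 (hD a b h1 h2 h3 h4 h5)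
  grid := h.grid

theorem Progress.of_frame {n : ℕ} {p : PMF (Fin (n + 1))} {N : ℕ} {D : ℕ → ℕ → Prop}
    {s s' : Store} {ns rs : List ℕ} (h : Progress p N D s) (hF : Frame ns rs s s') (h0 : 0 ∉ ns)
    (h1 : 1 ∉ ns) (hr0 : 0 ∉ rs) (hr1 : 1 ∉ rs) (hr2 : 2 ∉ rs) : Progress p N D s' where
  die := h.die.of_frame hF h0 hr0
  target := (hF.nat 0 h0 _ _ _).trans h.target
  solved a b g1 g2 g3 g4 g5 := by
    obtain ⟨hs, hg⟩ := h.solved a b g1 g2 g3 g4 g5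
    exact ⟨hs.congr (fun τ => hF.real 1 hr1 _ _ _) fun τ => hF.nat 1 h1 _ _ _,
      hg.congr fun k _ => hF.real 2 hr2 _ _ _⟩
  grid b g1 g2 := (h.grid b g1 g2).congr fun k _ => hF.real 2 hr2 _ _ _

theorem Progress.putNat {n : ℕ} {p : PMF (Fin (n + 1))} {N : ℕ} {D : ℕ → ℕ → Prop}
    {s : Store} (h : Progress p N D s) {A : ℕ} (hA : 1 < A) (i j k x : ℕ) :
    Progress p N D (s.putNat A i j k x) :=
  h.of_frame ((Frame.refl [A] [] s).putNat (List.mem_singleton_self A) i j k x)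
    (by simp; omega) (by simp; omega) (by simp) (by simp) (by simp)

theorem Progress.ready {n : ℕ} {p : PMF (Fin (n + 1))} {N : ℕ} {D : ℕ → ℕ → Prop} {s : Store}
    (h : Progress p N D s) {u w a b : ℕ} (hu : s.nat 10 u 0 0 = a) (hw : s.nat 10 w 0 0 = b)
    (ha : 1 ≤ a) (ha' : a ≤ N) (hb : 1 ≤ b) (hb' : b ≤ N)
    (h1 : ∀ i, 1 ≤ i → i < a → D b i) (h2 : ∀ i, 1 ≤ i → i < a → D i b) :
    Ready p u w a b s := by
  refine ⟨h.die, hu, hw, ha, fun i hi hia => ?_, ?_⟩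
  · have := (h.solved b i hb hb' hi (by omega) (h1 i hi hia)).1.value 0 hb
    rw [turnValue, if_pos rfl] at this
    exact this
  · rcases Nat.lt_or_ge 1 a with h1a | h1a
    · have := (h.solved (a - 1) b (by omega) (by omega) hb hb' (h2 _ (by omega) (by omega))).2
      rwa [Nat.sub_add_cancel ha] at this
    · obtain rfl : a = 1 := by omega
      exact h.grid b hb hb'

/-- The effect of `solveProgram` on the progress of the computation. -/
theorem Progress.solveProgram {n : ℕ} {p : PMF (Fin (n + 1))} (hp : p 0 < 1) {N k : ℕ}
    {D : ℕ → ℕ → Prop} {s : Store} (h : Progress p N D s) {u w a b : ℕ}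
    (hu : s.nat 10 u 0 0 = a) (hw : s.nat 10 w 0 0 = b)
    (ha : 1 ≤ a) (ha' : a ≤ N) (hb : 1 ≤ b) (hb' : b ≤ N) (hN : N ≤ 2 ^ k)
    (h1 : ∀ i, 1 ≤ i → i < a → D b i ∧ D i b) (h2 : ∀ i, 1 ≤ i → i < b → D a i ∧ D i a) :
    Does (solveProgram u w) s (20 * (120 * (n + 1) * N) * (k + 1)) fun s' =>
      Progress p N (fun c d => D c d ∨ (c = a ∧ d = b)) s' ∧
        ∀ i j k, s'.nat 10 i j k = s.nat 10 i j k := by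
  have r := h.ready hu hw ha ha' hb hb' (fun i g1 g2 => (h1 i g1 g2).1)
    fun i g1 g2 => (h1 i g1 g2).2
  have r' := h.ready hw hu hb hb' ha ha' (fun i g1 g2 => (h2 i g1 g2).1)
    fun i g1 g2 => (h2 i g1 g2).2
  refine (solveProgram_spec hp r r' ha' hb' hN).mono le_rfl fun s' hs' => ?_
  obtain ⟨⟨hsol, hgrid, hother, hother2⟩, hF⟩ := hs'
  refine ⟨⟨h.die.of_frame hF (by simp) (by simp), (hF.nat 0 (by simp) _ _ _).trans h.target,
    fun c d g1 g2 g3 g4 hD => ?_, fun d g1 g2 => ?_⟩, hF.nat 10 (by simp)⟩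
  · by_cases hcd : c = a ∧ d = b
    · obtain ⟨rfl, rfl⟩ := hcd
      exact ⟨hsol, hgrid⟩
    · obtain ⟨hs, hg⟩ := h.solved c d g1 g2 g3 g4 (hD.resolve_right hcd)
      exact ⟨hs.congr (fun τ => (hother c d hcd τ).1) fun τ => (hother c d hcd τ).2,
        hg.congr fun k _ => hother2 d (c + 1) (by omega) k⟩
  · exact (h.grid d g1 g2).congr fun k _ => hother2 d 1 (by omega) k

/-- Initialize the grids and solve the sub-games in the order of the larger need, and then of the
smaller one. -/
def pigProgram : Program :=
  .seq (forLoop 14 (.lit 1) (.get 0 (.lit 1) (.lit 0) (.lit 0))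
      (.seq (.setReal 2 (natVar 14) (.lit 1) (.lit 0) .zero)
        (.setReal 2 (natVar 14) (.lit 1) (.lit 1) (.add .one .one))))
    (forLoop 12 (.lit 1) (.get 0 (.lit 1) (.lit 0) (.lit 0))
      (forLoop 13 (.lit 1) (natVar 12)
        (.seq (.setNat 10 (.lit 0) (.lit 0) (.lit 0) (natVar 12))
          (.seq (.setNat 10 (.lit 1) (.lit 0) (.lit 0) (natVar 13))
            (.seq (solveProgram 0 1) (solveProgram 1 0))))))

/-- The sub-games that are solved when the counters of the two loops are `m` and `b`. -/
def Before (m b c d : ℕ) : Prop := (c < m ∧ d < m) ∨ (c = m ∧ d < b) ∨ (c < b ∧ d = m)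

/-- One pass of the inner loop solves the sub-games `(m,b)` and `(b,m)`; they depend only on sub-games
solved before. -/
theorem pair_spec {n : ℕ} {p : PMF (Fin (n + 1))} (hp : p 0 < 1) {N k m b : ℕ} {s : Store}
    (h : Progress p N (Before m b) s) (hm : s.nat 12 0 0 0 = m) (hb : s.nat 13 0 0 0 = b)
    (hb1 : 1 ≤ b) (hbm : b ≤ m) (hmN : m ≤ N) (hN : N ≤ 2 ^ k) :
    Does (.seq (.setNat 10 (.lit 0) (.lit 0) (.lit 0) (natVar 12))
      (.seq (.setNat 10 (.lit 1) (.lit 0) (.lit 0) (natVar 13))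
        (.seq (solveProgram 0 1) (solveProgram 1 0)))) s
      (41 * (120 * (n + 1) * N) * (k + 1)) (Progress p N (Before m (b + 1))) := by
  have hC : 120 ≤ 120 * (n + 1) * N := by nlinarith [Nat.zero_le (n * N)]
  set C := 120 * (n + 1) * N with hCdef
  refine (Does.setNat_seq (Does.setNat_seq (Does.seq (T := 20 * C * (k + 1))
    (T' := 20 * C * (k + 1)) (Q := fun s' =>
      Progress p N (fun c d => Before m b c d ∨ (c = m ∧ d = b)) s' ∧
        s'.nat 10 0 0 0 = m ∧ s'.nat 10 1 0 0 = b) ?first fun s' hs' => ?second))).mono_cost ?cost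
  case cost =>
    simp only [NExp.cost]
    nlinarith [Nat.zero_le (C * k)]
  case first =>
    refine (Progress.solveProgram hp ((h.putNat (by norm_num) _ _ _ _).putNat (by norm_num) _ _ _ _)
      (a := m) (b := b) ?_ ?_ (by omega) hmN hb1 (by omega) hN ?_ ?_).mono le_rfl ?_
    · simp [NExp.eval, hm]
    · simp [NExp.eval, hb]
    · intro i h1 h2; unfold Before; omega
    · intro i h1 h2; unfold Before; omega
    · rintro s' ⟨h1, h2⟩
      exact ⟨h1, by rw [h2]; simp [NExp.eval, hm], by rw [h2]; simp [NExp.eval, hb]⟩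
  case second =>
    obtain ⟨hs', e0, e1⟩ := hs'
    refine (hs'.solveProgram hp e1 e0 hb1 (by omega) (by omega) hmN hN ?_ ?_).mono le_rfl ?_
    · intro i h1 h2; unfold Before; omega
    · intro i h1 h2; unfold Before; omega
    · rintro s'' ⟨h1, -⟩
      refine h1.mono fun c d _ _ _ _ hcd => ?_
      unfold Before at hcd ⊢
      omega

/-- A bound for the number of steps of `pigProgram`: there are `N²` passes of the inner loop, each of
which makes two binary searches per line and grid, with `O(log N)` evaluations of the functions of a
sub-game at a cost of at most `120 (n + 1) N`. -/
def timeBound (n N : ℕ) : ℕ := 46 * N ^ 2 * (120 * (n + 1) * N) * (Nat.log 2 N + 2)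

theorem pigProgram_spec {n : ℕ} {p : PMF (Fin (n + 1))} (hp : p 0 < 1) {N : ℕ} (hN1 : 1 ≤ N) :
    Does pigProgram (inputStore p N) (timeBound n N) (Progress p N fun _ _ => True) := by
  have hN : N ≤ 2 ^ (Nat.log 2 N + 1) := (Nat.lt_pow_succ_log_self (by norm_num) N).le
  unfold timeBound
  have hC : 120 ≤ 120 * (n + 1) * N := by nlinarith [Nat.zero_le (n * N)]
  set C := 120 * (n + 1) * N with hCdef
  set k := Nat.log 2 N + 1 with hk
  have hwrites : (12 ∉ (solveProgram 0 1).natWrites ∧ 13 ∉ (solveProgram 0 1).natWrites ∧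
      0 ∉ (solveProgram 0 1).natWrites) ∧ (12 ∉ (solveProgram 1 0).natWrites ∧
      13 ∉ (solveProgram 1 0).natWrites ∧ 0 ∉ (solveProgram 1 0).natWrites) := by
    simp [solveProgram, lineProgram, outputProgram, refineProgram, endsProgram, binarySearch,
      subgameProgram, rollProgram, forLoop, Program.natWrites]
  refine (Does.seq (Does.mono (Does.forLoop (lo := 1) (hi := N) (c := 30) (fun d s =>
    HasDie p s ∧ s.nat 0 1 0 0 = N ∧ ∀ b, 1 ≤ b → b < d → s.real 2 b 1 0 = 0 ∧
      s.real 2 b 1 1 = 2) ?_ ?_ ?_ ?_ ?_ ?_) le_rfl (Q' := Progress p N (Before 1 1))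
      fun s hs => ?start) fun s hs => Does.mono (Does.forLoop (lo := 1) (hi := N)
      (c := 15 + N * (41 * C * (k + 1) + 20)) (fun m s => Progress p N (Before m 1) s)
      ?_ ?_ ?_ ?_ ?_ ?_) le_rfl fun s' hs' => ?fin).mono_cost ?cost
  case cost =>
    simp only [NExp.cost, Nat.add_sub_cancel]
    have hk2 : Nat.log 2 N + 2 = k + 1 := by omega
    rw [hk2]
    have h1 : N * (15 + N * (41 * C * (k + 1) + 20) + (1 + 1 + 1 + 1) + 16) + N * 50 + 30 ≤
        46 * N ^ 2 * C * (k + 1) := by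
      have e1 : N ≤ N ^ 2 := by nlinarith
      have e2 : 120 ≤ C * (k + 1) := by nlinarith [Nat.zero_le (C * k)]
      have e3 : N ^ 2 * 120 ≤ N ^ 2 * (C * (k + 1)) := Nat.mul_le_mul_left _ e2
      nlinarith
    omega
  case start =>
    obtain ⟨-, hdie, htar, hinit⟩ := hs
    refine ⟨hdie, htar, fun c d h1 _ h2 _ hD => ?_, fun b h1 h2 => ?_⟩
    · unfold Before at hD; omega
    · obtain ⟨g1, g2⟩ := hinit b h1 (by omega)
      exact isGrid_one p b g1 g2
  case fin =>
    refine hs'.2.mono fun c d h1 h2 h3 h4 _ => ?_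
    unfold Before; omega
  · simp [Program.natWrites]
  · simp [NExp.eval]
  · omega
  · intro s hF
    have := hF.nat 0 (by simp [Program.natWrites]) 1 0 0
    simp [inputStore] at this
    simp [NExp.eval, this]
  · refine ⟨⟨by simp [inputStore], fun i => ?_⟩, by simp [inputStore], fun b _ _ => by omega⟩
    simp [inputStore]
    intro hi
    omega
  · intro d s h1 h2 hF hd hI
    obtain ⟨hdie, htar, hinit⟩ := hI
    refine (Does.setReal_seq (Does.setReal ?_)).mono_cost (by simp [NExp.cost, RExp.cost])
    refine ⟨⟨by simp [hdie.1], fun i => by simp [hdie.2]⟩, by simp [htar], fun b hb1 hb2 => ?_⟩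
    simp only [NExp.eval, RExp.eval, Store.putReal_nat, hd]
    by_cases hbd : b = d
    · simp [hbd]
      norm_num
    · simpa [hbd] using hinit b hb1 (by omega)
  · simp [forLoop, Program.natWrites, hwrites]
  · simp [NExp.eval]
  · omega
  · intro s' hF
    have := hF.nat 0 (by simp [forLoop, Program.natWrites, hwrites]) 1 0 0
    simp [NExp.eval, this, hs.target]
  · exact hs.putNat (by norm_num) _ _ _ _
  · intro m s1 hm1 hm2 hF hm hI
    refine (Does.mono (Does.forLoop (lo := 1) (hi := m) (c := 41 * C * (k + 1)) (fun b s =>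
      Progress p N (Before m b) s) ?_ ?_ ?_ ?_ ?_ ?_) le_rfl fun s2 hs2 => ?post).mono_cost ?cost1
    case cost1 =>
      simp only [NExp.cost, Nat.add_sub_cancel]
      have : m * (41 * C * (k + 1) + (1 + 1 + 1 + 1) + 16) ≤ N * (41 * C * (k + 1) + 20) :=
        Nat.mul_le_mul hm2 (by omega)
      omega
    case post =>
      refine (hs2.2.putNat (by norm_num) _ _ _ _).mono fun c d h1 h2 h3 h4 hcd => ?_
      unfold Before at hcd ⊢
      omega
    · simp [Program.natWrites, hwrites]
    · simp [NExp.eval]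
    · omega
    · intro s' hF
      have := hF.nat 12 (by simp [Program.natWrites, hwrites]) 0 0 0
      simp [NExp.eval, this, hm]
    · exact hI.putNat (by norm_num) _ _ _ _
    · intro b s2 hb1 hb2 hF2 hb hI2
      have h12 := (hF2.nat 12 (by simp [Program.natWrites, hwrites]) 0 0 0).trans hm
      exact (pair_spec hp hI2 h12 hb hb1 hb2 hm2 hN).mono le_rfl fun s3 hs3 =>
        hs3.putNat (by norm_num) _ _ _ _

/-! ### Asymptotic running time -/

theorem finite_stateSet (n N : ℕ) : (stateSet n N).Finite := by
  have h : stateSet n N ⊆ insert State.go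
      ((fun x : Player × ℕ × ℕ × ℕ => State.turn x.1 x.2.1 x.2.2.1 x.2.2.2) ''
        (({.one, .two} : Set Player) ×ˢ Set.Iic N ×ˢ Set.Iic N ×ˢ Set.Iic (N + n))) := by
    intro s hs
    cases s with
    | go => exact Set.mem_insert _ _
    | turn j a b τ =>
      obtain ⟨ha, hb, hτ⟩ := turn_mem_stateSet.1 hs
      refine Set.mem_insert_of_mem _ ⟨(j, a, b, τ), ?_, rfl⟩
      simp only [Set.mem_prod, Set.mem_insert_iff, Set.mem_singleton_iff, Set.mem_Iic]
      cases j <;> simp only [Player.need] at hτ <;> refine ⟨by simp, ha.2, hb.2, by omega⟩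
  exact ((((Set.toFinite _).prod ((Set.finite_Iic N).prod ((Set.finite_Iic N).prod
    (Set.finite_Iic (N + n))))).image _).insert _).subset h

/-- There are at least `N³` states: the triples `(a, b, t)` with `t ≤ a` give states of player one
with need `a + 1` and turn score `t`, the others give states of player two. -/
theorem pow_le_numStates (n N : ℕ) : N ^ 3 ≤ numStates n N := by
  have hcard : (Finset.range N ×ˢ Finset.range N ×ˢ Finset.range N).card = N ^ 3 := by
    simp [Finset.card_product]
    ring
  rw [← hcard, ← Set.ncard_coe_finset, numStates]
  refine Set.ncard_le_ncard_of_injOn (fun x : ℕ × ℕ × ℕ => if x.2.2 ≤ x.1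
    then State.turn .one (x.1 + 1) (x.2.1 + 1) x.2.2
    else State.turn .two (x.2.1 + 1) (x.2.2 + 1) x.1) ?_ ?_ (finite_stateSet n N)
  · rintro ⟨a, b, t⟩ hx
    simp only [Finset.coe_product, Finset.coe_range, Set.mem_prod, Set.mem_Iio] at hx
    simp only
    split_ifs with h <;> refine turn_mem_stateSet.2 ?_ <;> simp only [Player.need] <;> omega
  · rintro ⟨a, b, t⟩ _ ⟨a', b', t'⟩ _ h
    simp only at h
    split_ifs at h with h1 h2 h2 <;> simp only [State.turn.injEq] at h
    · obtain ⟨-, h3, h4, h5⟩ := h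
      simp only [Prod.mk.injEq]; omega
    · exact absurd h.1 (by simp)
    · exact absurd h.1 (by simp)
    · obtain ⟨-, h3, h4, h5⟩ := h
      simp only [Prod.mk.injEq]; omega

theorem timeBound_isBigO (n : ℕ) : (fun N : ℕ => (timeBound n N : ℝ)) =O[Filter.atTop]
    (fun N : ℕ => (N : ℝ) ^ 3 * Real.log (N : ℝ)) := by
  refine Asymptotics.IsBigO.of_bound (46 * 120 * (n + 1) * 6) ?_
  filter_upwards [Filter.eventually_ge_atTop 2] with N hN
  have hN0 : (0 : ℝ) < N := by exact_mod_cast (by omega : 0 < N)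
  have hlog : 0 ≤ Real.log N := Real.log_nonneg (by exact_mod_cast (by omega : 1 ≤ N))
  rw [Real.norm_of_nonneg (Nat.cast_nonneg _), Real.norm_of_nonneg (by positivity)]
  have h1 : 1 ≤ Nat.log 2 N := Nat.log_pos (by norm_num) hN
  have h2 : (Nat.log 2 N : ℝ) ≤ 2 * Real.log N := by
    have h3 := Real.natLog_le_logb N 2
    rw [Real.logb, Nat.cast_ofNat, le_div_iff₀ (Real.log_pos (by norm_num))] at h3
    have h4 : (1 / 2 : ℝ) ≤ Real.log 2 := by linarith [Real.log_two_gt_d9]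
    nlinarith [(Nat.cast_nonneg (Nat.log 2 N) : (0 : ℝ) ≤ _)]
  have h5 : ((Nat.log 2 N + 2 : ℕ) : ℝ) ≤ 6 * Real.log N := by
    have : ((Nat.log 2 N + 2 : ℕ) : ℝ) ≤ 3 * (Nat.log 2 N : ℝ) := by
      exact_mod_cast (by omega : Nat.log 2 N + 2 ≤ 3 * Nat.log 2 N)
    linarith
  calc (timeBound n N : ℝ)
      = (46 * 120 * (n + 1) * N ^ 3) * ((Nat.log 2 N + 2 : ℕ) : ℝ) := by
        unfold timeBound; push_cast; ring
    _ ≤ (46 * 120 * (n + 1) * N ^ 3) * (6 * Real.log N) :=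
        mul_le_mul_of_nonneg_left h5 (by positivity)
    _ = _ := by ring

theorem timeBound_isBigO_numStates (n : ℕ) : (fun N : ℕ => (timeBound n N : ℝ)) =O[Filter.atTop]
    (fun N : ℕ => (numStates n N : ℝ) * Real.log (numStates n N : ℝ)) := by
  refine (timeBound_isBigO n).trans (Asymptotics.IsBigO.of_bound 1 ?_)
  filter_upwards [Filter.eventually_ge_atTop 1] with N hN
  have hN1 : (1 : ℝ) ≤ N := by exact_mod_cast hN
  have h1 : (N : ℝ) ^ 3 ≤ numStates n N := by exact_mod_cast pow_le_numStates n N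
  have h2 : (N : ℝ) ≤ numStates n N := (le_self_pow₀ hN1 (by norm_num)).trans h1
  have hlog : 0 ≤ Real.log N := Real.log_nonneg hN1
  have hlog2 : Real.log N ≤ Real.log (numStates n N) := Real.log_le_log (by linarith) h2
  rw [one_mul, Real.norm_of_nonneg (by positivity),
    Real.norm_of_nonneg (mul_nonneg (Nat.cast_nonneg _) (hlog.trans hlog2))]
  exact mul_le_mul h1 hlog2 hlog (Nat.cast_nonneg _)

end GenPig

open GenPig
theorem theorem1 :
    ∃ (P : Program) (T : ℕ → ℕ → ℕ),
      (∀ n : ℕ,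
        (fun N : ℕ => (T n N : ℝ)) =O[Filter.atTop]
            (fun N : ℕ => (N : ℝ) ^ 3 * Real.log (N : ℝ)) ∧
        (fun N : ℕ => (T n N : ℝ)) =O[Filter.atTop]
            (fun N : ℕ => (numStates n N : ℝ) * Real.log (numStates n N : ℝ))) ∧
      ∀ (n : ℕ) (p : PMF (Fin (n + 1))), p 0 < 1 → ∀ N : ℕ, 1 ≤ N →
        ∃ (t : ℕ) (out : Store), Runs P (inputStore p N) t out ∧ t ≤ T n N ∧
          (∀ s ∈ stateSet n N,
            HasValue p s (tableValue out.values s) ∧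
            OptimalForOne p s (tableStrategy out.actions) ∧
            OptimalForTwo p s (tableStrategy out.actions)) ∧
          (∀ a b : ℕ, 1 ≤ a → a ≤ N → 1 ≤ b → b ≤ N →
            (∀ x ∈ Set.Icc (0 : ℝ) 1, ∀ y ∈ Set.Icc (0 : ℝ) 1,
              (x = subgameFun p (fun c d => out.values c d 0) a b y ∧
                y = subgameFun p (fun c d => out.values c d 0) b a x) ↔
              (x = out.values a b 0 ∧ y = out.values b a 0)) ∧
            (∀ i : ℕ, 1 ≤ i → i < a →
              out.values a b (a - i) =
                turnFun p (fun c d => out.values c d 0) b (out.values b a 0) i)) := by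
  refine ⟨pigProgram, timeBound, fun n => ⟨timeBound_isBigO n, timeBound_isBigO_numStates n⟩,
    fun n p hp N hN => ?_⟩
  obtain ⟨t, out, hrun, ht, hprog⟩ := pigProgram_spec hp hN
  have hsol : ∀ a b, 1 ≤ a → a ≤ N → 1 ≤ b → b ≤ N → Solved p a b out :=
    fun a b h1 h2 h3 h4 => (hprog.solved a b h1 h2 h3 h4 trivial).1
  have hzero : ∀ a b, 1 ≤ a → a ≤ N → 1 ≤ b → b ≤ N → out.values a b 0 = gameValue p a b := by
    intro a b h1 h2 h3 h4
    rw [(hsol a b h1 h2 h3 h4).value 0 h1, turnValue, if_pos rfl]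
  refine ⟨t, out, hrun, ht, fun s hs => ?_, fun a b ha1 ha hb1 hb => ⟨fun x _ y _ => ?_,
    fun i hi1 hi => ?_⟩⟩
  · have hgreedy : GreedyTable p N out.actions := fun a b τ h1 h2 h3 h4 h5 h6 =>
      (hsol a b h1 h2 h3 h4).action τ h5 h6
    have htable : tableValue out.values s = tableValue (turnValue p) s := by
      cases s with
      | go => rfl
      | turn j a b τ =>
        obtain ⟨ha, hb, _⟩ := turn_mem_stateSet.1 hs
        cases j <;> simp only [tableValue] <;> split_ifs with hτ <;> try rfl
        · exact (hsol a b ha.1 ha.2 hb.1 hb.2).value τ hτ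
        · rw [(hsol b a hb.1 hb.2 ha.1 ha.2).value τ hτ]
    rw [htable]
    exact hasValue_and_optimal hp hgreedy hs
  · rw [subgameFun_congr p (w' := gameValue p) (a := a) y
        fun j h1 h2 => hzero b j hb1 hb h1 (by omega),
      subgameFun_congr p (w' := gameValue p) (a := b) x
        fun j h1 h2 => hzero a j ha1 ha h1 (by omega),
      hzero a b ha1 ha hb1 hb, hzero b a hb1 hb ha1 ha]
    constructor
    · rintro ⟨hx, hy⟩
      exact (slowlyAntitone_subgameFun hp (gameValue p) a b).system_unique
        (slowlyAntitone_subgameFun hp (gameValue p) b a) hx hy (gameValue_eq hp a b)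
        (gameValue_eq hp b a)
    · rintro ⟨rfl, rfl⟩
      exact ⟨gameValue_eq hp a b, gameValue_eq hp b a⟩
  · rw [(hsol a b ha1 ha hb1 hb).value (a - i) (by omega), turnValue, if_neg (by omega),
      Nat.sub_sub_self hi.le, hzero b a hb1 hb ha1 ha]
    exact (turnFun_congr p _ fun j h1 h2 => hzero b j hb1 hb h1 (by omega)).symm
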